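/- For complex $a,b,c,d,e,z$ (with $d,e$ not in $\mathbb{Z}_{\le 0}$) let $${}_3F_2(a,b,c;d,e;z)=\sum_{n\ge 0}\frac{(a)_n(b)_n(c)_n}{(d)_n(e)_n\,n!}z^n,\qquad (x)_n=x(x+1)\cdots(x+n-1),$$ whenever the series converges. Let $\eta(\tau)=q^{1/24}\prod_{n\ge1}(1-q^n)$, $q=e^{2\pi i\tau}$, $\operatorname{Im}\tau>0$, be the Dedekind eta function, and for a function $f$ on the upper half plane put $$L(f,1)=-2\pi i\int_0^{i\infty}f(t)\,dt,\qquad L(f,2)=-4\pi^2\int_0^{i\infty}f(t)\,t\,dt,$$ the integrals being taken along the imaginary axis. Let $$g_4(\tau)=\eta(4\tau)^6,\qquad g_3(\tau)=\eta(2\tau)^3\eta(6\tau)^3,\qquad f_{8.3.d.a}(\tau)=\eta(\tau)^2\eta(2\tau)\eta(4\tau)\eta(8\tau)^2 .$$ Theorem. All the series and integrals occurring below converge absolutely, and $${}_3F_2\left(\tfrac12,\tfrac12,\tfrac12;1,1;1\right)=\frac{2}{\sqrt3}\,{}_3F_2\left(\tfrac12,\tfrac16,\tfrac56;1,1;1\right)=\frac{8}{\pi}L(g_4,1)=\frac{16}{\pi^2}L(g_4,2),$$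 $${}_3F_2\left(\tfrac12,\tfrac13,\tfrac23;1,1;1\right)=\frac{6\sqrt3}{\pi}L(g_3,1)=\frac{18}{\pi^2}L(g_3,2),$$ $${}_3F_2\left(\tfrac12,\tfrac14,\tfrac34;1,1;1\right)=\sqrt2\,{}_3F_2\left(\tfrac12,\tfrac12,\tfrac12;1,1;-1\right)=\frac{12\sqrt2}{\pi}L(f_{8.3.d.a},1)=\frac{24}{\pi^2}L(f_{8.3.d.a},2).$$ -/

import Mathlib

namespace HypergeometricLValues

open Complex MeasureTheory

/-- The `n`-th term `(a)ₙ (b)ₙ (c)ₙ / ((d)ₙ (e)ₙ n!) zⁿ` of the hypergeometric series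
`₃F₂(a, b, c; d, e; z)`, where `(x)ₙ = x (x + 1) ⋯ (x + n - 1)`. -/
noncomputable def threeFTwoTerm (a b c d e z : ℂ) (n : ℕ) : ℂ :=
  ((ascPochhammer ℂ n).eval a * (ascPochhammer ℂ n).eval b * (ascPochhammer ℂ n).eval c) /
    ((ascPochhammer ℂ n).eval d * (ascPochhammer ℂ n).eval e * (n.factorial : ℂ)) * z ^ n

/-- The hypergeometric series `₃F₂(a, b, c; d, e; z)` converges (absolutely). -/
def ThreeFTwoConverges (a b c d e z : ℂ) : Prop :=
  Summable (threeFTwoTerm a b c d e z)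

/-- The value `₃F₂(a, b, c; d, e; z)`, as the sum of the hypergeometric series. -/
noncomputable def threeFTwo (a b c d e z : ℂ) : ℂ :=
  ∑' n : ℕ, threeFTwoTerm a b c d e z n

/-- The integral `∫₀^{i∞} g(t) dt` along the imaginary axis `t = i y`, `dt = i dy`, `y > 0`. -/
noncomputable def imagAxisIntegral (g : ℂ → ℂ) : ℂ :=
  ∫ y in Set.Ioi (0 : ℝ), g (I * y) * I

/-- The integral `∫₀^{i∞} g(t) dt` converges (absolutely). -/
def ImagAxisIntegrable (g : ℂ → ℂ) : Prop :=
  IntegrableOn (fun y : ℝ => g (I * y) * I) (Set.Ioi (0 : ℝ))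

/-- `L(f, 1) = -2πi ∫₀^{i∞} f(t) dt`. -/
noncomputable def LValueOne (f : ℂ → ℂ) : ℂ :=
  -2 * Real.pi * I * imagAxisIntegral f

/-- `L(f, 2) = -4π² ∫₀^{i∞} f(t) t dt`. -/
noncomputable def LValueTwo (f : ℂ → ℂ) : ℂ :=
  -4 * (Real.pi : ℂ) ^ 2 * imagAxisIntegral (fun t => f t * t)

/-- The integrals defining `L(f, 1)` and `L(f, 2)` both converge. -/
def LValuesConverge (f : ℂ → ℂ) : Prop :=
  ImagAxisIntegrable f ∧ ImagAxisIntegrable (fun t => f t * t)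

/-- The form `η(4τ)⁶`. -/
noncomputable def etaForm4 (τ : ℂ) : ℂ :=
  ModularForm.eta (4 * τ) ^ 6

/-- The form `η(2τ)³ η(6τ)³`. -/
noncomputable def etaForm3 (τ : ℂ) : ℂ :=
  ModularForm.eta (2 * τ) ^ 3 * ModularForm.eta (6 * τ) ^ 3

/-- The form `f_{8.3.d.a}(τ) = η(τ)² η(2τ) η(4τ) η(8τ)²`. -/
noncomputable def f83da (τ : ℂ) : ℂ :=
  ModularForm.eta τ ^ 2 * ModularForm.eta (2 * τ) * ModularForm.eta (4 * τ) *
    ModularForm.eta (8 * τ) ^ 2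

end HypergeometricLValues

open MeasureTheory Set Filter Topology

namespace HypergeometricLValues

/-! Write F(x) = ₂F₁(a, 1 - a; 1; x) and S(a) = ₃F₂(1/2, a, 1 - a; 1, 1; 1). Every quantity in the
theorem is tied to some S(a), and each S(a) has a closed form in Gamma values.

Hypergeometric side. Clausen's formula makes S(a) the square of ₂F₁(a/2, (1 - a)/2; 1; 1), which
Gauss's theorem sums (`hasSum_clausenCoeff`). At argument -1 the square is that of ₂F₁(1/4, 1/4; 1;
-1), a case of Kummer's theorem (`hasSum_gaussCoeff_neg_one`). Relations between two hypergeometric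
values thereby become relations between Gamma values, which follow from reflection, duplication and
triplication.

Modular side. Along the imaginary axis a modulus X(y) satisfies y = κ F(1 - X) / F(X), where F(X) is
a theta function. The Wronskian of F(x) and F(1 - x) gives dy = -κ sin(πa) / π · dx / (x (1 - x)
F²), and the eta products η⁶ and η(τ)³η(3τ)³ equal a constant times F(X)³ √(X (1 - X)). Their
integrals are therefore multiples of ∫ F(x) (x (1 - x))^(-1/2) dx, which is π S(a) by termwise
integration (`integral_comp_modulus`, `integral_hyp_mul_betaIntegrand`); a = 1/2 uses Jacobi's theta
constants and a = 1/3 the cubic theta functions of the Borweins. For the level eight form f, the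
combination f(y) + 4 f(2y) is an elliptic integrand with an extra factor √(1 + k) (`etaR8_add`). It
leads to ₃F₂(1/2, 1/2, 1/2; 3/4, 5/4; 1), and Thomae's transformation carries this to S(1/4). The
value at 2 is the value at 1 up to a factor, by the Fricke involution
(`integral_mul_id_of_inversion`).

That F(X) is a theta function rests on matching a rational transformation of F
(`hyp_half_quadratic`, `hyp_third_cubic`) with the behaviour of theta functions under y ↦ 2y or 3y:
the ratio of the two sides is then invariant, and it tends to 1 at infinity. The transformations are
proved by a Wronskian argument (`hyp_eq_mul_hyp`), and the theta relations by dissecting special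
cases of the Jacobi triple product (`hasSum_jacobi`). -/

/-! ### Rising factorials, the binomial series and termwise integration. -/

/-- The rising factorial `x (x + 1) ⋯ (x + n - 1)` of a real number. -/
noncomputable def rising (x : ℝ) (n : ℕ) : ℝ := (ascPochhammer ℝ n).eval x

@[simp] lemma rising_zero (x : ℝ) : rising x 0 = 1 := by simp [rising]

lemma rising_succ (x : ℝ) (n : ℕ) : rising x (n + 1) = rising x n * (x + n) := by
  simp [rising, ascPochhammer_succ_eval]

lemma rising_pos {x : ℝ} (hx : 0 < x) (n : ℕ) : 0 < rising x n := ascPochhammer_pos n x hx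

lemma rising_one (n : ℕ) : rising 1 n = n.factorial := by
  simp [rising]

lemma Gamma_add_natCast {x : ℝ} (hx : 0 < x) (n : ℕ) :
    Real.Gamma (x + n) = rising x n * Real.Gamma x := by
  induction n with
  | zero => simp
  | succ n ih =>
    rw [Nat.cast_succ, ← add_assoc, Real.Gamma_add_one (by positivity), ih, rising_succ]
    ring

lemma choose_eq_rising_div (a : ℝ) (n : ℕ) :
    Ring.choose (a + n - 1) n = rising a n / n.factorial := by
  rw [Ring.choose_eq_smul, Polynomial.descPochhammer_smeval_eq_ascPochhammer,
    Polynomial.ascPochhammer_smeval_cast, Polynomial.ascPochhammer_smeval_eq_eval, rising,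
    smul_eq_mul, show a + n - 1 - n + 1 = a by ring]
  ring

lemma HasSum.of_eq {M ι : Type*} [AddCommMonoid M] [TopologicalSpace M] {f g : ι → M} {a b : M}
    (h : HasSum f a) (hfg : ∀ n, g n = f n) (hab : b = a) : HasSum g b := by
  rw [hab, funext hfg]; exact h

/-- The binomial series. -/
lemma hasSum_rising_div_factorial (a : ℝ) {t : ℝ} (ht : |t| < 1) :
    HasSum (fun n : ℕ => rising a n / n.factorial * t ^ n) ((1 - t) ^ (-a)) := by
  have h := (Real.one_div_one_sub_rpow_hasFPowerSeriesOnBall_zero a).hasSum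
    (y := t) (by simpa [enorm_eq_nnnorm, ← NNReal.coe_lt_coe] using ht)
  have h1 : 0 ≤ 1 - t := by linarith [(abs_lt.1 ht).2]
  simp only [zero_add, one_div, ← Real.rpow_neg h1] at h
  refine HasSum.of_eq h (fun n => ?_) rfl
  simp [choose_eq_rising_div, mul_comm]

/-- Termwise integration of a series of nonnegative functions with integrable sum. -/
lemma hasSum_integral_of_nonneg {f : ℕ → ℝ → ℝ} {G : ℝ → ℝ} {s : Set ℝ} (hs : MeasurableSet s)
    (hf : ∀ n, IntegrableOn (f n) s) (h0 : ∀ n, ∀ x ∈ s, 0 ≤ f n x)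
    (hsum : ∀ x ∈ s, HasSum (fun n => f n x) (G x)) (hG : IntegrableOn G s) :
    HasSum (fun n => ∫ x in s, f n x) (∫ x in s, G x) := by
  rw [hasSum_iff_tendsto_nat_of_nonneg fun n => setIntegral_nonneg hs (h0 n)]
  simp_rw [← integral_finsetSum _ fun i _ => hf i]
  refine integral_tendsto_of_tendsto_of_monotone
    (fun n => integrable_finsetSum _ fun i _ => hf i) hG ?_ ?_
  · filter_upwards [ae_restrict_mem hs] with x hx
    exact fun m n hmn => Finset.sum_le_sum_of_subset_of_nonneg
      (Finset.range_mono hmn) fun i _ _ => h0 i x hx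
  · filter_upwards [ae_restrict_mem hs] with x hx
    exact (hsum x hx).tendsto_sum_nat

/-- A series of nonnegative functions with summable integrals has an integrable sum. -/
lemma integrableOn_of_summable_integral {f : ℕ → ℝ → ℝ} {G : ℝ → ℝ} {s : Set ℝ}
    (hs : MeasurableSet s)
    (hf : ∀ n, IntegrableOn (f n) s) (h0 : ∀ n, ∀ x ∈ s, 0 ≤ f n x)
    (hsum : ∀ x ∈ s, HasSum (fun n => f n x) (G x))
    (hS : Summable fun n => ∫ x in s, f n x) : IntegrableOn G s := by
  have hm : AEStronglyMeasurable G (volume.restrict s) := by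
    refine aestronglyMeasurable_of_tendsto_ae atTop
      (f := fun n x => ∑ i ∈ Finset.range n, f i x)
      (fun n => (integrable_finsetSum _ fun i _ => hf i).aestronglyMeasurable) ?_
    filter_upwards [ae_restrict_mem hs] with x hx
    exact (hsum x hx).tendsto_sum_nat
  have hG0 : 0 ≤ᵐ[volume.restrict s] G := by
    filter_upwards [ae_restrict_mem hs] with x hx
    exact (hsum x hx).nonneg fun n => h0 n x hx
  refine ⟨hm, ?_⟩
  rw [hasFiniteIntegral_iff_ofReal hG0]
  have h1 : ∫⁻ x in s, ENNReal.ofReal (G x) = ∫⁻ x in s, ∑' n, ENNReal.ofReal (f n x) := by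
    refine setLIntegral_congr_fun hs fun x hx => ?_
    rw [← (hsum x hx).tsum_eq,
      ENNReal.ofReal_tsum_of_nonneg (fun n => h0 n x hx) (hsum x hx).summable]
  rw [h1, lintegral_tsum fun n => (hf n).aemeasurable.ennreal_ofReal]
  have h2 (n : ℕ) : ∫⁻ x in s, ENNReal.ofReal (f n x) = ENNReal.ofReal (∫ x in s, f n x) := by
    rw [ofReal_integral_eq_lintegral_ofReal (hf n)]
    filter_upwards [ae_restrict_mem hs] with x hx using h0 n x hx
  simp_rw [h2]
  rw [← ENNReal.ofReal_tsum_of_nonneg (fun n => setIntegral_nonneg hs (h0 n)) hS]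
  exact ENNReal.ofReal_lt_top

/-! ### Beta integrals and Gauss's summation theorem. -/

/-- The beta function integrand. -/
noncomputable def betaIntegrand (u v x : ℝ) : ℝ := x ^ (u - 1) * (1 - x) ^ (v - 1)

lemma betaIntegrand_nonneg (u v : ℝ) {x : ℝ} (hx : x ∈ Ioo (0 : ℝ) 1) :
    0 ≤ betaIntegrand u v x :=
  mul_nonneg (Real.rpow_nonneg hx.1.le _) (Real.rpow_nonneg (by linarith [hx.2]) _)

lemma lintegral_betaIntegrand {u v : ℝ} (hu : 0 < u) (hv : 0 < v) :
    ∫⁻ x in Ioo (0 : ℝ) 1, ENNReal.ofReal (betaIntegrand u v x) =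
      ENNReal.ofReal (ProbabilityTheory.beta u v) := by
  have hb := ProbabilityTheory.beta_pos hu hv
  have h := ProbabilityTheory.lintegral_betaPDF_eq_one hu hv
  rw [ProbabilityTheory.lintegral_betaPDF] at h
  have h2 : ∀ x : ℝ, ENNReal.ofReal
      (1 / ProbabilityTheory.beta u v * x ^ (u - 1) * (1 - x) ^ (v - 1)) =
      ENNReal.ofReal (1 / ProbabilityTheory.beta u v) * ENNReal.ofReal (betaIntegrand u v x) := by
    intro x
    rw [← ENNReal.ofReal_mul (by positivity), betaIntegrand, mul_assoc]
  simp_rw [h2] at h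
  rw [lintegral_const_mul' _ _ ENNReal.ofReal_ne_top] at h
  have h3 : ENNReal.ofReal (ProbabilityTheory.beta u v) *
      ENNReal.ofReal (1 / ProbabilityTheory.beta u v) = 1 := by
    rw [← ENNReal.ofReal_mul hb.le, mul_one_div_cancel hb.ne', ENNReal.ofReal_one]
  rw [← one_mul (∫⁻ x in Ioo (0 : ℝ) 1, _), ← h3, mul_assoc, h, mul_one]

lemma measurable_betaIntegrand (u v : ℝ) : Measurable (betaIntegrand u v) := by
  unfold betaIntegrand; fun_prop

lemma integrableOn_betaIntegrand {u v : ℝ} (hu : 0 < u) (hv : 0 < v) :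
    IntegrableOn (betaIntegrand u v) (Ioo 0 1) := by
  refine ⟨(measurable_betaIntegrand u v).aestronglyMeasurable, ?_⟩
  rw [hasFiniteIntegral_iff_ofReal, lintegral_betaIntegrand hu hv]
  · exact ENNReal.ofReal_lt_top
  · filter_upwards [ae_restrict_mem measurableSet_Ioo] with x hx using betaIntegrand_nonneg u v hx

lemma integral_betaIntegrand {u v : ℝ} (hu : 0 < u) (hv : 0 < v) :
    ∫ x in Ioo (0 : ℝ) 1, betaIntegrand u v x =
      Real.Gamma u * Real.Gamma v / Real.Gamma (u + v) := by
  rw [integral_eq_lintegral_of_nonneg_ae, lintegral_betaIntegrand hu hv,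
    ENNReal.toReal_ofReal (ProbabilityTheory.beta_pos hu hv).le, ProbabilityTheory.beta]
  · filter_upwards [ae_restrict_mem measurableSet_Ioo] with x hx using betaIntegrand_nonneg u v hx
  · exact (measurable_betaIntegrand u v).aestronglyMeasurable

lemma pow_mul_betaIntegrand (u v : ℝ) (n : ℕ) {x : ℝ} (hx : x ∈ Ioo (0 : ℝ) 1) :
    x ^ n * betaIntegrand u v x = betaIntegrand (u + n) v x := by
  rw [betaIntegrand, betaIntegrand, ← mul_assoc, ← Real.rpow_natCast, ← Real.rpow_add hx.1]
  congr 2; ring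

/-- Moments of the beta distribution, up to normalization. -/
lemma integral_betaIntegrand_add {u v : ℝ} (hu : 0 < u) (hv : 0 < v) (n : ℕ) :
    ∫ x in Ioo (0 : ℝ) 1, betaIntegrand (u + n) v x =
      rising u n / rising (u + v) n * (Real.Gamma u * Real.Gamma v / Real.Gamma (u + v)) := by
  rw [integral_betaIntegrand (by positivity) hv, Gamma_add_natCast hu,
    show u + n + v = u + v + n by ring, Gamma_add_natCast (by positivity)]
  have := (rising_pos (add_pos hu hv) n).ne'
  have := (Real.Gamma_pos_of_pos (add_pos hu hv)).ne'
  field_simp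

/-- **Gauss's summation theorem** for positive parameters. -/
theorem hasSum_gauss {a b c : ℝ} (ha : 0 < a) (hb : 0 < b) (hc : a + b < c) :
    HasSum (fun n : ℕ => rising a n * rising b n / (rising c n * n.factorial))
      (Real.Gamma c * Real.Gamma (c - a - b) / (Real.Gamma (c - a) * Real.Gamma (c - b))) := by
  have hcb : 0 < c - b := by linarith
  -- The quotient (b)ₙ / (c)ₙ is the n-th moment of the beta density with parameters b and c - b.
  -- Summing under the integral produces (1 - t)^(-a), which only shifts the second beta exponent.
  have key := hasSum_integral_of_nonneg (s := Ioo (0 : ℝ) 1)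
    (f := fun n t => rising a n / n.factorial * betaIntegrand (b + n) (c - b) t)
    (G := betaIntegrand b (c - b - a)) measurableSet_Ioo
    (fun n => (integrableOn_betaIntegrand (by positivity) hcb).const_mul _)
    (fun n x hx => mul_nonneg (div_nonneg (rising_pos ha n).le (by positivity))
      (betaIntegrand_nonneg _ _ hx)) ?_ (integrableOn_betaIntegrand hb (by linarith))
  · simp_rw [integral_const_mul, integral_betaIntegrand_add hb hcb] at key
    rw [integral_betaIntegrand hb (by linarith)] at key
    have hΓb := (Real.Gamma_pos_of_pos hb).ne'
    have hΓcb := (Real.Gamma_pos_of_pos hcb).ne'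
    have hΓc := (Real.Gamma_pos_of_pos (show 0 < c by linarith)).ne'
    refine HasSum.of_eq (key.mul_right (Real.Gamma c / (Real.Gamma b * Real.Gamma (c - b))))
      (fun n => ?_) ?_
    · have := (rising_pos (show 0 < c by linarith) n).ne'
      rw [show b + (c - b) = c by ring]
      field_simp
    · rw [show b + (c - b - a) = c - a by ring, show c - b - a = c - a - b by ring]
      field_simp
  · intro x hx
    have h := (hasSum_rising_div_factorial a (t := x)
      (by rw [abs_of_pos hx.1]; exact hx.2)).mul_right (betaIntegrand b (c - b) x)
    refine HasSum.of_eq h (fun n => ?_) ?_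
    · rw [← pow_mul_betaIntegrand _ _ _ hx, mul_assoc]
    · rw [betaIntegrand, betaIntegrand, mul_left_comm, ← Real.rpow_add (by linarith [hx.2])]
      congr 2; ring

/-! ### Clausen's formula. -/

/-- The coefficients of `₂F₁(a, b; 1; z)`. -/
noncomputable def gaussCoeff (a b : ℝ) (n : ℕ) : ℝ := rising a n * rising b n / (n.factorial : ℝ) ^ 2

/-- The coefficients of `₃F₂(1/2, a, b; 1, 1; z)`. -/
noncomputable def clausenCoeff (a b : ℝ) (n : ℕ) : ℝ :=
  rising (1 / 2) n * rising a n * rising b n / (n.factorial : ℝ) ^ 3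

lemma gaussCoeff_pos {a b : ℝ} (ha : 0 < a) (hb : 0 < b) (n : ℕ) : 0 < gaussCoeff a b n :=
  div_pos (mul_pos (rising_pos ha n) (rising_pos hb n)) (by positivity)

lemma gaussCoeff_zero (a b : ℝ) : gaussCoeff a b 0 = 1 := by simp [gaussCoeff]

lemma gaussCoeff_succ (a b : ℝ) (n : ℕ) :
    ((n : ℝ) + 1) ^ 2 * gaussCoeff a b (n + 1) = (n + a) * (n + b) * gaussCoeff a b n := by
  have : (n.factorial : ℝ) ≠ 0 := by positivity
  have : (n : ℝ) + 1 ≠ 0 := by positivity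
  rw [gaussCoeff, gaussCoeff, rising_succ, rising_succ, Nat.factorial_succ]
  push_cast
  field_simp
  ring

lemma clausenCoeff_succ (a b : ℝ) (n : ℕ) :
    ((n : ℝ) + 1) ^ 3 * clausenCoeff a b (n + 1) =
      (n + 1 / 2) * (n + a) * (n + b) * clausenCoeff a b n := by
  have : (n.factorial : ℝ) ≠ 0 := by positivity
  have : (n : ℝ) + 1 ≠ 0 := by positivity
  rw [clausenCoeff, clausenCoeff, rising_succ, rising_succ, rising_succ, Nat.factorial_succ]
  push_cast
  field_simp
  ring

/-- The Euler operator `X d/dX` on formal power series. -/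
noncomputable def eulerOp : Derivation ℝ (PowerSeries ℝ) (PowerSeries ℝ) :=
  (PowerSeries.X : PowerSeries ℝ) • PowerSeries.derivative ℝ

lemma coeff_eulerOp (f : PowerSeries ℝ) (n : ℕ) :
    PowerSeries.coeff n (eulerOp f) = n * PowerSeries.coeff n f := by
  rw [eulerOp, Derivation.smul_apply, smul_eq_mul]
  cases n with
  | zero => simp
  | succ n =>
    rw [PowerSeries.coeff_succ_X_mul, PowerSeries.coeff_derivative]
    push_cast
    ring

lemma eulerOp_X : eulerOp (PowerSeries.X : PowerSeries ℝ) = PowerSeries.X := by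
  simp [eulerOp]

lemma eulerOp_C (r : ℝ) : eulerOp (PowerSeries.C r) = 0 := by
  simp [eulerOp]

/-- **Clausen's formula**, coefficientwise. -/
theorem sum_antidiagonal_gaussCoeff {a b : ℝ} (hab : a + b = 1 / 2) (n : ℕ) :
    ∑ kl ∈ Finset.HasAntidiagonal.antidiagonal n, gaussCoeff a b kl.1 * gaussCoeff a b kl.2 =
      clausenCoeff (2 * a) (2 * b) n := by
  set y : PowerSeries ℝ := PowerSeries.mk (gaussCoeff a b) with hy
  set p : PowerSeries ℝ := PowerSeries.C (a * b) with hp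
  -- The hypergeometric equation in terms of the Euler operator ϑ; the coefficient of ϑy uses a + b
  -- = 1/2.
  have h1 : 2 * eulerOp (eulerOp y) =
      PowerSeries.X * (2 * eulerOp (eulerOp y) + eulerOp y + 2 * p * y) := by
    ext n
    have h2 (f : PowerSeries ℝ) : 2 * f = PowerSeries.C (2 : ℝ) * f := by
      simp [map_ofNat]
    cases n with
    | zero =>
      have h3 := coeff_eulerOp (eulerOp y) 0
      simp [PowerSeries.coeff_zero_eq_constantCoeff] at h3
      simp [h2, h3]
    | succ n =>
      rw [PowerSeries.coeff_succ_X_mul, mul_assoc, h2, h2 (p * y), hp]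
      simp only [map_add, PowerSeries.coeff_C_mul, coeff_eulerOp, hy, PowerSeries.coeff_mk]
      have h := gaussCoeff_succ a b n
      push_cast
      linear_combination 2 * h + 2 * n * gaussCoeff a b n * hab
  have h3 := congrArg eulerOp h1
  have hp0 : eulerOp p = 0 := eulerOp_C _
  have h20 : eulerOp (2 : PowerSeries ℝ) = 0 := by
    rw [show (2 : PowerSeries ℝ) = ((2 : ℕ) : PowerSeries ℝ) by norm_num, Derivation.map_natCast]
  simp only [Derivation.leibniz, map_add, smul_eq_mul, eulerOp_X, hp0, h20, mul_zero,
    add_zero] at h3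
  set w := y * y with hw
  have hw1 : eulerOp w = 2 * y * eulerOp y := by
    rw [hw, Derivation.leibniz, smul_eq_mul]; ring
  have hw2 : eulerOp (eulerOp w) = 2 * (eulerOp y) ^ 2 + 2 * y * eulerOp (eulerOp y) := by
    rw [hw1]
    simp only [Derivation.leibniz, smul_eq_mul, h20]
    ring
  have hw3 : eulerOp (eulerOp (eulerOp w)) = 6 * eulerOp y * eulerOp (eulerOp y) +
      2 * y * eulerOp (eulerOp (eulerOp y)) := by
    rw [hw2, pow_two]
    simp only [map_add, Derivation.leibniz, smul_eq_mul, h20]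
    ring
  -- The square of a solution of a second order equation satisfies a third order one. It is a
  -- combination of `h1` and its ϑ-derivative `h3`, and its coefficient recursion is that of
  -- ₃F₂(1/2, 2a, 2b; 1, 1; z).
  have hode : 2 * eulerOp (eulerOp (eulerOp w)) = PowerSeries.X *
      (2 * eulerOp (eulerOp (eulerOp w)) + 3 * eulerOp (eulerOp w) + eulerOp w +
        8 * (p * eulerOp w) + 4 * (p * w)) := by
    rw [hw3, hw2, hw1, hw]
    linear_combination 2 * y * h3 + 6 * eulerOp y * h1
  have hrec (n : ℕ) : ((n : ℝ) + 1) ^ 3 * PowerSeries.coeff (n + 1) w =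
      (n + 1 / 2) * (n + 2 * a) * (n + 2 * b) * PowerSeries.coeff n w := by
    have h := congrArg (PowerSeries.coeff (n + 1)) hode
    rw [PowerSeries.coeff_succ_X_mul] at h
    simp only [← map_ofNat (PowerSeries.C (R := ℝ)), hp] at h
    simp only [map_add, PowerSeries.coeff_C_mul, coeff_eulerOp] at h
    push_cast at h
    linear_combination h / 2 - 2 * (n + 1 / 2) * n * PowerSeries.coeff n w * hab
  have hmain : PowerSeries.coeff n w = clausenCoeff (2 * a) (2 * b) n := by
    induction n with
    | zero => simp [hw, hy, clausenCoeff, gaussCoeff]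
    | succ n ih =>
      have h4 : ((n : ℝ) + 1) ^ 3 ≠ 0 := by positivity
      rw [← mul_right_inj' h4, hrec, clausenCoeff_succ, ih]
  rw [← hmain, hw, PowerSeries.coeff_mul]
  simp [hy]

/-- **Clausen's formula** on the boundary of the disc of convergence. -/
theorem hasSum_clausen {a b : ℝ} (ha : 0 < a) (hb : 0 < b) (hab : a + b = 1 / 2) {z s : ℝ}
    (hz : |z| ≤ 1) (h : HasSum (fun n => gaussCoeff a b n * z ^ n) s)
    (hs : Summable (gaussCoeff a b)) :
    HasSum (fun n => clausenCoeff (2 * a) (2 * b) n * z ^ n) (s ^ 2) := by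
  have hn : Summable fun n => ‖gaussCoeff a b n * z ^ n‖ := by
    refine Summable.of_nonneg_of_le (fun _ => norm_nonneg _) (fun n => ?_) hs
    rw [norm_mul, norm_pow, Real.norm_of_nonneg (gaussCoeff_pos ha hb n).le]
    exact mul_le_of_le_one_right (gaussCoeff_pos ha hb n).le
      (pow_le_one₀ (norm_nonneg _) (by simpa using hz))
  -- Since the coefficients themselves are summable, the Cauchy product converges absolutely even
  -- for |z| = 1.
  have h1 := tsum_mul_tsum_eq_tsum_sum_antidiagonal_of_summable_norm hn hn
  have h2 := (summable_norm_sum_mul_antidiagonal_of_summable_norm hn hn).of_norm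
  have h3 := h2.hasSum
  rw [← h1, h.tsum_eq] at h3
  refine HasSum.of_eq h3 (fun n => ?_) (by ring)
  rw [← sum_antidiagonal_gaussCoeff hab, Finset.sum_mul]
  refine Finset.sum_congr rfl fun kl hkl => ?_
  rw [← Finset.HasAntidiagonal.mem_antidiagonal.1 hkl, pow_add]
  ring

lemma hasSum_gaussCoeff {a b : ℝ} (ha : 0 < a) (hb : 0 < b) (hab : a + b < 1) :
    HasSum (gaussCoeff a b)
      (Real.Gamma (1 - a - b) / (Real.Gamma (1 - a) * Real.Gamma (1 - b))) := by
  refine HasSum.of_eq (hasSum_gauss ha hb hab) (fun n => ?_) (by rw [Real.Gamma_one, one_mul])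
  rw [gaussCoeff, rising_one, pow_two]

/-- The value of `₃F₂(1/2, a, 1 - a; 1, 1; 1)`. -/
theorem hasSum_clausenCoeff {a : ℝ} (ha : 0 < a) (ha1 : a < 1) :
    HasSum (clausenCoeff a (1 - a))
      (Real.pi / (Real.Gamma (1 - a / 2) * Real.Gamma ((1 + a) / 2)) ^ 2) := by
  have h1 := hasSum_gaussCoeff (a := a / 2) (b := (1 - a) / 2) (by linarith) (by linarith)
    (by linarith)
  -- The parameters a/2 and (1 - a)/2 add up to 1/2, so the numerator in Gauss's theorem is Γ(1/2),
  -- whose square is π.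
  have h2 := hasSum_clausen (a := a / 2) (b := (1 - a) / 2) (z := 1) (by linarith) (by linarith)
    (by ring) (by norm_num) (by simpa using h1) h1.summable
  refine HasSum.of_eq h2 (fun n => ?_) ?_
  · rw [one_pow, mul_one]; congr 1 <;> ring
  · rw [show 1 - a / 2 - (1 - a) / 2 = 1 / 2 by ring, Real.Gamma_one_half_eq, div_pow,
      Real.sq_sqrt Real.pi_pos.le, show 1 - (1 - a) / 2 = (1 + a) / 2 by ring]

/-! ### The value at argument -1. -/

/-- A case of Kummer's theorem: the value of `₂F₁(1/4, 1/4; 1; -1)`. -/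
lemma hasSum_gaussCoeff_neg_one :
    HasSum (fun n => gaussCoeff (1 / 4) (1 / 4) n * (-1) ^ n)
      (Real.Gamma (1 / 8) / (2 * Real.Gamma (1 / 4) * Real.Gamma (7 / 8))) := by
  have hΓ1 := (Real.Gamma_pos_of_pos (show (0 : ℝ) < 1 / 4 by norm_num)).ne'
  have hΓ3 := (Real.Gamma_pos_of_pos (show (0 : ℝ) < 3 / 4 by norm_num)).ne'
  have hΓ7 := (Real.Gamma_pos_of_pos (show (0 : ℝ) < 7 / 8 by norm_num)).ne'
  set B : ℝ := Real.Gamma (1 / 4) * Real.Gamma (3 / 4) with hB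
  -- Euler's integral: expanding (1 + t)^(-1/4) against the beta density gives `B` times the series.
  -- The factors (1 + t)^(-1/4) and (1 - t)^(-1/4) then merge into (1 - t²)^(-1/4).
  set f : ℕ → ℝ → ℝ := fun n t =>
    rising (1 / 4) n / n.factorial * (-1) ^ n * betaIntegrand (1 / 4 + n) (3 / 4) t with hf
  have hfi (n : ℕ) : IntegrableOn (f n) (Ioo 0 1) :=
    (integrableOn_betaIntegrand (by positivity) (by norm_num)).const_mul _
  have hval (n : ℕ) : ∫ t in Ioo (0 : ℝ) 1, betaIntegrand (1 / 4 + n) (3 / 4) t =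
      rising (1 / 4) n / n.factorial * B := by
    rw [integral_betaIntegrand_add (by norm_num) (by norm_num)]
    norm_num [rising_one, hB]
  have hnorm (n : ℕ) : ∫ t in Ioo (0 : ℝ) 1, ‖f n t‖ = gaussCoeff (1 / 4) (1 / 4) n * B := by
    have : ∀ t ∈ Ioo (0 : ℝ) 1, ‖f n t‖ =
        rising (1 / 4) n / n.factorial * betaIntegrand (1 / 4 + n) (3 / 4) t := by
      intro t ht
      simp only [hf, norm_mul, norm_pow, norm_neg, norm_one, one_pow, mul_one]
      rw [Real.norm_of_nonneg (betaIntegrand_nonneg _ _ ht), Real.norm_of_nonneg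
        (div_nonneg (rising_pos (by norm_num) n).le (by positivity))]
    rw [setIntegral_congr_fun measurableSet_Ioo this, integral_const_mul, hval, gaussCoeff]
    ring
  have hsum : Summable (gaussCoeff (1 / 4) (1 / 4)) :=
    (hasSum_gaussCoeff (by norm_num) (by norm_num) (by norm_num)).summable
  have key := hasSum_integral_of_summable_integral_norm (μ := volume.restrict (Ioo (0 : ℝ) 1)) hfi
    (by simp_rw [hnorm]; exact hsum.mul_right B)
  have hG (t : ℝ) (ht : t ∈ Ioo (0 : ℝ) 1) :
      ∑' n, f n t = t ^ (-(3 / 4) : ℝ) * (1 - t ^ 2) ^ (-(1 / 4) : ℝ) := by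
    have h := (hasSum_rising_div_factorial (1 / 4) (t := -t)
      (by rw [abs_neg, abs_of_pos ht.1]; exact ht.2)).mul_right (betaIntegrand (1 / 4) (3 / 4) t)
    refine (HasSum.of_eq h (fun n => ?_) ?_).tsum_eq
    · rw [hf]
      simp only
      rw [← pow_mul_betaIntegrand _ _ _ ht, neg_pow t]
      ring
    · rw [betaIntegrand, show 1 - t ^ 2 = (1 - -t) * (1 - t) by ring,
        Real.mul_rpow (by linarith [ht.1]) (by linarith [ht.2])]
      norm_num
      ring
  rw [setIntegral_congr_fun measurableSet_Ioo hG] at key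
  -- Evaluate the same integral by expanding in powers of t². The result is a series at argument 1,
  -- with parameters 1/4, 1/8; 9/8, to which Gauss's theorem applies.
  have key2 := hasSum_integral_of_nonneg (s := Ioo (0 : ℝ) 1)
    (f := fun n t => rising (1 / 4) n / n.factorial * betaIntegrand (1 / 4 + (2 * n : ℕ)) 1 t)
    (G := fun t => t ^ (-(3 / 4) : ℝ) * (1 - t ^ 2) ^ (-(1 / 4) : ℝ)) measurableSet_Ioo
    (fun n => (integrableOn_betaIntegrand (by positivity) one_pos).const_mul _)
    (fun n x hx => mul_nonneg (div_nonneg (rising_pos (by norm_num) n).le (by positivity))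
      (betaIntegrand_nonneg _ _ hx)) ?_ ?_
  · have hterm (n : ℕ) : ∫ t in Ioo (0 : ℝ) 1,
        rising (1 / 4) n / n.factorial * betaIntegrand (1 / 4 + (2 * n : ℕ)) 1 t =
        4 * (rising (1 / 4) n * rising (1 / 8) n / (rising (9 / 8) n * n.factorial)) := by
      rw [integral_const_mul, integral_betaIntegrand (by positivity) one_pos, Real.Gamma_one,
        mul_one, Real.Gamma_add_one (by positivity)]
      -- This rewrites the elementary integral 1 / (1/4 + 2n) as 4 (1/8)ₙ / (9/8)ₙ.
      have h8 : rising (9 / 8) n * (1 / 8) = rising (1 / 8) n * (1 / 8 + n) := by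
        induction n with
        | zero => simp
        | succ n ih =>
          rw [rising_succ, rising_succ]
          push_cast
          linear_combination (9 / 8 + (n : ℝ)) * ih
      have := (Real.Gamma_pos_of_pos (show (0 : ℝ) < 1 / 4 + (2 * n : ℕ) by positivity)).ne'
      have h9 := (rising_pos (show (0 : ℝ) < 9 / 8 by norm_num) n).ne'
      have h10 : (1 / 4 + ((2 * n : ℕ) : ℝ)) ≠ 0 := by positivity
      have h11 : (n.factorial : ℝ) ≠ 0 := by positivity
      rw [div_mul_cancel_right₀ this]
      push_cast at h10 ⊢
      field_simp
      field_simp at h8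
      linear_combination rising (1 / 4) n * h8
    simp_rw [hterm] at key2
    have hgs := (hasSum_gauss (a := 1 / 4) (b := 1 / 8) (c := 9 / 8) (by norm_num) (by norm_num)
      (by norm_num)).mul_left 4
    rw [key2.unique hgs] at key
    refine HasSum.of_eq (key.mul_right B⁻¹) (fun n => ?_) ?_
    · rw [hf]
      simp only
      rw [integral_const_mul, hval, gaussCoeff, hB]
      field_simp
    · rw [show (9 / 8 : ℝ) = 1 / 8 + 1 by norm_num, Real.Gamma_add_one (by norm_num), hB]
      norm_num
      field_simp
      norm_num
  · intro t ht
    have ht2 : t ^ 2 < 1 := by nlinarith [ht.1, ht.2]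
    have h := (hasSum_rising_div_factorial (1 / 4) (t := t ^ 2)
      (by rw [abs_of_nonneg (sq_nonneg t)]; exact ht2)).mul_right (t ^ (-(3 / 4) : ℝ))
    refine HasSum.of_eq h (fun n => ?_) (mul_comm _ _)
    rw [← pow_mul_betaIntegrand _ _ _ ht, betaIntegrand, sub_self, Real.rpow_zero, ← pow_mul]
    norm_num
    ring
  · refine (integrableOn_betaIntegrand (u := 1 / 4) (v := 3 / 4) (by norm_num)
      (by norm_num)).mono' (by fun_prop) ?_
    filter_upwards [ae_restrict_mem measurableSet_Ioo] with t ht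
    rw [betaIntegrand, show 1 - t ^ 2 = (1 + t) * (1 - t) by ring,
      Real.mul_rpow (by linarith [ht.1]) (by linarith [ht.2])]
    have h1 : (1 + t) ^ (-(1 / 4) : ℝ) ≤ 1 :=
      Real.rpow_le_one_of_one_le_of_nonpos (by linarith [ht.1]) (by norm_num)
    have h2 : 0 ≤ (1 - t) ^ (-(1 / 4) : ℝ) := Real.rpow_nonneg (by linarith [ht.2]) _
    have h3 : 0 ≤ (1 + t) ^ (-(1 / 4) : ℝ) := Real.rpow_nonneg (by linarith [ht.1]) _
    have h4 : 0 ≤ t ^ (-(3 / 4) : ℝ) := Real.rpow_nonneg ht.1.le _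
    rw [Real.norm_of_nonneg (by positivity)]
    norm_num
    norm_num at h1 h2 h3 h4
    exact mul_le_mul_of_nonneg_left (mul_le_of_le_one_left h2 h1) h4

/-- The value of `₃F₂(1/2, 1/2, 1/2; 1, 1; -1)`. -/
theorem hasSum_clausenCoeff_neg_one :
    HasSum (fun n => clausenCoeff (1 / 2) (1 / 2) n * (-1) ^ n)
      ((Real.Gamma (1 / 8) / (2 * Real.Gamma (1 / 4) * Real.Gamma (7 / 8))) ^ 2) := by
  refine HasSum.of_eq (hasSum_clausen (a := 1 / 4) (b := 1 / 4) (by norm_num) (by norm_num)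
    (by norm_num) (by norm_num) hasSum_gaussCoeff_neg_one
    (hasSum_gaussCoeff (by norm_num) (by norm_num) (by norm_num)).summable) (fun n => ?_) rfl
  norm_num

/-! ### Relations between Gamma values. -/

/-- The multiplication theorem for the Gamma function in the case of three factors. -/
lemma Gamma_mul_Gamma_add_third {s : ℝ} (hs : 0 < s) :
    Real.Gamma (s / 3) * Real.Gamma ((s + 1) / 3) * Real.Gamma ((s + 2) / 3) * 3 ^ s =
      3 * Real.Gamma (1 / 3) * Real.Gamma (2 / 3) * Real.Gamma s := by
  have h1 := Real.Gamma_pos_of_pos (show (0 : ℝ) < 1 / 3 by norm_num)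
  have h2 := Real.Gamma_pos_of_pos (show (0 : ℝ) < 2 / 3 by norm_num)
  set C : ℝ := 3 * Real.Gamma (1 / 3) * Real.Gamma (2 / 3) with hC
  have hC0 : 0 < C := by positivity
  -- Bohr–Mollerup: the quotient is log-convex, satisfies f(s + 1) = s f(s), and `C` is chosen so
  -- that f(1) = 1.
  set f : ℝ → ℝ := fun s =>
    Real.Gamma (s / 3) * Real.Gamma ((s + 1) / 3) * Real.Gamma ((s + 2) / 3) * 3 ^ s / C with hf
  have hconv (c : ℝ) (hc : 0 ≤ c) :
      ConvexOn ℝ (Ioi 0) fun x => Real.log (Real.Gamma ((x + c) / 3)) := by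
    refine ⟨convex_Ioi 0, fun x hx y hy a b ha hb hab => ?_⟩
    have h := Real.convexOn_log_Gamma.2 (x := (x + c) / 3) (y := (y + c) / 3)
      (show 0 < (x + c) / 3 by have : 0 < x := hx; positivity)
      (show 0 < (y + c) / 3 by have : 0 < y := hy; positivity) ha hb hab
    simp only [Function.comp_apply, smul_eq_mul] at h ⊢
    convert h using 3
    linear_combination (-(c / 3)) * hab
  have hpos (y : ℝ) (hy : 0 < y) (c : ℝ) (hc : 0 ≤ c) : 0 < Real.Gamma ((y + c) / 3) :=
    Real.Gamma_pos_of_pos (by positivity)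
  have hlin : ConvexOn ℝ (Ioi (0 : ℝ)) fun x => x * Real.log 3 - Real.log C := by
    refine ⟨convex_Ioi 0, fun x hx y hy a b ha hb hab => le_of_eq ?_⟩
    simp only [smul_eq_mul]
    linear_combination Real.log C * hab
  have key : EqOn f Real.Gamma (Ioi 0) := by
    refine Real.eq_Gamma_of_log_convex ?_ (fun {y} hy => ?_) (fun {y} hy => ?_) ?_
    · refine ((((hconv 0 le_rfl).add (hconv 1 zero_le_one)).add (hconv 2 zero_le_two)).add
        hlin).congr fun x hx => ?_
      have hx' : 0 < x := hx
      have a0 := (hpos x hx' 0 le_rfl).ne'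
      have a1 := (hpos x hx' 1 zero_le_one).ne'
      have a2 := (hpos x hx' 2 zero_le_two).ne'
      have a3 : (3 : ℝ) ^ x ≠ 0 := by positivity
      rw [add_zero] at a0
      simp only [Pi.add_apply, Function.comp_apply, hf, add_zero]
      rw [Real.log_div (by positivity) hC0.ne', Real.log_mul (by positivity) a3,
        Real.log_mul (by positivity) a2, Real.log_mul a0 a1, Real.log_rpow (by norm_num)]
      ring
    · simp only [hf]
      rw [show y + 1 + 1 = y + 2 by ring, show (y + 1 + 2) / 3 = y / 3 + 1 by ring,
        Real.Gamma_add_one (by positivity), Real.rpow_add (by norm_num), Real.rpow_one]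
      ring
    · have a0 := hpos y hy 0 le_rfl
      have a1 := hpos y hy 1 zero_le_one
      have a2 := hpos y hy 2 zero_le_two
      rw [add_zero] at a0
      simp only [hf]
      positivity
    · simp only [hf, hC]
      norm_num
      field_simp
  have := key (show s ∈ Ioi 0 from hs)
  simp only [hf] at this
  rw [div_eq_iff hC0.ne'] at this
  rw [this]; ring

lemma Gamma_quarter_mul : Real.Gamma (1 / 4) * Real.Gamma (3 / 4) = Real.pi * √2 := by
  have h := Real.Gamma_mul_Gamma_one_sub (1 / 4)
  rw [show (1 : ℝ) - 1 / 4 = 3 / 4 by norm_num, show Real.pi * (1 / 4) = Real.pi / 4 by ring,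
    Real.sin_pi_div_four] at h
  rw [h]
  have : √2 * √2 = (2 : ℝ) := Real.mul_self_sqrt (by norm_num)
  field_simp
  linarith [this]

/-- Triplication at s = 3/4 combined with reflection at 1/3 and 1/4. It compares the closed forms of
S(1/6) and S(1/2). -/
lemma sq_Gamma_mul_Gamma_twelfths :
    (Real.Gamma (11 / 12) * Real.Gamma (7 / 12)) ^ 2 = 2 / √3 * Real.Gamma (3 / 4) ^ 4 := by
  have h := Gamma_mul_Gamma_add_third (s := 3 / 4) (by norm_num)
  norm_num at h
  have h3 := Real.Gamma_mul_Gamma_one_sub (1 / 3)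
  rw [show (1 : ℝ) - 1 / 3 = 2 / 3 by norm_num, show Real.pi * (1 / 3) = Real.pi / 3 by ring,
    Real.sin_pi_div_three] at h3
  have h4 := Gamma_quarter_mul
  have hG4 := Real.Gamma_pos_of_pos (show (0 : ℝ) < 1 / 4 by norm_num)
  have hs3 : √3 * √3 = (3 : ℝ) := Real.mul_self_sqrt (by norm_num)
  have hs2 : √2 * √2 = (2 : ℝ) := Real.mul_self_sqrt (by norm_num)
  have hp : ((3 : ℝ) ^ (3 / 4 : ℝ)) ^ 2 = 3 * √3 := by
    rw [← Real.rpow_natCast, ← Real.rpow_mul (by norm_num), Real.sqrt_eq_rpow,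
      ← Real.rpow_one_add' (by norm_num) (by norm_num)]
    norm_num
  have h5 : Real.Gamma (11 / 12) * Real.Gamma (7 / 12) * (3 : ℝ) ^ (3 / 4 : ℝ) *
      (Real.pi * √2) * √3 = 6 * Real.pi * Real.Gamma (3 / 4) ^ 2 := by
    rw [mul_assoc 3, h3] at h
    rw [← h4]
    have hs3' : √3 ≠ 0 := by positivity
    field_simp at h
    linear_combination Real.Gamma (3 / 4) * h
  have hpi := Real.pi_pos.ne'
  have h6 : Real.Gamma (11 / 12) * Real.Gamma (7 / 12) * (3 : ℝ) ^ (3 / 4 : ℝ) *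
      √2 * √3 = 6 * Real.Gamma (3 / 4) ^ 2 := by
    apply mul_left_cancel₀ hpi
    linear_combination h5
  have h7 := congrArg (· ^ 2) h6
  simp only [mul_pow, hp] at h7
  rw [Real.sq_sqrt (by norm_num), Real.sq_sqrt (by norm_num)] at h7
  have hs3' : √3 ≠ 0 := by positivity
  rw [mul_pow]
  field_simp
  linear_combination h7 / 18

/-- Duplication at 1/8, squared. It compares the closed form of S(1/4) with the value at argument
-1. -/
lemma sq_Gamma_mul_Gamma_eighths :
    (Real.Gamma (1 / 8) * Real.Gamma (5 / 8)) ^ 2 = 2 * √2 * Real.pi * Real.Gamma (1 / 4) ^ 2 := by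
  have h := Real.Gamma_mul_Gamma_add_half (1 / 8)
  norm_num at h
  norm_num
  rw [h, mul_pow, mul_pow, Real.sq_sqrt Real.pi_pos.le, ← Real.rpow_natCast (2 ^ (3 / 4 : ℝ)),
    ← Real.rpow_mul (by norm_num), Real.sqrt_eq_rpow]
  have : (2 : ℝ) * 2 ^ (1 / 2 : ℝ) = 2 ^ (3 / 2 : ℝ) := by
    rw [← Real.rpow_one_add' (by norm_num) (by norm_num)]
    norm_num
  rw [this]
  norm_num
  ring

/-! ### A case of Thomae's transformation. -/

lemma rising_two_mul (x : ℝ) (n : ℕ) :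
    rising x (2 * n) = 4 ^ n * rising (x / 2) n * rising ((x + 1) / 2) n := by
  induction n with
  | zero => simp
  | succ n ih =>
    rw [show 2 * (n + 1) = 2 * n + 1 + 1 by ring, rising_succ, rising_succ, ih, rising_succ,
      rising_succ]
    push_cast
    ring

/-- A case of **Thomae's transformation**. -/
theorem hasSum_thomae :
    HasSum (fun n : ℕ => rising (1 / 2) n ^ 3 / (n.factorial * rising (3 / 4) n * rising (5 / 4) n))
      (Real.pi * √2 / 4 * (Real.pi / (Real.Gamma (7 / 8) * Real.Gamma (5 / 8)) ^ 2)) := by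
  -- A nonnegative double series that Gauss's theorem sums over either index: over the first index
  -- it leaves the terms of S(1/4), over the second those of ₃F₂(1/2, 1/2, 1/2; 3/4, 5/4; 1).
  set g : ℕ × ℕ → ℝ := fun p => rising (1 / 2) p.1 ^ 2 * (rising (1 / 4) p.2 * rising (3 / 4) p.2) /
    (p.1.factorial * p.2.factorial * Real.Gamma (3 / 2 + p.1 + p.2)) with hg
  have hΓ2 := Real.Gamma_pos_of_pos (show (0 : ℝ) < 1 / 2 by norm_num)
  have hΓ32 := Real.Gamma_pos_of_pos (show (0 : ℝ) < 3 / 2 by norm_num)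
  have hΓ3 := Real.Gamma_pos_of_pos (show (0 : ℝ) < 3 / 4 by norm_num)
  have hΓ5 := Real.Gamma_pos_of_pos (show (0 : ℝ) < 5 / 4 by norm_num)
  have hg0 : 0 ≤ g := fun p => by
    have := rising_pos (show (0 : ℝ) < 1 / 4 by norm_num) p.2
    have := rising_pos (show (0 : ℝ) < 3 / 4 by norm_num) p.2
    have := Real.Gamma_pos_of_pos (show (0 : ℝ) < 3 / 2 + p.1 + p.2 by positivity)
    simp only [hg, Pi.zero_apply]
    positivity
  have hcol (m : ℕ) : HasSum (fun n => g (n, m))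
      (Real.Gamma (1 / 2) * clausenCoeff (1 / 4) (3 / 4) m) := by
    have h := hasSum_gauss (a := 1 / 2) (b := 1 / 2) (c := 3 / 2 + m) (by norm_num) (by norm_num)
      (by have : (0 : ℝ) ≤ m := by positivity
          linarith)
    have hc : (0 : ℝ) < 3 / 2 + m := by positivity
    have hΓ := Real.Gamma_pos_of_pos hc
    refine HasSum.of_eq (h.mul_right (rising (1 / 4) m * rising (3 / 4) m /
      (m.factorial * Real.Gamma (3 / 2 + m)))) (fun n => ?_) ?_
    · have := rising_pos hc n
      simp only [hg]
      rw [add_right_comm, Gamma_add_natCast hc]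
      field_simp
    · rw [show (3 / 2 + m - 1 / 2 : ℝ) = m + 1 by ring, Real.Gamma_nat_eq_factorial,
        show (m + 1 - 1 / 2 : ℝ) = 1 / 2 + m by ring,
        Gamma_add_natCast (x := 1 / 2) (by norm_num),
        clausenCoeff]
      field_simp
  have hrow (n : ℕ) : HasSum (fun m => g (n, m)) (Real.Gamma (1 / 2) / (Real.Gamma (3 / 4) *
      Real.Gamma (5 / 4)) *
      (rising (1 / 2) n ^ 3 / (n.factorial * rising (3 / 4) n * rising (5 / 4) n))) := by
    have h := hasSum_gauss (a := 1 / 4) (b := 3 / 4) (c := 3 / 2 + n) (by norm_num) (by norm_num)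
      (by have : (0 : ℝ) ≤ n := by positivity
          linarith)
    have hc : (0 : ℝ) < 3 / 2 + n := by positivity
    have hΓ := Real.Gamma_pos_of_pos hc
    refine HasSum.of_eq (h.mul_right (rising (1 / 2) n ^ 2 /
      (n.factorial * Real.Gamma (3 / 2 + n)))) (fun m => ?_) ?_
    · have := rising_pos hc m
      simp only [hg]
      rw [Gamma_add_natCast hc]
      field_simp
    · have := rising_pos (show (0 : ℝ) < 5 / 4 by norm_num) n
      have := rising_pos (show (0 : ℝ) < 3 / 4 by norm_num) n
      rw [show (3 / 2 + n - 1 / 4 - 3 / 4 : ℝ) = 1 / 2 + n by ring,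
        show (3 / 2 + n - 1 / 4 : ℝ) = 5 / 4 + n by ring,
        show (3 / 2 + n - 3 / 4 : ℝ) = 3 / 4 + n by ring, Gamma_add_natCast (x := 1 / 2)
        (by norm_num), Gamma_add_natCast (x := 5 / 4) (by norm_num),
        Gamma_add_natCast (x := 3 / 4) (by norm_num)]
      field_simp
  have hF := hasSum_clausenCoeff (a := 1 / 4) (by norm_num) (by norm_num)
  norm_num at hF
  -- By nonnegativity, convergence of the column sums, already known from Clausen's formula,
  -- justifies interchanging the order of summation.
  have hswap : Summable (g ∘ Prod.swap) := by
    refine (summable_prod_of_nonneg (f := g ∘ Prod.swap) (fun p => hg0 p.swap)).2 ⟨fun m => (hcol m).summable, ?_⟩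
    simp only [Function.comp_apply, Prod.swap_prod_mk, (hcol _).tsum_eq]
    exact hF.summable.mul_left _
  have hsum : Summable g := (Equiv.prodComm ℕ ℕ).summable_iff.1 hswap
  have h1 := hsum.hasSum.prod_fiberwise hrow
  have h2 := ((Equiv.prodComm ℕ ℕ).hasSum_iff.2 hsum.hasSum).prod_fiberwise hcol
  have h3 := h2.unique (hF.mul_left _)
  rw [h3] at h1
  refine HasSum.of_eq (h1.mul_left (Real.Gamma (3 / 4) * Real.Gamma (5 / 4) / Real.Gamma (1 / 2)))
    (fun n => ?_) ?_
  · field_simp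
  · have h54 : Real.Gamma (5 / 4) = 1 / 4 * Real.Gamma (1 / 4) := by
      rw [show (5 / 4 : ℝ) = 1 / 4 + 1 by norm_num, Real.Gamma_add_one (by norm_num)]
    rw [← Gamma_quarter_mul, h54]
    field_simp

/-! ### The function ₂F₁(a, 1 - a; 1; x) and its integrals. -/

/-- The hypergeometric function `₂F₁(a, 1 - a; 1; x)`. -/
noncomputable def hyp (a x : ℝ) : ℝ := ∑' n, gaussCoeff a (1 - a) n * x ^ n

/-- The ratio of consecutive coefficients is (n + a)(n + 1 - a) / (n + 1)² ≤ 1. Boundedness by 1 is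
all that the convergence and differentiation arguments below need. -/
lemma gaussCoeff_le_one {a : ℝ} (ha : 0 < a) (ha1 : a < 1) (n : ℕ) :
    gaussCoeff a (1 - a) n ≤ 1 := by
  induction n with
  | zero => simp [gaussCoeff_zero]
  | succ n ih =>
    have h := gaussCoeff_succ a (1 - a) n
    have h0 := gaussCoeff_pos ha (sub_pos.2 ha1) n
    have h2 : (n + a) * (n + (1 - a)) ≤ ((n : ℝ) + 1) ^ 2 := by
      nlinarith [sq_nonneg (2 * a - 1), (show (0 : ℝ) ≤ n by positivity)]
    have h3 : ((n : ℝ) + 1) ^ 2 * gaussCoeff a (1 - a) (n + 1) ≤ ((n : ℝ) + 1) ^ 2 * 1 := by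
      rw [h, mul_one]
      calc _ ≤ (n + a) * (n + (1 - a)) * 1 := by
            have : 0 < 1 - a := by linarith
            gcongr
        _ ≤ _ := by linarith
    exact le_of_mul_le_mul_left h3 (by positivity)

lemma summable_hyp {a x : ℝ} (ha : 0 < a) (ha1 : a < 1) (hx : |x| < 1) :
    Summable fun n => gaussCoeff a (1 - a) n * x ^ n := by
  refine Summable.of_norm_bounded (g := fun n => |x| ^ n)
    (summable_geometric_of_lt_one (abs_nonneg _) hx) fun n => ?_
  rw [norm_mul, norm_pow, Real.norm_eq_abs x,
    Real.norm_of_nonneg (gaussCoeff_pos ha (sub_pos.2 ha1) n).le]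
  exact mul_le_of_le_one_left (by positivity) (gaussCoeff_le_one ha ha1 n)

lemma hasSum_hyp {a x : ℝ} (ha : 0 < a) (ha1 : a < 1) (hx : |x| < 1) :
    HasSum (fun n => gaussCoeff a (1 - a) n * x ^ n) (hyp a x) :=
  (summable_hyp ha ha1 hx).hasSum

/-- Termwise integration of `₂F₁(a, 1 - a; 1; x)` against `(x (1 - x))^(-1/2)`. -/
lemma integral_hyp_mul_betaIntegrand {a S : ℝ} (ha : 0 < a) (ha1 : a < 1)
    (hS : HasSum (clausenCoeff a (1 - a)) S) :
    IntegrableOn (fun x => hyp a x * betaIntegrand (1 / 2) (1 / 2) x) (Ioo 0 1) ∧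
      ∫ x in Ioo (0 : ℝ) 1, hyp a x * betaIntegrand (1 / 2) (1 / 2) x = Real.pi * S := by
  set f : ℕ → ℝ → ℝ := fun n x => gaussCoeff a (1 - a) n * betaIntegrand (1 / 2 + n) (1 / 2) x
  have hf (n : ℕ) : IntegrableOn (f n) (Ioo 0 1) :=
    (integrableOn_betaIntegrand (by positivity) (by norm_num)).const_mul _
  have h0 (n : ℕ) (x : ℝ) (hx : x ∈ Ioo (0 : ℝ) 1) : 0 ≤ f n x :=
    mul_nonneg (gaussCoeff_pos ha (sub_pos.2 ha1) n).le (betaIntegrand_nonneg _ _ hx)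
  have hs (x : ℝ) (hx : x ∈ Ioo (0 : ℝ) 1) :
      HasSum (fun n => f n x) (hyp a x * betaIntegrand (1 / 2) (1 / 2) x) := by
    refine HasSum.of_eq ((hasSum_hyp ha ha1 (by rw [abs_of_pos hx.1]; exact hx.2)).mul_right
      (betaIntegrand (1 / 2) (1 / 2) x)) (fun n => ?_) rfl
    simp only [f]
    rw [← pow_mul_betaIntegrand _ _ _ hx, mul_assoc]
  -- The n-th moment of (x (1 - x))^(-1/2) is π (1/2)ₙ / n!, the extra factor that raises ₂F₁ to
  -- ₃F₂.
  have hint (n : ℕ) : ∫ x in Ioo (0 : ℝ) 1, f n x = Real.pi * clausenCoeff a (1 - a) n := by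
    simp only [f]
    rw [integral_const_mul, integral_betaIntegrand_add (by norm_num) (by norm_num)]
    norm_num [rising_one]
    rw [Real.Gamma_one_half_eq, Real.mul_self_sqrt Real.pi_pos.le, gaussCoeff,
      clausenCoeff]
    ring
  have hi := integrableOn_of_summable_integral measurableSet_Ioo hf h0 hs
    (by simp_rw [hint]; exact hS.summable.mul_left _)
  refine ⟨hi, ?_⟩
  have h := hasSum_integral_of_nonneg measurableSet_Ioo hf h0 hs hi
  simp_rw [hint] at h
  exact h.unique (hS.mul_left _)

/-- Termwise integration of `₂F₁(1/2, 1/2; 1; k²)` against `(1 - k)^(-1/2)`. -/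
lemma integral_hyp_sq_mul_betaIntegrand :
    IntegrableOn (fun k => hyp (1 / 2) (k ^ 2) * betaIntegrand 1 (1 / 2) k) (Ioo 0 1) ∧
      ∫ k in Ioo (0 : ℝ) 1, hyp (1 / 2) (k ^ 2) * betaIntegrand 1 (1 / 2) k =
        Real.pi * √2 / 2 * (Real.pi / (Real.Gamma (7 / 8) * Real.Gamma (5 / 8)) ^ 2) := by
  set f : ℕ → ℝ → ℝ := fun n x =>
    gaussCoeff (1 / 2) (1 - 1 / 2) n * betaIntegrand (1 + (2 * n : ℕ)) (1 / 2) x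
  have hf (n : ℕ) : IntegrableOn (f n) (Ioo 0 1) :=
    (integrableOn_betaIntegrand (by positivity) (by norm_num)).const_mul _
  have h0 (n : ℕ) (x : ℝ) (hx : x ∈ Ioo (0 : ℝ) 1) : 0 ≤ f n x :=
    mul_nonneg (gaussCoeff_pos (by norm_num) (by norm_num) n).le (betaIntegrand_nonneg _ _ hx)
  have hs (x : ℝ) (hx : x ∈ Ioo (0 : ℝ) 1) :
      HasSum (fun n => f n x) (hyp (1 / 2) (x ^ 2) * betaIntegrand 1 (1 / 2) x) := by
    refine HasSum.of_eq ((hasSum_hyp (a := 1 / 2) (x := x ^ 2) (by norm_num) (by norm_num)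
      (by rw [abs_of_nonneg (sq_nonneg x)]; nlinarith [hx.1, hx.2])).mul_right
      (betaIntegrand 1 (1 / 2) x)) (fun n => ?_) rfl
    simp only [f]
    rw [← pow_mul_betaIntegrand _ _ _ hx, mul_assoc, pow_mul]
  -- The moment is 2 (1)₂ₙ / (3/2)₂ₙ. Duplication splits this into 2 (1/2)ₙ n! / ((3/4)ₙ (5/4)ₙ).
  have hint (n : ℕ) : ∫ x in Ioo (0 : ℝ) 1, f n x =
      2 * (rising (1 / 2) n ^ 3 / (n.factorial * rising (3 / 4) n * rising (5 / 4) n)) := by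
    simp only [f]
    rw [integral_const_mul, integral_betaIntegrand_add (by norm_num) (by norm_num),
      rising_two_mul, rising_two_mul, Real.Gamma_one, show (1 + 1 / 2 : ℝ) = 1 / 2 + 1 by norm_num,
      Real.Gamma_add_one (by norm_num), gaussCoeff]
    have := Real.Gamma_pos_of_pos (show (0 : ℝ) < 1 / 2 by norm_num)
    have := rising_pos (show (0 : ℝ) < 5 / 4 by norm_num) n
    have := rising_pos (show (0 : ℝ) < 3 / 4 by norm_num) n
    have h1 := rising_one n
    norm_num at *
    rw [h1]
    field_simp
  have hS := hasSum_thomae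
  have hi := integrableOn_of_summable_integral measurableSet_Ioo hf h0 hs
    (by simp_rw [hint]; exact hS.summable.mul_left _)
  refine ⟨hi, ?_⟩
  have h := hasSum_integral_of_nonneg measurableSet_Ioo hf h0 hs hi
  simp_rw [hint] at h
  rw [h.unique (hS.mul_left _)]
  ring

/-! ### The hypergeometric equation as a first order system, and its Wronskian. -/

lemma hasDerivAt_tsum_mul_pow {c : ℕ → ℝ} (hc : ∀ n, |c n| ≤ 1) {x : ℝ} (hx : |x| < 1) :
    HasDerivAt (fun z => ∑' n, c n * z ^ n) (∑' n, c n * (n * x ^ (n - 1))) x := by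
  obtain ⟨r, hr1, hr2⟩ := exists_between hx
  have hr0 : 0 ≤ r := (abs_nonneg x).trans hr1.le
  have hu : Summable fun n : ℕ => (n : ℝ) * r ^ (n - 1) := by
    rw [← summable_nat_add_iff 1]
    have h := (summable_pow_mul_geometric_of_norm_lt_one 1 (r := r)
      (by rwa [Real.norm_of_nonneg hr0])).add (summable_geometric_of_lt_one hr0 hr2)
    refine h.congr fun n => ?_
    push_cast
    simp
    ring
  refine hasDerivAt_tsum_of_isPreconnected hu Metric.isOpen_ball
    (convex_ball (0 : ℝ) r).isPreconnected (g := fun n z => c n * z ^ n)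
    (fun n y _ => (hasDerivAt_pow n y).const_mul (c n)) (fun n y hy => ?_)
    (y₀ := x) (by simpa using hr1) ?_ (by simpa using hr1)
  · have hy' : |y| < r := by simpa using hy
    rw [norm_mul, norm_mul, norm_pow, Real.norm_eq_abs, Real.norm_natCast, Real.norm_eq_abs]
    calc _ ≤ 1 * ((n : ℝ) * r ^ (n - 1)) := by gcongr; exact hc n
      _ = _ := one_mul _
  · refine Summable.of_norm_bounded (g := fun n => |x| ^ n)
      (summable_geometric_of_lt_one (abs_nonneg _) hx) fun n => ?_
    rw [norm_mul, norm_pow, Real.norm_eq_abs, Real.norm_eq_abs]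
    exact mul_le_of_le_one_left (by positivity) (hc n)

/-- The coefficients of the power series of `a (1 - a) ∫ ₂F₁(a, 1 - a; 1; x) dx / x`. -/
noncomputable def fluxCoeff (a : ℝ) (n : ℕ) : ℝ := a * (1 - a) * gaussCoeff a (1 - a) n / (n + 1)

/-- The function `x (1 - x) F'(x)`, where `F(x) = ₂F₁(a, 1 - a; 1; x)`. -/
noncomputable def flux (a x : ℝ) : ℝ := x * ∑' n, fluxCoeff a n * x ^ n

lemma abs_gaussCoeff_le_one {a : ℝ} (ha : 0 < a) (ha1 : a < 1) (n : ℕ) : |gaussCoeff a (1 - a) n| ≤ 1 := by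
  rw [abs_of_pos (gaussCoeff_pos ha (sub_pos.2 ha1) n)]
  exact gaussCoeff_le_one ha ha1 n

lemma fluxCoeff_nonneg {a : ℝ} (ha : 0 < a) (ha1 : a < 1) (n : ℕ) : 0 ≤ fluxCoeff a n := by
  have := gaussCoeff_pos ha (sub_pos.2 ha1) n
  have : 0 < 1 - a := by linarith
  unfold fluxCoeff
  positivity

lemma abs_fluxCoeff_le_one {a : ℝ} (ha : 0 < a) (ha1 : a < 1) (n : ℕ) : |fluxCoeff a n| ≤ 1 := by
  rw [abs_of_nonneg (fluxCoeff_nonneg ha ha1 n), fluxCoeff, div_le_one (by positivity)]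
  have h1 := gaussCoeff_le_one ha ha1 n
  have h0 := gaussCoeff_pos ha (sub_pos.2 ha1) n
  have h2 : a * (1 - a) ≤ 1 := by nlinarith
  calc a * (1 - a) * gaussCoeff a (1 - a) n ≤ 1 * 1 := by gcongr
    _ ≤ n + 1 := by linarith [(show (0 : ℝ) ≤ n by positivity)]

lemma summable_flux {a : ℝ} (ha : 0 < a) (ha1 : a < 1) {x : ℝ} (hx : |x| < 1) : Summable fun n => fluxCoeff a n * x ^ n := by
  refine Summable.of_norm_bounded (g := fun n => |x| ^ n)
    (summable_geometric_of_lt_one (abs_nonneg _) hx) fun n => ?_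
  rw [norm_mul, norm_pow, Real.norm_eq_abs, Real.norm_eq_abs]
  exact mul_le_of_le_one_left (by positivity) (abs_fluxCoeff_le_one ha ha1 n)

lemma summable_natCast_mul_pow {c : ℕ → ℝ} (hc : ∀ n, |c n| ≤ 1) {x : ℝ} (hx : |x| < 1) :
    Summable fun n : ℕ => c n * (n * x ^ n) := by
  refine Summable.of_norm_bounded (g := fun n : ℕ => ‖(n : ℝ) ^ 1 * x ^ n‖)
    (summable_pow_mul_geometric_of_norm_lt_one 1 (r := x) hx).norm fun n => ?_
  rw [norm_mul, pow_one]
  exact mul_le_of_le_one_left (by positivity) (hc n)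

/-- Half of the self-adjoint form (x (1 - x) F')' = a (1 - a) F. With `hasDerivAt_hyp` it gives a
first order system for F and its flux, so second derivatives never appear. -/
lemma hasDerivAt_flux {a : ℝ} (ha : 0 < a) (ha1 : a < 1) {x : ℝ} (hx : |x| < 1) :
    HasDerivAt (flux a) (a * (1 - a) * hyp a x) x := by
  have h := (hasDerivAt_id x).mul (hasDerivAt_tsum_mul_pow (abs_fluxCoeff_le_one ha ha1) hx)
  refine h.congr_deriv ?_
  simp only [id, one_mul, hyp]
  rw [← tsum_mul_left, ← tsum_mul_left, ← (summable_flux ha ha1 hx).tsum_add]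
  · refine tsum_congr fun n => ?_
    rcases n with _ | n
    · simp [fluxCoeff]
    · have : ((n : ℝ) + 1 + 1) ≠ 0 := by positivity
      rw [fluxCoeff, Nat.add_sub_cancel, pow_succ]
      push_cast
      field_simp
      ring
  · refine (summable_natCast_mul_pow (abs_fluxCoeff_le_one ha ha1) hx).congr fun n => ?_
    rcases n with _ | n
    · simp
    · rw [Nat.add_sub_cancel, pow_succ]
      ring

/-- Comparing coefficients of x ^ (n + 1) in x (1 - x) F', this is the recursion `gaussCoeff_succ`
together with (n + a)(n + 1 - a) - n (n + 1) = a (1 - a). -/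
lemma hasDerivAt_hyp {a : ℝ} (ha : 0 < a) (ha1 : a < 1) {x : ℝ} (hx : x ∈ Ioo (0 : ℝ) 1) :
    HasDerivAt (hyp a) (flux a x / (x * (1 - x))) x := by
  have hx' : |x| < 1 := by rw [abs_of_pos hx.1]; exact hx.2
  have h1x : 0 < 1 - x := by linarith [hx.2]
  refine (hasDerivAt_tsum_mul_pow (abs_gaussCoeff_le_one ha ha1) hx').congr_deriv ?_
  rw [eq_div_iff (mul_pos hx.1 h1x).ne']
  have hs := summable_natCast_mul_pow (abs_gaussCoeff_le_one ha ha1) hx'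
  have hs1 : x * ∑' n : ℕ, gaussCoeff a (1 - a) n * (n * x ^ (n - 1)) =
      ∑' n : ℕ, gaussCoeff a (1 - a) n * (n * x ^ n) := by
    rw [← tsum_mul_left]
    refine tsum_congr fun n => ?_
    rcases n with _ | n
    · simp
    · rw [Nat.add_sub_cancel, pow_succ]
      ring
  have hs2 : ∑' n : ℕ, gaussCoeff a (1 - a) n * (n * x ^ n) =
      ∑' n : ℕ, gaussCoeff a (1 - a) (n + 1) * ((n + 1 : ℕ) * x ^ (n + 1)) := by
    rw [hs.tsum_eq_zero_add]
    simp
  have hs' := (summable_nat_add_iff 1).2 hs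
  rw [show ∀ S : ℝ, S * (x * (1 - x)) = x * S - x * (x * S) by intro S; ring, hs1]
  nth_rewrite 1 [hs2]
  rw [flux, ← tsum_mul_left, ← tsum_mul_left, ← hs'.tsum_sub (hs.mul_left x)]
  refine tsum_congr fun n => ?_
  have h := gaussCoeff_succ a (1 - a) n
  have hn : (n : ℝ) + 1 ≠ 0 := by positivity
  rw [fluxCoeff]
  push_cast
  field_simp
  rw [pow_succ]
  linear_combination x ^ n * x * h

lemma hyp_pos {a : ℝ} (ha : 0 < a) (ha1 : a < 1) {x : ℝ} (hx : 0 ≤ x) (hx1 : x < 1) : 0 < hyp a x := by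
  have h := (hasSum_hyp ha ha1 (x := x) (by rwa [abs_of_nonneg hx]))
  have h2 := sum_le_hasSum (Finset.range 1) (fun n _ => mul_nonneg
    (gaussCoeff_pos ha (sub_pos.2 ha1) n).le (pow_nonneg hx n)) h
  simp [gaussCoeff_zero] at h2
  linarith

lemma continuousAt_hyp {a : ℝ} (ha : 0 < a) (ha1 : a < 1) {x : ℝ} (hx : |x| < 1) : ContinuousAt (hyp a) x :=
  (hasDerivAt_tsum_mul_pow (abs_gaussCoeff_le_one ha ha1) hx).continuousAt

lemma hyp_zero {a : ℝ} : hyp a 0 = 1 := by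
  rw [hyp, tsum_eq_single 0 fun n hn => by simp [hn]]
  simp [gaussCoeff_zero]

lemma flux_zero {a : ℝ} : flux a 0 = 0 := by simp [flux]

lemma tendsto_hyp_zero {a : ℝ} (ha : 0 < a) (ha1 : a < 1) : Tendsto (hyp a) (𝓝 0) (𝓝 1) := by
  have h := continuousAt_hyp ha ha1 (x := 0) (by simp)
  rwa [ContinuousAt, hyp_zero] at h

lemma tendsto_flux_zero {a : ℝ} (ha : 0 < a) (ha1 : a < 1) : Tendsto (flux a) (𝓝 0) (𝓝 0) := by
  have h := (hasDerivAt_flux ha ha1 (x := 0) (by simp)).continuousAt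
  rwa [ContinuousAt, flux_zero] at h

/-- Abel's limit theorem reduces the limit to the sum of the coefficients, a Gauss series with c =
2. Its value is 1 / (Γ(a) Γ(1 - a)), and reflection finishes. -/
lemma tendsto_flux_one {a : ℝ} (ha : 0 < a) (ha1 : a < 1) : Tendsto (flux a) (𝓝[<] 1) (𝓝 (Real.sin (Real.pi * a) / Real.pi)) := by
  have h1a : 0 < 1 - a := by linarith
  have hs : HasSum (fluxCoeff a) (Real.sin (Real.pi * a) / Real.pi) := by
    refine HasSum.of_eq ((hasSum_gauss (a := a) (b := 1 - a) (c := 2) ha h1a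
      (by linarith)).mul_left (a * (1 - a))) (fun n => ?_) ?_
    · have h2 : rising 2 n = (n + 1) * n.factorial := by
        induction n with
        | zero => simp
        | succ n ih =>
          rw [rising_succ, ih, Nat.factorial_succ]
          push_cast
          ring
      rw [fluxCoeff, gaussCoeff, h2]
      field_simp
    · rw [show (2 : ℝ) - (1 - a) = a + 1 by ring, show (2 : ℝ) - a = (1 - a) + 1 by ring,
        Real.Gamma_add_one ha.ne', Real.Gamma_add_one h1a.ne',
        show (1 - a + 1 - (1 - a) : ℝ) = 1 by ring, Real.Gamma_one, Real.Gamma_two]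
      have h := Real.Gamma_mul_Gamma_one_sub a
      have hsin : 0 < Real.sin (Real.pi * a) := Real.sin_pos_of_pos_of_lt_pi
        (by positivity) (by nlinarith [Real.pi_pos])
      have := Real.pi_pos
      have := Real.Gamma_pos_of_pos ha
      have := Real.Gamma_pos_of_pos h1a
      rw [eq_div_iff hsin.ne'] at h
      field_simp
      linear_combination h
  have h := Real.tendsto_tsum_powerSeries_nhdsWithin_lt hs.tendsto_sum_nat
  have hid : Tendsto (fun x : ℝ => x) (𝓝[<] 1) (𝓝 1) := tendsto_id.mono_left nhdsWithin_le_nhds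
  have h' := hid.mul h
  rw [one_mul] at h'
  exact h'

/-- Coefficientwise comparison with the binomial series. The true singularity at 1 is only
logarithmic, but this bound suffices to make x F(1 - x) vanish as x → 0. -/
lemma hyp_le {a : ℝ} (ha : 0 < a) (ha1 : a < 1) {x : ℝ} (hx : 0 ≤ x) (hx1 : x < 1) : hyp a x ≤ (1 - x) ^ (-(1 / 2) : ℝ) := by
  have hxa : |x| < 1 := by rwa [abs_of_nonneg hx]
  refine hasSum_le (fun n => ?_) (hasSum_hyp ha ha1 hxa) (hasSum_rising_div_factorial (1 / 2) hxa)
  refine mul_le_mul_of_nonneg_right ?_ (pow_nonneg hx n)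
  induction n with
  | zero => simp [gaussCoeff_zero]
  | succ n ih =>
    have h1 := gaussCoeff_succ a (1 - a) n
    have h0 := gaussCoeff_pos ha (sub_pos.2 ha1) n
    have hn : (0 : ℝ) ≤ n := by positivity
    rw [rising_succ, Nat.factorial_succ]
    push_cast
    rw [mul_comm ((n : ℝ) + 1), mul_div_mul_comm]
    have h2 : (n + a) * (n + (1 - a)) ≤ (1 / 2 + (n : ℝ)) * (n + 1) := by
      nlinarith [sq_nonneg (2 * a - 1)]
    have h3 : ((n : ℝ) + 1) ^ 2 * gaussCoeff a (1 - a) (n + 1) ≤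
        ((n : ℝ) + 1) ^ 2 * (rising (1 / 2) n / n.factorial * ((1 / 2 + n) / (n + 1))) := by
      rw [h1]
      calc _ ≤ (1 / 2 + (n : ℝ)) * (n + 1) * (rising (1 / 2) n / n.factorial) := by
            have : 0 < 1 - a := by linarith
            gcongr
        _ = _ := by field_simp
    exact le_of_mul_le_mul_left h3 (by positivity)

/-- Used to evaluate Wronskians: a function with zero derivative on (0, 1) is known once its limit
along some filter on the interval, in practice at an endpoint, is known. -/
lemma eqOn_const_of_hasDerivAt_zero {f : ℝ → ℝ} (hf : ∀ x ∈ Ioo (0 : ℝ) 1, HasDerivAt f 0 x)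
    {l : Filter ℝ} [l.NeBot] (hl : Ioo (0 : ℝ) 1 ∈ l) {c : ℝ} (hc : Tendsto f l (𝓝 c))
    {x : ℝ} (hx : x ∈ Ioo (0 : ℝ) 1) : f x = c := by
  have h : ∀ y ∈ Ioo (0 : ℝ) 1, f y = f x := fun y hy =>
    isOpen_Ioo.is_const_of_deriv_eq_zero isPreconnected_Ioo
      (fun z hz => (hf z hz).differentiableAt.differentiableWithinAt)
      (fun z hz => (hf z hz).deriv) hy hx
  refine tendsto_nhds_unique (tendsto_const_nhds.congr' ?_) hc
  filter_upwards [hl] with y hy using (h y hy).symm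

lemma Ioo_mem_nhdsGT_zero : Ioo (0 : ℝ) 1 ∈ 𝓝[>] (0 : ℝ) := Ioo_mem_nhdsGT one_pos

lemma Ioo_mem_nhdsLT_one : Ioo (0 : ℝ) 1 ∈ 𝓝[<] (1 : ℝ) := Ioo_mem_nhdsLT one_pos

/-- The Wronskian of `F(x)` and `F(1 - x)` for `F = ₂F₁(a, 1 - a; 1; ·)`. -/
lemma hyp_wronskian {a : ℝ} (ha : 0 < a) (ha1 : a < 1) {x : ℝ} (hx : x ∈ Ioo (0 : ℝ) 1) :
    flux a (1 - x) * hyp a x + flux a x * hyp a (1 - x) = Real.sin (Real.pi * a) / Real.pi := by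
  refine eqOn_const_of_hasDerivAt_zero
    (f := fun x => flux a (1 - x) * hyp a x + flux a x * hyp a (1 - x))
    (fun x hx => ?_) Ioo_mem_nhdsGT_zero ?_ hx
  · have hx' : 1 - x ∈ Ioo (0 : ℝ) 1 := ⟨by linarith [hx.2], by linarith [hx.1]⟩
    have hs : HasDerivAt (fun x : ℝ => 1 - x) (-1) x := by
      simpa using (hasDerivAt_id x).const_sub 1
    have h1 := hasDerivAt_hyp ha ha1 hx
    have h2 := hasDerivAt_flux ha ha1 (x := x) (by rw [abs_of_pos hx.1]; exact hx.2)
    have h3 := (hasDerivAt_hyp ha ha1 hx').comp x hs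
    have h4 := (hasDerivAt_flux ha ha1 (x := 1 - x) (by rw [abs_of_pos hx'.1]; exact hx'.2)).comp
      x hs
    refine ((h4.mul h1).add (h2.mul h3)).congr_deriv ?_
    have := hx.1.ne'
    have := hx'.1.ne'
    simp only [Function.comp_apply]
    rw [sub_sub_cancel]
    field_simp
    ring
  · have hid : Tendsto (fun x : ℝ => x) (𝓝[>] 0) (𝓝 0) := tendsto_id.mono_left nhdsWithin_le_nhds
    have h1 : Tendsto (fun x : ℝ => 1 - x) (𝓝[>] 0) (𝓝[<] 1) := by
      refine tendsto_nhdsWithin_iff.2 ⟨by simpa using hid.const_sub 1, ?_⟩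
      filter_upwards [self_mem_nhdsWithin] with x hx
      have : 0 < x := hx
      simpa using this
    have h2 := ((tendsto_flux_one ha ha1).comp h1).mul ((tendsto_hyp_zero ha ha1).comp hid)
    -- Near 0 the flux is at most x and F(1 - x) at most x^(-1/2), so this product is squeezed by
    -- √x. The Wronskian is then the limit of the flux at 1.
    have h3 : Tendsto (fun x => flux a x * hyp a (1 - x)) (𝓝[>] 0) (𝓝 0) := by
      have hb : ∀ᶠ x in 𝓝[>] (0 : ℝ), flux a x * hyp a (1 - x) ≤ x ^ (1 / 2 : ℝ) := by
        have h5 : ∀ᶠ x in 𝓝[>] (0 : ℝ), ∑' n, fluxCoeff a n * x ^ n ≤ 1 := by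
          have h6 := (hasDerivAt_tsum_mul_pow (abs_fluxCoeff_le_one ha ha1)
            (x := 0) (by simp)).continuousAt.tendsto.comp hid
          have h7 : ∑' n, fluxCoeff a n * (0 : ℝ) ^ n < 1 := by
            rw [tsum_eq_single 0 fun n hn => by simp [hn]]
            simp only [fluxCoeff, gaussCoeff_zero]
            norm_num
            nlinarith [sq_nonneg (2 * a - 1)]
          filter_upwards [h6.eventually_lt_const h7] with x hx using hx.le
        filter_upwards [h5, Ioo_mem_nhdsGT_zero] with x h5 hx
        have h8 := hyp_le ha ha1 (x := 1 - x) (by linarith [hx.2]) (by linarith [hx.1])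
        have h9 := hyp_pos ha ha1 (x := 1 - x) (by linarith [hx.2]) (by linarith [hx.1])
        rw [sub_sub_cancel] at h8
        have hx0 := hx.1
        calc flux a x * hyp a (1 - x) ≤ (x * 1) * x ^ (-(1 / 2) : ℝ) := by
              rw [flux]; gcongr
          _ = x ^ (1 / 2 : ℝ) := by
              rw [mul_one]
              nth_rewrite 1 [← Real.rpow_one x]
              rw [← Real.rpow_add hx0]
              norm_num
      refine tendsto_of_tendsto_of_tendsto_of_le_of_le' tendsto_const_nhds
        (h := fun x => x ^ (1 / 2 : ℝ)) ?_ ?_ hb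
      · have := (Real.continuousAt_rpow_const 0 (1 / 2) (Or.inr (by norm_num))).tendsto.comp hid
        simpa [Real.zero_rpow, Function.comp_def] using this
      · filter_upwards [Ioo_mem_nhdsGT_zero] with x hx
        have h9 := hyp_pos ha ha1 (x := 1 - x) (by linarith [hx.2]) (by linarith [hx.1])
        exact mul_nonneg (mul_nonneg hx.1.le (tsum_nonneg fun n =>
          mul_nonneg (fluxCoeff_nonneg ha ha1 n) (pow_nonneg hx.1.le n))) h9.le
    simpa using h2.add h3

/-! ### Rational transformations of ₂F₁. -/

/-- A sufficient condition for a rational transformation `F(z(x)) = m(x) F(w(x))` of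
`F = ₂F₁(a, 1 - a; 1; ·)`. The functions `A` and `B` are `z (1 - z) m' / z'` and
`z (1 - z) m w' / (w (1 - w) z')`. -/
lemma hyp_eq_mul_hyp {a : ℝ} (ha : 0 < a) (ha1 : a < 1) {z w m A B z' w' m' A' B' : ℝ → ℝ}
    (hz : ∀ x ∈ Ioo (0 : ℝ) 1, z x ∈ Ioo (0 : ℝ) 1) (hw : ∀ x ∈ Ioo (0 : ℝ) 1, w x ∈ Ioo (0 : ℝ) 1)
    (dz : ∀ x ∈ Ioo (0 : ℝ) 1, HasDerivAt z (z' x) x)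
    (dw : ∀ x ∈ Ioo (0 : ℝ) 1, HasDerivAt w (w' x) x)
    (dm : ∀ x ∈ Ioo (0 : ℝ) 1, HasDerivAt m (m' x) x)
    (dA : ∀ x ∈ Ioo (0 : ℝ) 1, HasDerivAt A (A' x) x)
    (dB : ∀ x ∈ Ioo (0 : ℝ) 1, HasDerivAt B (B' x) x)
    (hA : ∀ x ∈ Ioo (0 : ℝ) 1, A x * z' x = z x * (1 - z x) * m' x)
    (hB : ∀ x ∈ Ioo (0 : ℝ) 1, B x * z' x * (w x * (1 - w x)) = z x * (1 - z x) * m x * w' x)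
    (hAB : ∀ x ∈ Ioo (0 : ℝ) 1, A x * w' x + B' x * (w x * (1 - w x)) = 0)
    (hA' : ∀ x ∈ Ioo (0 : ℝ) 1, A' x + B x * (a * (1 - a)) * w' x = m x * (a * (1 - a)) * z' x)
    (hz1 : Tendsto z (𝓝[<] 1) (𝓝 0)) (hw1 : Tendsto w (𝓝[<] 1) (𝓝 0))
    (hm1 : Tendsto m (𝓝[<] 1) (𝓝 1)) (hA1 : Tendsto A (𝓝[<] 1) (𝓝 0)) {b : ℝ}
    (hB1 : Tendsto B (𝓝[<] 1) (𝓝 b)) {x : ℝ} (hx : x ∈ Ioo (0 : ℝ) 1) :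
    hyp a (z x) = m x * hyp a (w x) := by
  have abs_lt {t : ℝ} (ht : t ∈ Ioo (0 : ℝ) 1) : |t| < 1 := by
    rw [abs_of_pos ht.1]; exact ht.2
  have ne {t : ℝ} (ht : t ∈ Ioo (0 : ℝ) 1) : t ≠ 0 ∧ 1 - t ≠ 0 :=
    ⟨ht.1.ne', (sub_pos.2 ht.2).ne'⟩
  have d1 (x) (hx : x ∈ Ioo (0 : ℝ) 1) := (hasDerivAt_hyp ha ha1 (hz x hx)).comp x (dz x hx)
  have d2 (x) (hx : x ∈ Ioo (0 : ℝ) 1) := (hasDerivAt_hyp ha ha1 (hw x hx)).comp x (dw x hx)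
  have d3 (x) (hx : x ∈ Ioo (0 : ℝ) 1) :=
    (hasDerivAt_flux ha ha1 (abs_lt (hz x hx))).comp x (dz x hx)
  have d4 (x) (hx : x ∈ Ioo (0 : ℝ) 1) :=
    (hasDerivAt_flux ha ha1 (abs_lt (hw x hx))).comp x (dw x hx)
  have t1 := (tendsto_hyp_zero ha ha1).comp hz1
  have t2 := (tendsto_hyp_zero ha ha1).comp hw1
  have t3 := (tendsto_flux_zero ha ha1).comp hz1
  have t4 := (tendsto_flux_zero ha ha1).comp hw1
  -- With y = m F(w), the expression A F(w) + B flux(w) is z (1 - z) dy/dz, so the left side is the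
  -- Wronskian of F(z) and y. The conditions on A and B say that y solves the same equation in z, so
  -- the Wronskian is constant. It vanishes in the limit x → 1, where z and w tend to 0; for B a
  -- finite limit is enough.
  have hW {x : ℝ} (hx : x ∈ Ioo (0 : ℝ) 1) :
      hyp a (z x) * (A x * hyp a (w x) + B x * flux a (w x)) -
        m x * flux a (z x) * hyp a (w x) = 0 := by
    refine eqOn_const_of_hasDerivAt_zero
      (f := fun x => hyp a (z x) * (A x * hyp a (w x) + B x * flux a (w x)) -
        m x * flux a (z x) * hyp a (w x)) (fun x hx => ?_) Ioo_mem_nhdsLT_one ?_ hx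
    · refine (((d1 x hx).mul (((dA x hx).mul (d2 x hx)).add ((dB x hx).mul (d4 x hx)))).sub
        (((dm x hx).mul (d3 x hx)).mul (d2 x hx))).congr_deriv ?_
      obtain ⟨z0, z1⟩ := ne (hz x hx)
      obtain ⟨w0, w1⟩ := ne (hw x hx)
      simp only [Function.comp_apply, Pi.mul_apply, Pi.add_apply]
      have e1 : A x * w' x / (w x * (1 - w x)) = -B' x := by
        rw [div_eq_iff (mul_ne_zero w0 w1)]; linear_combination hAB x hx
      have e2 : A x * z' x / (z x * (1 - z x)) = m' x := by
        rw [div_eq_iff (mul_ne_zero z0 z1), hA x hx]; ring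
      have e3 : B x * z' x / (z x * (1 - z x)) = m x * w' x / (w x * (1 - w x)) := by
        rw [div_eq_div_iff (mul_ne_zero z0 z1) (mul_ne_zero w0 w1)]
        linear_combination hB x hx
      linear_combination hyp a (z x) * flux a (w x) * e1 + flux a (z x) * hyp a (w x) * e2 +
        flux a (z x) * flux a (w x) * e3 + hyp a (z x) * hyp a (w x) * hA' x hx
    · simpa using (t1.mul ((hA1.mul t2).add (hB1.mul t4))).sub ((hm1.mul t3).mul t2)
  -- With vanishing Wronskian the ratio of the two solutions is constant, and its limit at x → 1 is
  -- 1.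
  have hR : m x * hyp a (w x) / hyp a (z x) = 1 := by
    refine eqOn_const_of_hasDerivAt_zero (f := fun x => m x * hyp a (w x) / hyp a (z x))
      (fun x hx => ?_) Ioo_mem_nhdsLT_one ?_ hx
    · have hF := (hyp_pos ha ha1 (hz x hx).1.le (hz x hx).2).ne'
      refine (((dm x hx).mul (d2 x hx)).div (d1 x hx) hF).congr_deriv ?_
      obtain ⟨z0, z1⟩ := ne (hz x hx)
      obtain ⟨w0, w1⟩ := ne (hw x hx)
      simp only [Function.comp_apply, Pi.mul_apply]
      refine div_eq_zero_iff.2 (Or.inl ?_)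
      have e2 : A x * z' x / (z x * (1 - z x)) = m' x := by
        rw [div_eq_iff (mul_ne_zero z0 z1), hA x hx]; ring
      have e3 : B x * z' x / (z x * (1 - z x)) = m x * w' x / (w x * (1 - w x)) := by
        rw [div_eq_div_iff (mul_ne_zero z0 z1) (mul_ne_zero w0 w1)]
        linear_combination hB x hx
      linear_combination z' x / (z x * (1 - z x)) * hW hx - hyp a (w x) * hyp a (z x) * e2 -
        flux a (w x) * hyp a (z x) * e3
    · have h := (hm1.mul t2).div t1 one_ne_zero
      rw [mul_one, div_one] at h
      exact h
  rw [div_eq_one_iff_eq (hyp_pos ha ha1 (hz x hx).1.le (hz x hx).2).ne'] at hR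
  exact hR.symm

lemma tendsto_nhdsLT_one_of_continuousAt {f : ℝ → ℝ} {c : ℝ} (hf : ContinuousAt f 1)
    (hc : f 1 = c) : Tendsto f (𝓝[<] 1) (𝓝 c) :=
  hc ▸ hf.tendsto.mono_left nhdsWithin_le_nhds

/-- The quadratic transformation of the complete elliptic integral. -/
theorem hyp_half_quadratic {x : ℝ} (hx : x ∈ Ioo (0 : ℝ) 1) :
    hyp (1 / 2) (1 - x ^ 2) = 2 / (1 + x) * hyp (1 / 2) (((1 - x) / (1 + x)) ^ 2) := by
  have h1 {x : ℝ} (hx : x ∈ Ioo (0 : ℝ) 1) : (1 + x) ≠ 0 := by linarith [hx.1]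
  -- The choices of A and B are forced by z, w and m. The remaining conditions are rational
  -- identities in x.
  refine hyp_eq_mul_hyp (a := 1 / 2) (by norm_num) (by norm_num) (z := fun x => 1 - x ^ 2)
    (w := fun x => ((1 - x) / (1 + x)) ^ 2) (m := fun x => 2 / (1 + x))
    (A := fun x => (1 - x) * x / (1 + x)) (B := fun x => 1 + x)
    (z' := fun x => -2 * x) (w' := fun x => -4 * (1 - x) / (1 + x) ^ 3)
    (m' := fun x => -2 / (1 + x) ^ 2) (A' := fun x => (1 - 2 * x - x ^ 2) / (1 + x) ^ 2)
    (B' := fun _ => 1) (b := 2)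
    (fun x hx => ⟨by nlinarith [hx.1, hx.2], by nlinarith [hx.1, hx.2]⟩)
    (fun x hx => ?_) (fun x hx => ?_) (fun x hx => ?_) (fun x hx => ?_) (fun x hx => ?_)
    (fun x hx => ?_) (fun x hx => ?_) (fun x hx => ?_) (fun x hx => ?_) (fun x hx => ?_)
    ?_ ?_ ?_ ?_ ?_ hx
  · have h2 : 0 < (1 - x) / (1 + x) := div_pos (by linarith [hx.2]) (by linarith [hx.1])
    have h3 : (1 - x) / (1 + x) < 1 := (div_lt_one (by linarith [hx.1])).2 (by linarith [hx.1])
    exact ⟨by positivity, by nlinarith⟩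
  · exact ((hasDerivAt_pow 2 x).const_sub 1).congr_deriv (by norm_num)
  · refine ((((hasDerivAt_id x).const_sub 1).div ((hasDerivAt_id x).const_add 1)
      (h1 hx)).pow 2).congr_deriv ?_
    have := h1 hx
    simp
    field_simp
    ring
  · refine ((hasDerivAt_const x 2).div ((hasDerivAt_id x).const_add 1) (h1 hx)).congr_deriv ?_
    simp
  · refine ((((hasDerivAt_id x).const_sub 1).mul (hasDerivAt_id x)).div
      ((hasDerivAt_id x).const_add 1) (h1 hx)).congr_deriv ?_
    have := h1 hx
    simp
    field_simp
    ring
  · exact (hasDerivAt_id x).const_add 1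
  · have := h1 hx
    field_simp
    ring
  · have := h1 hx
    field_simp
    ring
  · have := h1 hx
    field_simp
    ring
  · have := h1 hx
    field_simp
    ring
  · exact tendsto_nhdsLT_one_of_continuousAt (by fun_prop) (by norm_num)
  · exact tendsto_nhdsLT_one_of_continuousAt (by fun_prop (disch := norm_num)) (by norm_num)
  · exact tendsto_nhdsLT_one_of_continuousAt (by fun_prop (disch := norm_num)) (by norm_num)
  · exact tendsto_nhdsLT_one_of_continuousAt (by fun_prop (disch := norm_num)) (by norm_num)
  · exact tendsto_nhdsLT_one_of_continuousAt (by fun_prop) (by norm_num)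

/-- Ramanujan's cubic transformation. -/
theorem hyp_third_cubic {x : ℝ} (hx : x ∈ Ioo (0 : ℝ) 1) :
    hyp (1 / 3) (1 - x ^ 3) = 3 / (1 + 2 * x) * hyp (1 / 3) (((1 - x) / (1 + 2 * x)) ^ 3) := by
  have h1 {x : ℝ} (hx : x ∈ Ioo (0 : ℝ) 1) : (1 + 2 * x) ≠ 0 := by linarith [hx.1]
  have hd (x : ℝ) : HasDerivAt (fun x : ℝ => 1 + 2 * x) 2 x := by
    simpa using ((hasDerivAt_id x).const_mul 2).const_add 1
  refine hyp_eq_mul_hyp (a := 1 / 3) (by norm_num) (by norm_num) (z := fun x => 1 - x ^ 3)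
    (w := fun x => ((1 - x) / (1 + 2 * x)) ^ 3) (m := fun x => 3 / (1 + 2 * x))
    (A := fun x => 2 * (x * (1 - x ^ 3)) / (1 + 2 * x) ^ 2) (B := fun x => 1 + 2 * x)
    (z' := fun x => -3 * x ^ 2) (w' := fun x => -9 * (1 - x) ^ 2 / (1 + 2 * x) ^ 4)
    (m' := fun x => -6 / (1 + 2 * x) ^ 2)
    (A' := fun x => 2 * (1 - 2 * x - 4 * x ^ 3 - 4 * x ^ 4) / (1 + 2 * x) ^ 3)
    (B' := fun _ => 2) (b := 3)
    (fun x hx => ⟨sub_pos.2 (pow_lt_one₀ hx.1.le hx.2 (by norm_num)),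
      by have := pow_pos hx.1 3; linarith⟩)
    (fun x hx => ?_) (fun x hx => ?_) (fun x hx => ?_) (fun x hx => ?_) (fun x hx => ?_)
    (fun x hx => ?_) (fun x hx => ?_) (fun x hx => ?_) (fun x hx => ?_) (fun x hx => ?_)
    ?_ ?_ ?_ ?_ ?_ hx
  · have h2 : 0 < (1 - x) / (1 + 2 * x) := div_pos (by linarith [hx.2]) (by linarith [hx.1])
    have h3 : (1 - x) / (1 + 2 * x) < 1 := (div_lt_one (by linarith [hx.1])).2 (by linarith [hx.1])
    exact ⟨by positivity, pow_lt_one₀ h2.le h3 (by norm_num)⟩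
  · exact ((hasDerivAt_pow 3 x).const_sub 1).congr_deriv (by norm_num)
  · refine ((((hasDerivAt_id x).const_sub 1).div (hd x) (h1 hx)).pow 3).congr_deriv ?_
    have := h1 hx
    simp
    field_simp
    ring
  · refine ((hasDerivAt_const x 3).div (hd x) (h1 hx)).congr_deriv ?_
    norm_num
  · refine ((((hasDerivAt_id x).mul ((hasDerivAt_pow 3 x).const_sub 1)).const_mul 2).div
      ((hd x).pow 2) (pow_ne_zero 2 (h1 hx))).congr_deriv ?_
    have := h1 hx
    simp
    field_simp
    ring
  · exact hd x
  · have := h1 hx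
    field_simp
    ring
  · have := h1 hx
    field_simp
    ring
  · have := h1 hx
    field_simp
    ring
  · have := h1 hx
    field_simp
    ring
  · exact tendsto_nhdsLT_one_of_continuousAt (by fun_prop) (by norm_num)
  · exact tendsto_nhdsLT_one_of_continuousAt (by fun_prop (disch := norm_num)) (by norm_num)
  · exact tendsto_nhdsLT_one_of_continuousAt (by fun_prop (disch := norm_num)) (by norm_num)
  · exact tendsto_nhdsLT_one_of_continuousAt (by fun_prop (disch := norm_num)) (by norm_num)
  · exact tendsto_nhdsLT_one_of_continuousAt (by fun_prop) (by norm_num)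

/-! ### Finite and infinite Jacobi identities -/

section Jacobi
variable {K : Type*} [Field K]

/-- The finite product `(1 - q) (1 - q²) ⋯ (1 - qⁿ)`. -/
def qFactorial (q : K) (n : ℕ) : K := ∏ k ∈ Finset.range n, (1 - q ^ (k + 1))

lemma qFactorial_zero (q : K) : qFactorial q 0 = 1 := rfl

lemma qFactorial_succ (q : K) (n : ℕ) :
    qFactorial q (n + 1) = qFactorial q n * (1 - q ^ (n + 1)) :=
  Finset.prod_range_succ _ _

/-- The Chebyshev-type polynomials `(x ^ (j + 1) - x ^ (-j)) / (x - 1)` in `s = x + 1 / x`. -/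
def chi (s : K) : ℕ → K
  | 0 => 1
  | 1 => s + 1
  | j + 2 => s * chi s (j + 1) - chi s j

/-- The signed power `(-1) ^ j * q ^ (j * (j + 1) / 2)`. -/
def triPow (q : K) (j : ℕ) : K := ∏ i ∈ Finset.range j, -q ^ (i + 1)

lemma triPow_zero (q : K) : triPow q 0 = 1 := rfl

lemma triPow_succ (q : K) (j : ℕ) : triPow q (j + 1) = triPow q j * -q ^ (j + 1) :=
  Finset.prod_range_succ _ _

/-- Summation of the recursion s χ(j + 1) = χ(j + 2) + χ(j). The boundary term comes from s χ(0) =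
χ(1) - χ(0). -/
lemma mul_sum_chi (s : K) (f : ℕ → K) (n : ℕ) :
    s * ∑ j ∈ Finset.range (n + 1), f j * chi s j =
      ∑ j ∈ Finset.range (n + 1), f j * chi s (j + 1) +
        ∑ j ∈ Finset.range n, f (j + 1) * chi s j - f 0 * chi s 0 := by
  induction n with
  | zero =>
    simp [chi]
    ring
  | succ n ih =>
    rw [Finset.sum_range_succ, mul_add, ih, Finset.sum_range_succ _ (n + 1),
      Finset.sum_range_succ (fun j => f (j + 1) * chi s j) n, chi.eq_3]
    ring

/-- The weights in the finite form of the Jacobi identity. -/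
def jacobiWeight (q : K) (n j : ℕ) : K :=
  if j ≤ n then triPow q j / (qFactorial q (n - j) * qFactorial q (n + j + 1)) else 0

lemma jacobiWeight_of_lt (q : K) {n j : ℕ} (h : n < j) : jacobiWeight q n j = 0 :=
  if_neg h.not_ge

/-- Writing n = m + j removes the truncated subtraction from the weight. -/
lemma jacobiWeight_add (q : K) (m j : ℕ) : jacobiWeight q (m + j) j =
    triPow q j / (qFactorial q m * qFactorial q (m + j + j + 1)) := by
  rw [jacobiWeight, if_pos (Nat.le_add_left j m), Nat.add_sub_cancel]

/-- The coefficient of χ(0) in the passage from n to n + 1 factors; the index 0 is separate because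
of the boundary term of `mul_sum_chi`. -/
lemma jacobiWeight_rec_zero {q : K} (hq : ∀ n, 1 - q ^ (n + 1) ≠ 0) (n : ℕ) :
    (1 - q ^ (2 * n + 2)) * (1 - q ^ (2 * n + 3)) * jacobiWeight q (n + 1) 0 =
      (1 + q ^ (2 * n + 2)) * jacobiWeight q n 0 -
        q ^ (n + 1) * (jacobiWeight q n 1 - jacobiWeight q n 0) := by
  have hp (n : ℕ) : qFactorial q n ≠ 0 := Finset.prod_ne_zero_iff.2 fun k _ => hq k
  have h0 := jacobiWeight_add q (n + 1) 0
  have h1 := jacobiWeight_add q n 0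
  simp only [add_zero] at h0 h1
  rw [h0, h1]
  rcases n with _ | m
  · rw [jacobiWeight_of_lt q one_pos]
    have a1 := hq 0
    have a2 := hq 1
    simp only [qFactorial_succ, qFactorial_zero, triPow_zero]
    field_simp
    ring
  · have h2 := jacobiWeight_add q m 1
    rw [h2]
    have a1 := hq m
    have a2 := hq (m + 1)
    have a3 := hq (m + 2)
    have a4 := hp m
    simp only [qFactorial_succ, triPow_zero, triPow_succ]
    field_simp
    ring

/-- The coefficient of χ(j + 1) when the product acquires the factor 1 - s q^(n+1) + q^(2n+2). The
left factors are the two new factors of `qFactorial`. -/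
lemma jacobiWeight_rec_succ {q : K} (hq : ∀ n, 1 - q ^ (n + 1) ≠ 0) {n j : ℕ} (hj : j ≤ n) :
    (1 - q ^ (2 * n + 2)) * (1 - q ^ (2 * n + 3)) * jacobiWeight q (n + 1) (j + 1) =
      (1 + q ^ (2 * n + 2)) * jacobiWeight q n (j + 1) -
        q ^ (n + 1) * (jacobiWeight q n j + jacobiWeight q n (j + 2)) := by
  have hp (n : ℕ) : qFactorial q n ≠ 0 := Finset.prod_ne_zero_iff.2 fun k _ => hq k
  obtain ⟨m, rfl⟩ := Nat.exists_eq_add_of_le' hj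
  have h0 := jacobiWeight_add q m (j + 1)
  have h1 := jacobiWeight_add q m j
  rw [← add_assoc] at h0
  rw [h0, h1]
  have key (a b c : ℕ) (hb : b = a + 1) (hc : c = a + 2) (ha : a = m + j + j + 1) :
      qFactorial q b = qFactorial q a * (1 - q ^ (m + j + j + 2)) ∧
      qFactorial q c = qFactorial q a * (1 - q ^ (m + j + j + 2)) * (1 - q ^ (m + j + j + 3)) := by
    subst hb hc ha
    exact ⟨qFactorial_succ _ _, by rw [qFactorial_succ, qFactorial_succ]⟩
  have a1 := hq (m + j + j + 1)
  have a2 := hq (m + j + j + 2)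
  have a4 := hp (m + j + j + 1)
  -- With m = n - j, the weights at j + 1 and j + 2 vanish when m = 0, and the one at j + 2 also
  -- when m = 1.
  rcases m with _ | _ | m
  · obtain ⟨k1, k2⟩ := key (0 + j + j + 1) _ (0 + j + 1 + (j + 1) + 1) rfl (by omega) rfl
    rw [jacobiWeight_of_lt q (by omega), jacobiWeight_of_lt q (by omega), k2,
      qFactorial_zero, triPow_succ]
    generalize qFactorial q (0 + j + j + 1) = P at *
    field_simp
    ring
  · have h2 := jacobiWeight_add q 0 (j + 1)
    obtain ⟨k1, k2⟩ := key (0 + 1 + j + j + 1) (0 + 1 + j + (j + 1) + 1)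
      (0 + 1 + j + 1 + (j + 1) + 1) (by omega) (by omega) rfl
    rw [show 0 + (j + 1) = 0 + 1 + j by ring] at h2
    have a3 := hq 0
    rw [jacobiWeight_of_lt q (show 0 + 1 + j < j + 2 by omega), h2, k1, k2]
    simp only [qFactorial_succ q 0, qFactorial_zero, triPow_succ]
    generalize qFactorial q (0 + 1 + j + j + 1) = P at *
    field_simp
    ring
  · have h2 := jacobiWeight_add q (m + 1) (j + 1)
    have h3 := jacobiWeight_add q m (j + 2)
    obtain ⟨k1, k2⟩ := key (m + 1 + 1 + j + j + 1) (m + 1 + 1 + j + (j + 1) + 1)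
      (m + 1 + 1 + j + 1 + (j + 1) + 1) (by omega) (by omega) rfl
    rw [show m + 1 + (j + 1) = m + 1 + 1 + j by ring] at h2
    rw [show m + (j + 2) = m + 1 + 1 + j by ring] at h3
    have a3 := hq m
    have a5 := hq (m + 1)
    have a6 := hp m
    rw [h2, h3, show m + 1 + 1 + j + (j + 2) + 1 = m + 1 + 1 + j + 1 + (j + 1) + 1 by ring, k1, k2]
    simp only [qFactorial_succ q (m + 1), qFactorial_succ q m, triPow_succ]
    generalize qFactorial q (m + 1 + 1 + j + j + 1) = P at *
    generalize qFactorial q m = R at *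
    field_simp
    ring

/-- A finite form of the Jacobi triple product identity. -/
theorem prod_eq_sum_jacobiWeight {q : K} (hq : ∀ n, 1 - q ^ (n + 1) ≠ 0) (s : K) (n : ℕ) :
    ∏ k ∈ Finset.range n, (1 - s * q ^ (k + 1) + q ^ (2 * (k + 1))) =
      qFactorial q (2 * n + 1) * ∑ j ∈ Finset.range (n + 1), jacobiWeight q n j * chi s j := by
  induction n with
  | zero =>
    have := hq 0
    have h := jacobiWeight_add q 0 0
    simp only [add_zero] at h
    simp only [Finset.prod_range_zero, mul_zero, zero_add, Finset.sum_range_one, h, qFactorial_succ,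
      qFactorial_zero, triPow_zero, chi]
    rw [zero_add, pow_one] at this
    field_simp
  | succ n ih =>
    have h1 := mul_sum_chi s (jacobiWeight q n) n
    have h2 : ∑ j ∈ Finset.range (n + 1), jacobiWeight q n j * chi s j =
        jacobiWeight q n 0 * chi s 0 +
          ∑ j ∈ Finset.range (n + 1), jacobiWeight q n (j + 1) * chi s (j + 1) := by
      have h4 := Finset.sum_range_succ (fun j => jacobiWeight q n j * chi s j) (n + 1)
      rw [jacobiWeight_of_lt q (Nat.lt_succ_self n), zero_mul, add_zero] at h4
      rw [← h4, Finset.sum_range_succ']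
      ring
    have h3 : ∑ j ∈ Finset.range n, jacobiWeight q n (j + 1) * chi s j =
        jacobiWeight q n 1 * chi s 0 +
          ∑ j ∈ Finset.range (n + 1), jacobiWeight q n (j + 2) * chi s (j + 1) := by
      have h4 : ∑ j ∈ Finset.range (n + 2), jacobiWeight q n (j + 1) * chi s j =
          ∑ j ∈ Finset.range n, jacobiWeight q n (j + 1) * chi s j := by
        rw [Finset.sum_range_succ, Finset.sum_range_succ, jacobiWeight_of_lt q (by omega),
          jacobiWeight_of_lt q (by omega)]
        ring
      rw [← h4, Finset.sum_range_succ']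
      ring
    have h5 : (1 - q ^ (2 * n + 2)) * (1 - q ^ (2 * n + 3)) *
        ∑ j ∈ Finset.range (n + 2), jacobiWeight q (n + 1) j * chi s j =
        (1 - s * q ^ (n + 1) + q ^ (2 * (n + 1))) *
          ∑ j ∈ Finset.range (n + 1), jacobiWeight q n j * chi s j := by
      have h6 : (1 - s * q ^ (n + 1) + q ^ (2 * (n + 1))) *
          ∑ j ∈ Finset.range (n + 1), jacobiWeight q n j * chi s j =
          (1 + q ^ (2 * n + 2)) * (∑ j ∈ Finset.range (n + 1), jacobiWeight q n j * chi s j) -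
            q ^ (n + 1) * (s * ∑ j ∈ Finset.range (n + 1), jacobiWeight q n j * chi s j) := by
        ring
      rw [h6, h1, h3, h2, Finset.sum_range_succ']
      have h7 : (1 - q ^ (2 * n + 2)) * (1 - q ^ (2 * n + 3)) *
          ∑ j ∈ Finset.range (n + 1), jacobiWeight q (n + 1) (j + 1) * chi s (j + 1) =
          ∑ j ∈ Finset.range (n + 1), ((1 + q ^ (2 * n + 2)) * jacobiWeight q n (j + 1) -
            q ^ (n + 1) * (jacobiWeight q n j + jacobiWeight q n (j + 2))) * chi s (j + 1) := by
        rw [Finset.mul_sum]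
        refine Finset.sum_congr rfl fun j hj => ?_
        rw [← jacobiWeight_rec_succ hq (Nat.lt_succ_iff.1 (Finset.mem_range.1 hj))]
        ring
      have h8 : ∑ j ∈ Finset.range (n + 1), ((1 + q ^ (2 * n + 2)) * jacobiWeight q n (j + 1) -
            q ^ (n + 1) * (jacobiWeight q n j + jacobiWeight q n (j + 2))) * chi s (j + 1) =
          (1 + q ^ (2 * n + 2)) *
            ∑ j ∈ Finset.range (n + 1), jacobiWeight q n (j + 1) * chi s (j + 1) -
          q ^ (n + 1) * (∑ j ∈ Finset.range (n + 1), jacobiWeight q n j * chi s (j + 1) +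
            ∑ j ∈ Finset.range (n + 1), jacobiWeight q n (j + 2) * chi s (j + 1)) := by
        rw [Finset.mul_sum, ← Finset.sum_add_distrib, Finset.mul_sum, ← Finset.sum_sub_distrib]
        exact Finset.sum_congr rfl fun j _ => by ring
      linear_combination h7 + h8 + chi s 0 * jacobiWeight_rec_zero hq n
    rw [Finset.prod_range_succ, ih, show 2 * (n + 1) + 1 = 2 * n + 1 + 1 + 1 by ring,
      qFactorial_succ q (2 * n + 1 + 1), qFactorial_succ q (2 * n + 1)]
    linear_combination -qFactorial q (2 * n + 1) * h5

end Jacobi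

/-! ### Theta series as Euler products. -/

/-- The Euler product `∏ (1 - q ^ n)`. -/
noncomputable def euler (q : ℂ) : ℂ := ∏' n : ℕ, (1 - q ^ (n + 1))

lemma one_sub_pow_succ_ne_zero {q : ℂ} (hq : ‖q‖ < 1) (n : ℕ) : 1 - q ^ (n + 1) ≠ 0 := by
  intro h
  have h1 : ‖q ^ (n + 1)‖ < 1 := by
    rw [norm_pow]
    exact pow_lt_one₀ (norm_nonneg _) hq n.succ_ne_zero
  rw [← sub_eq_zero.1 h, norm_one] at h1
  exact lt_irrefl _ h1

lemma tendsto_qFactorial {q : ℂ} (hq : ‖q‖ < 1) :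
    Tendsto (qFactorial q) atTop (𝓝 (euler q)) :=
  (ModularForm.multipliable_one_sub_pow hq).hasProd.tendsto_prod_nat

lemma euler_ne_zero {q : ℂ} (hq : ‖q‖ < 1) : euler q ≠ 0 := by
  refine tprod_one_add_ne_zero_of_summable (f := fun n => -q ^ (n + 1)) (fun n => ?_) ?_
  · rw [← sub_eq_add_neg]
    exact one_sub_pow_succ_ne_zero hq n
  · simpa using (summable_nat_add_iff 1).mpr (summable_geometric_of_lt_one (norm_nonneg _) hq)

lemma continuousAt_euler_zero : ContinuousAt euler 0 :=
  (ModularForm.differentiableOn_tprod_one_sub_pow.differentiableAt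
    (Metric.ball_mem_nhds 0 one_pos)).continuousAt

lemma euler_zero : euler 0 = 1 := by simp [euler]

/-- The Jacobi triple product identity for a given limit of the finite products. -/
theorem hasSum_jacobi {q s P : ℂ} (hq : ‖q‖ < 1) (hs : Summable fun j => ‖triPow q j * chi s j‖)
    (hP : Tendsto (fun n => ∏ k ∈ Finset.range n, (1 - s * q ^ (k + 1) + q ^ (2 * (k + 1)))) atTop
      (𝓝 P)) : HasSum (fun j => triPow q j * chi s j) (P * euler q) := by
  have hE := tendsto_qFactorial hq
  have hE0 := euler_ne_zero hq
  have hp (n : ℕ) : qFactorial q n ≠ 0 :=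
    Finset.prod_ne_zero_iff.2 fun k _ => one_sub_pow_succ_ne_zero hq k
  have hE1 := hE.inv₀ hE0
  obtain ⟨C, hC⟩ := (Metric.isBounded_range_of_tendsto _ hE1).exists_norm_le
  obtain ⟨D, hD⟩ := (Metric.isBounded_range_of_tendsto _ hE).exists_norm_le
  have hC' (n : ℕ) : ‖(qFactorial q n)⁻¹‖ ≤ C := hC _ ⟨n, rfl⟩
  have hC0 : 0 ≤ C := (norm_nonneg _).trans (hC' 0)
  have hD' (n : ℕ) : ‖qFactorial q n‖ ≤ D := hD _ ⟨n, rfl⟩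
  -- Tannery's theorem: each weight converges to `triPow q j / euler q ^ 2`, and `qFactorial` and
  -- its inverse are bounded uniformly in n.
  have hlim : Tendsto (fun n => ∑' j, qFactorial q (2 * n + 1) * (jacobiWeight q n j * chi s j))
      atTop (𝓝 (∑' j, euler q * (triPow q j * chi s j * ((euler q)⁻¹ * (euler q)⁻¹)))) := by
    refine tendsto_tsum_of_dominated_convergence
      (bound := fun j => D * (‖triPow q j * chi s j‖ * (C * C)))
      ((hs.mul_right _).mul_left _) (fun j => ?_) (Eventually.of_forall fun n j => ?_)
    · have h1 : Tendsto (fun n => 2 * n + 1) atTop atTop :=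
        tendsto_atTop_mono (fun n => by dsimp only [id]; omega) tendsto_id
      have h2 : Tendsto (fun n => n - j) atTop atTop := tendsto_sub_atTop_nat j
      have h3 : Tendsto (fun n => n + j + 1) atTop atTop :=
        tendsto_atTop_mono (fun n => by dsimp only [id]; omega) tendsto_id
      refine ((hE.comp h1).mul ((hE1.comp h2).mul (hE1.comp h3) |>.const_mul
        (triPow q j * chi s j))).congr' ?_
      filter_upwards [eventually_ge_atTop j] with n hn
      rw [jacobiWeight, if_pos hn]
      simp only [Function.comp_apply]
      field_simp
    · rw [norm_mul]
      have hD0 : 0 ≤ D := (norm_nonneg _).trans (hD' 0)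
      refine mul_le_mul (hD' _) ?_ (norm_nonneg _) hD0
      by_cases hn : j ≤ n
      · rw [jacobiWeight, if_pos hn, show triPow q j / (qFactorial q (n - j) *
          qFactorial q (n + j + 1)) * chi s j = triPow q j * chi s j *
          ((qFactorial q (n - j))⁻¹ * (qFactorial q (n + j + 1))⁻¹) by field_simp,
          norm_mul, norm_mul (qFactorial q (n - j))⁻¹]
        have := hC' (n - j)
        have := hC' (n + j + 1)
        gcongr
      · rw [jacobiWeight, if_neg hn, zero_mul, norm_zero]
        positivity
  have h2 : (fun n => ∏ k ∈ Finset.range n, (1 - s * q ^ (k + 1) + q ^ (2 * (k + 1)))) =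
      fun n => ∑' j, qFactorial q (2 * n + 1) * (jacobiWeight q n j * chi s j) := by
    ext n
    rw [prod_eq_sum_jacobiWeight (one_sub_pow_succ_ne_zero hq), Finset.mul_sum, tsum_eq_sum]
    intro j hj
    rw [jacobiWeight_of_lt q (by simpa using hj)]
    ring
  rw [h2] at hP
  have h3 := tendsto_nhds_unique hP hlim
  refine HasSum.of_eq hs.of_norm.hasSum (fun _ => rfl) ?_
  rw [h3, tsum_mul_left, tsum_mul_right]
  field_simp

lemma triPow_eq (q : ℂ) (j : ℕ) : triPow q j = (-1) ^ j * q ^ (j * (j + 1) / 2) := by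
  induction j with
  | zero => simp [triPow_zero]
  | succ j ih =>
    rw [triPow_succ, ih, show (j + 1) * (j + 1 + 1) / 2 = j * (j + 1) / 2 + (j + 1) by
      rw [show (j + 1) * (j + 1 + 1) = j * (j + 1) + (j + 1) * 2 by ring,
        Nat.add_mul_div_right _ _ two_pos], pow_add, pow_succ]
    ring

lemma le_tri (j : ℕ) : j ≤ j * (j + 1) / 2 := by
  rw [Nat.le_div_iff_mul_le two_pos]
  rcases j with _ | j
  · rfl
  · exact Nat.mul_le_mul_left _ (by omega)

lemma norm_pow_le_pow {q : ℂ} (hq : ‖q‖ < 1) {m n : ℕ} (h : m ≤ n) : ‖q ^ n‖ ≤ ‖q‖ ^ m := by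
  rw [norm_pow]
  exact pow_le_pow_of_le_one (norm_nonneg _) hq.le h

/-- Jacobi's identity for the cube of the Euler product. -/
theorem hasSum_euler_cube {q : ℂ} (hq : ‖q‖ < 1) :
    HasSum (fun j : ℕ => (-1) ^ j * (2 * j + 1) * q ^ (j * (j + 1) / 2)) (euler q ^ 3) := by
  -- The value s = x + 1/x = 2 is the point x = 1, where each factor of the product is (1 - q^k)².
  have hchi (j : ℕ) : chi (2 : ℂ) j = 2 * j + 1 := by
    induction j using Nat.strong_induction_on with
    | _ j ih =>
      rcases j with _ | _ | j
      · simp [chi]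
      · norm_num [chi]
      · rw [chi, ih _ (by omega), ih _ (by omega)]
        push_cast
        ring
  refine HasSum.of_eq (hasSum_jacobi (s := 2) (P := euler q ^ 2) hq ?_ ?_) (fun j => ?_) (by ring)
  · have h1 := ((summable_pow_mul_geometric_of_norm_lt_one 1 (r := ‖q‖) (by simpa)).mul_left 2).add
      (summable_geometric_of_lt_one (norm_nonneg q) hq)
    refine Summable.of_nonneg_of_le (fun _ => norm_nonneg _) (fun j => ?_) h1
    rw [hchi, triPow_eq, norm_mul, norm_mul]
    have h2 : ‖(2 * j + 1 : ℂ)‖ = 2 * j + 1 := by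
      rw [show (2 * j + 1 : ℂ) = ((2 * j + 1 : ℕ) : ℂ) by push_cast; rfl, Complex.norm_natCast]
      push_cast
      rfl
    rw [h2, norm_pow, norm_neg, norm_one, one_pow, one_mul]
    calc _ ≤ ‖q‖ ^ j * (2 * j + 1) := by
          gcongr
          exact norm_pow_le_pow hq (le_tri j)
      _ = _ := by ring
  · refine ((tendsto_qFactorial hq).pow 2).congr fun n => ?_
    rw [qFactorial, ← Finset.prod_pow]
    exact Finset.prod_congr rfl fun k _ => by ring
  · rw [hchi, triPow_eq]
    ring

/-- Gauss's identity for the sum of `q` over the triangular numbers. -/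
theorem hasSum_euler_sq_div {q : ℂ} (hq : ‖q‖ < 1) :
    HasSum (fun j : ℕ => q ^ (j * (j + 1) / 2)) (euler (q ^ 2) ^ 2 / euler q) := by
  -- The value s = -2 is the point x = -1, with factors (1 + q^k)² = ((1 - q^(2k)) / (1 - q^k))².
  have hchi (j : ℕ) : chi (-2 : ℂ) j = (-1) ^ j := by
    induction j using Nat.strong_induction_on with
    | _ j ih =>
      rcases j with _ | _ | j
      · simp [chi]
      · norm_num [chi]
      · rw [chi, ih _ (by omega), ih _ (by omega), pow_add, pow_succ]
        ring
  have hq2 : ‖q ^ 2‖ < 1 := by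
    rw [norm_pow]
    exact pow_lt_one₀ (norm_nonneg _) hq two_ne_zero
  have h0 := euler_ne_zero hq
  have hterm (j : ℕ) : triPow q j * chi (-2) j = q ^ (j * (j + 1) / 2) := by
    rw [hchi, triPow_eq, mul_right_comm, ← mul_pow]
    norm_num
  refine HasSum.of_eq (hasSum_jacobi (s := -2) (P := (euler (q ^ 2) / euler q) ^ 2) hq ?_ ?_)
    (fun j => (hterm j).symm) (by field_simp)
  · refine Summable.of_nonneg_of_le (fun _ => norm_nonneg _) (fun j => ?_)
      (summable_geometric_of_lt_one (norm_nonneg q) hq)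
    rw [hterm]
    exact norm_pow_le_pow hq (le_tri j)
  · refine (((tendsto_qFactorial hq2).div (tendsto_qFactorial hq) h0).pow 2).congr fun n => ?_
    simp only [Pi.div_apply, qFactorial]
    rw [← Finset.prod_div_distrib, ← Finset.prod_pow]
    refine Finset.prod_congr rfl fun k _ => ?_
    have := one_sub_pow_succ_ne_zero hq k
    field_simp
    ring

/-- The theta function `∑ (-1) ^ n q ^ (n ^ 2)` as a product. -/
theorem hasSum_euler_sq_div_euler_sq {q : ℂ} (hq : ‖q‖ < 1) :
    HasSum (fun j : ℕ => 2 * (-1) ^ j * q ^ (j ^ 2)) (euler q ^ 2 / euler (q ^ 2) + 1) := by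
  have hS : Summable fun j : ℕ => 2 * (-1) ^ j * q ^ (j ^ 2) := by
    refine Summable.of_norm_bounded (g := fun j => 2 * ‖q‖ ^ j)
      ((summable_geometric_of_lt_one (norm_nonneg q) hq).mul_left 2) fun j => ?_
    rw [norm_mul, norm_mul, norm_pow (-1 : ℂ), norm_neg, norm_one, one_pow, mul_one]
    norm_num
    rw [← norm_pow]
    exact norm_pow_le_pow hq (Nat.le_self_pow two_ne_zero j)
  rcases eq_or_ne q 0 with rfl | hq0
  · refine HasSum.of_eq (hasSum_ite_eq 0 (2 : ℂ)) (fun j => ?_) ?_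
    · rcases j with _ | j <;> simp
    · norm_num [euler_zero]
  have hq2 : ‖q ^ 2‖ < 1 := by
    rw [norm_pow]
    exact pow_lt_one₀ (norm_nonneg _) hq two_ne_zero
  have h0 := euler_ne_zero hq2
  have h1 : 1 - q ≠ 0 := by simpa using one_sub_pow_succ_ne_zero hq 0
  -- The triple product with base q² at x = q; the point q = 0 had to be treated apart.
  have hchi (j : ℕ) : chi (q + 1 / q) j = (1 - q ^ (2 * j + 1)) / (q ^ j * (1 - q)) := by
    induction j using Nat.strong_induction_on with
    | _ j ih =>
      rcases j with _ | _ | j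
      · simp [chi, h1]
      · rw [chi]
        field_simp
        ring
      · rw [chi, ih _ (by omega), ih _ (by omega)]
        field_simp
        ring
  have hterm (j : ℕ) : triPow (q ^ 2) j * chi (q + 1 / q) j =
      (1 / (1 - q)) * ((-1) ^ j * q ^ (j ^ 2) + (-1) ^ j * (-1) * q ^ ((j + 1) ^ 2)) := by
    rw [hchi, triPow_eq, ← pow_mul, Nat.mul_div_cancel' (Nat.even_mul_succ_self j).two_dvd,
      show j * (j + 1) = j ^ 2 + j by ring, show (j + 1) ^ 2 = j ^ 2 + (2 * j + 1) by ring,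
      pow_add q, pow_add q (j ^ 2) (2 * j + 1)]
    field_simp
    ring
  have hS1 := (hS.mul_left (1 / 2)).add ((summable_nat_add_iff 1).2 (hS.mul_left (1 / 2)))
  have hsum : HasSum (fun j => triPow (q ^ 2) j * chi (q + 1 / q) j)
      ((euler q / euler (q ^ 2)) ^ 2 / (1 - q) * euler (q ^ 2)) := by
    refine hasSum_jacobi hq2 ?_ ?_
    · refine ((hS1.mul_left (1 / (1 - q))).congr fun j => ?_).norm
      rw [hterm, pow_succ]
      ring
    · have hodd (n : ℕ) : ∏ k ∈ Finset.range n, (1 - q ^ (2 * k + 1)) =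
          qFactorial q (2 * n) / qFactorial (q ^ 2) n := by
        have hp : qFactorial (q ^ 2) n ≠ 0 :=
          Finset.prod_ne_zero_iff.2 fun k _ => one_sub_pow_succ_ne_zero hq2 k
        rw [eq_div_iff hp]
        clear hp
        induction n with
        | zero => simp [qFactorial_zero]
        | succ n ih =>
          rw [Finset.prod_range_succ, qFactorial_succ, show 2 * (n + 1) = 2 * n + 1 + 1 by ring,
            qFactorial_succ q, qFactorial_succ q, ← ih]
          ring
      -- Each factor is (1 - q^(2k+1)) (1 - q^(2k+3)), so the product of odd factors appears twice,
      -- the second copy shifted by one place. The shift accounts for the two end factors.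
      have hprod (n : ℕ) : ∏ k ∈ Finset.range n,
          (1 - (q + 1 / q) * (q ^ 2) ^ (k + 1) + (q ^ 2) ^ (2 * (k + 1))) =
          (qFactorial q (2 * n) / qFactorial (q ^ 2) n) ^ 2 / (1 - q) * (1 - q ^ (2 * n + 1)) := by
        rw [← hodd]
        induction n with
        | zero => simp [h1]
        | succ n ih =>
          rw [Finset.prod_range_succ, ih, Finset.prod_range_succ _ n]
          field_simp
          ring
      simp only [hprod]
      have t1 : Tendsto (fun n => 2 * n) atTop atTop :=
        tendsto_atTop_mono (fun n => by dsimp only [id]; omega) tendsto_id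
      have t2 : Tendsto (fun n => 2 * n + 1) atTop atTop :=
        tendsto_atTop_mono (fun n => by dsimp only [id]; omega) tendsto_id
      have t3 := ((tendsto_pow_atTop_nhds_zero_of_norm_lt_one hq).comp t2).const_sub 1
      have t4 := ((((tendsto_qFactorial hq).comp t1).div (tendsto_qFactorial hq2) h0).pow 2).div_const
        (1 - q)
      have t5 := t4.mul t3
      rw [sub_zero, mul_one] at t5
      exact t5
  have h2 := hsum.mul_left (1 - q)
  -- The triple product gives the sum of the series and its shift. The term j = 0 is 2 instead of 1,
  -- hence the final + 1.
  have h3 : HasSum (fun j : ℕ => 2 * (-1) ^ (j + 1) * q ^ ((j + 1) ^ 2))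
      ((∑' j : ℕ, 2 * (-1) ^ j * q ^ (j ^ 2)) - 2) := by
    have := (hasSum_nat_add_iff' 1).2 hS.hasSum
    simpa using this
  have h4 := (hS.hasSum.add h3).unique (HasSum.of_eq (h2.mul_left 2) (fun j => ?_) rfl)
  · refine HasSum.of_eq hS.hasSum (fun _ => rfl) ?_
    have h5 : (1 - q) * ((euler q / euler (q ^ 2)) ^ 2 / (1 - q) * euler (q ^ 2)) =
        euler q ^ 2 / euler (q ^ 2) := by field_simp
    rw [h5] at h4
    linear_combination -h4 / 2
  · rw [hterm, pow_succ (-1 : ℂ)]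
    field_simp

/-! ### Dissections by roots of unity. -/

lemma tendsto_mul_add_atTop {a : ℕ} (ha : 0 < a) : Tendsto (fun n => a * n) atTop atTop :=
  tendsto_id.const_mul_atTop' ha

lemma norm_pow_lt_one {q : ℂ} (hq : ‖q‖ < 1) {n : ℕ} (hn : n ≠ 0) : ‖q ^ n‖ < 1 := by
  rw [norm_pow]
  exact pow_lt_one₀ (norm_nonneg _) hq hn

/-- The factors 1 - q^k and 1 - (-q)^k multiply to 1 - q^(2k) for odd k and to (1 - q^k)² for even
k. The limit is taken over products with 2n factors to keep the parities balanced. -/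
lemma euler_mul_euler_neg {q : ℂ} (hq : ‖q‖ < 1) :
    euler q * euler (-q) * euler (q ^ 4) = euler (q ^ 2) ^ 3 := by
  have h2 : Tendsto (fun n => 2 * n) atTop atTop := tendsto_mul_add_atTop two_pos
  have t1 := ((tendsto_qFactorial hq).comp h2).mul
    ((tendsto_qFactorial (q := -q) (by rwa [norm_neg])).comp h2) |>.mul
    (tendsto_qFactorial (norm_pow_lt_one hq four_ne_zero))
  have hq2 := tendsto_qFactorial (norm_pow_lt_one hq two_ne_zero)
  have t2 := (hq2.comp h2).mul (hq2.pow 2)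
  rw [show euler (q ^ 2) ^ 3 = euler (q ^ 2) * euler (q ^ 2) ^ 2 by ring]
  refine tendsto_nhds_unique t1 (t2.congr fun n => ?_)
  simp only [Function.comp_apply]
  induction n with
  | zero => simp [qFactorial_zero]
  | succ n ih =>
    simp only [show 2 * (n + 1) = 2 * n + 1 + 1 by ring, qFactorial_succ _ (2 * n + 1),
      qFactorial_succ _ (2 * n), qFactorial_succ _ n]
    have e1 : (-q) ^ (2 * n + 1) = -q ^ (2 * n + 1) := Odd.neg_pow ⟨n, by ring⟩ q
    have e2 : (-q) ^ (2 * n + 1 + 1) = q ^ (2 * n + 1 + 1) := Even.neg_pow ⟨n + 1, by ring⟩ q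
    rw [e1, e2]
    simp only [← pow_mul]
    linear_combination (1 - q ^ (2 * (2 * n + 1))) * (1 - q ^ (2 * (2 * n + 1 + 1))) *
      (1 - q ^ (2 * (n + 1))) ^ 2 * ih

lemma norm_eq_one_of_sq_add {ω : ℂ} (hω : ω ^ 2 + ω + 1 = 0) : ‖ω‖ = 1 := by
  have h3 : ω ^ 3 = 1 := by linear_combination (ω - 1) * hω
  have h4 : ‖ω‖ ^ 3 = 1 := by rw [← norm_pow, h3, norm_one]
  exact (pow_eq_one_iff_of_nonneg (norm_nonneg _) three_ne_zero).1 h4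

/-- The three conjugate factors multiply to 1 - q^(3k) when 3 does not divide k, and to (1 - q^k)³
when it does. -/
lemma euler_mul_euler_mul_euler {q ω : ℂ} (hq : ‖q‖ < 1) (hω : ω ^ 2 + ω + 1 = 0) :
    euler q * euler (ω * q) * euler (ω ^ 2 * q) * euler (q ^ 9) = euler (q ^ 3) ^ 4 := by
  have hn := norm_eq_one_of_sq_add hω
  have h3 : Tendsto (fun n => 3 * n) atTop atTop := tendsto_mul_add_atTop three_pos
  have t1 := ((tendsto_qFactorial hq).comp h3).mul
    ((tendsto_qFactorial (q := ω * q) (by rwa [norm_mul, hn, one_mul])).comp h3) |>.mul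
    ((tendsto_qFactorial (q := ω ^ 2 * q) (by rwa [norm_mul, norm_pow, hn, one_pow, one_mul])).comp
      h3) |>.mul (tendsto_qFactorial (norm_pow_lt_one hq (show 9 ≠ 0 by norm_num)))
  have hq2 := tendsto_qFactorial (norm_pow_lt_one hq three_ne_zero)
  have t2 := (hq2.comp h3).mul (hq2.pow 3)
  rw [show euler (q ^ 3) ^ 4 = euler (q ^ 3) * euler (q ^ 3) ^ 3 by ring]
  refine tendsto_nhds_unique t1 (t2.congr fun n => ?_)
  simp only [Function.comp_apply]
  have hω3 : ω ^ 3 = 1 := by linear_combination (ω - 1) * hω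
  induction n with
  | zero => simp [qFactorial_zero]
  | succ n ih =>
    simp only [show 3 * (n + 1) = 3 * n + 1 + 1 + 1 by ring, qFactorial_succ _ (3 * n + 1 + 1),
      qFactorial_succ _ (3 * n + 1), qFactorial_succ _ (3 * n), qFactorial_succ _ n]
    have e0 : ω ^ (3 * n) = 1 := by rw [pow_mul, hω3, one_pow]
    have e1 (x : ℂ) : (1 - x) * (1 - ω * x) * (1 - ω ^ 2 * x) = 1 - x ^ 3 := by
      linear_combination (x ^ 2 - x) * hω + (x ^ 2 - x ^ 3) * hω3
    simp only [mul_pow, ← pow_mul, mul_comm 2]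
    simp only [pow_mul ω _ 2]
    have f1 : ω ^ (3 * n + 1) = ω := by rw [pow_succ, e0, one_mul]
    have f2 : ω ^ (3 * n + 1 + 1) = ω ^ 2 := by rw [pow_succ, f1]; ring
    have f3 : ω ^ (3 * n + 1 + 1 + 1) = 1 := by rw [pow_succ, f2, ← hω3]; ring
    have f4 : (ω ^ 2) ^ 2 = ω := by linear_combination ω * hω3
    rw [f1, f2, f3, f4]
    have g1 := e1 (q ^ (3 * n + 1))
    have g2 := e1 (q ^ (3 * n + 1 + 1))
    linear_combination (1 - q ^ (3 * (3 * n + 1))) * (1 - q ^ (3 * (3 * n + 1 + 1))) *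
      (1 - q ^ (9 * (n + 1))) * (1 - q ^ (3 * (n + 1))) ^ 3 * ih -
      qFactorial q (3 * n) * qFactorial (ω * q) (3 * n) * qFactorial (ω ^ 2 * q) (3 * n) *
      qFactorial (q ^ 9) n * (1 - q ^ (9 * (n + 1))) * (1 - q ^ (3 * (n + 1))) ^ 3 *
      ((1 - q ^ (3 * n + 1 + 1)) * (1 - ω * q ^ (3 * n + 1 + 1)) *
        (1 - ω ^ 2 * q ^ (3 * n + 1 + 1)) * g1 + (1 - (q ^ (3 * n + 1)) ^ 3) * g2)

/-- The theta function `∑ (-q) ^ (n ^ 2)`, `n ∈ ℤ`. -/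
noncomputable def phi (q : ℂ) : ℂ := euler q ^ 2 / euler (q ^ 2)

lemma hasSum_phi_neg {q : ℂ} (hq : ‖q‖ < 1) :
    HasSum (fun j : ℕ => 2 * q ^ (j ^ 2)) (phi (-q) + 1) := by
  refine HasSum.of_eq (hasSum_euler_sq_div_euler_sq (q := -q) (by rwa [norm_neg])) (fun j => ?_) rfl
  rw [neg_pow q, ← mul_assoc, mul_assoc 2, ← pow_add, Even.neg_one_pow, mul_one]
  rw [show j + j ^ 2 = j * (j + 1) by ring]
  exact Nat.even_mul_succ_self j

/-- Only even indices survive in the sum, and (2k)² = 4k². -/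
lemma phi_add_phi_neg {q : ℂ} (hq : ‖q‖ < 1) : phi q + phi (-q) = 2 * phi (-q ^ 4) := by
  have h1 := (hasSum_phi_neg hq).add (hasSum_euler_sq_div_euler_sq hq)
  have h2 := (hasSum_phi_neg (norm_pow_lt_one hq four_ne_zero)).mul_left 2
  have hi : Function.Injective fun k : ℕ => 2 * k := fun a b h => by simpa using h
  have h3 := (hi.hasSum_iff (f := fun j : ℕ => 2 * q ^ (j ^ 2) + 2 * (-1) ^ j * q ^ (j ^ 2))
    (a := 2 * (phi (-q ^ 4) + 1)) fun j hj => ?_).1 (HasSum.of_eq h2 (fun j => ?_) rfl)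
  · have h4 := h1.unique h3
    rw [← phi] at h4
    linear_combination h4
  · have hj' : Odd j := by
      rw [← Nat.not_even_iff_odd]
      rintro ⟨k, hk⟩
      exact hj ⟨k, by simp only; omega⟩
    rw [hj'.neg_one_pow]
    ring
  · simp only [Function.comp_apply, pow_mul (-1 : ℂ) 2 j]
    norm_num
    ring

/-- Only odd indices survive, and (2k + 1)² is 1 plus eight times a triangular number, so Gauss's
triangular series gives the product. -/
lemma phi_neg_sub_phi {q : ℂ} (hq : ‖q‖ < 1) :
    phi (-q) - phi q = 4 * q * (euler (q ^ 16) ^ 2 / euler (q ^ 8)) := by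
  have h1 := (hasSum_phi_neg hq).sub (hasSum_euler_sq_div_euler_sq hq)
  have h2 := (hasSum_euler_sq_div (norm_pow_lt_one hq (show 8 ≠ 0 by norm_num))).mul_left (4 * q)
  have hi : Function.Injective fun k : ℕ => 2 * k + 1 := fun a b h => by simpa using h
  have h3 := (hi.hasSum_iff (f := fun j : ℕ => 2 * q ^ (j ^ 2) - 2 * (-1) ^ j * q ^ (j ^ 2))
    (a := 4 * q * (euler ((q ^ 8) ^ 2) ^ 2 / euler (q ^ 8))) fun j hj => ?_).1
    (HasSum.of_eq h2 (fun j => ?_) rfl)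
  · have h4 := h1.unique h3
    rw [← phi, ← pow_mul] at h4
    linear_combination h4
  · have hj' : Even j := by
      rw [← Nat.not_odd_iff_even]
      rintro ⟨k, hk⟩
      exact hj ⟨k, by simp only; omega⟩
    rw [hj'.neg_one_pow]
    ring
  · simp only [Function.comp_apply, pow_succ (-1 : ℂ), pow_mul (-1 : ℂ) 2 j]
    have e : (2 * j + 1) ^ 2 = 8 * (j * (j + 1) / 2) + 1 := by
      have := Nat.mul_div_cancel' (Nat.even_mul_succ_self j).two_dvd
      linarith [this, (by ring : (2 * j + 1) ^ 2 = 4 * (j * (j + 1)) + 1)]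
    rw [e, pow_succ, pow_mul]
    norm_num
    ring

/-- In Jacobi's series the exponent j (j + 1) / 2 is divisible by 3 unless j = 3k + 1. Those terms
add up to -3q times the same series in q⁹, so the expression here is a power series in q³. -/
lemma euler_cube_mul_root {q ω : ℂ} (hq : ‖q‖ < 1) (hω : ω ^ 2 + ω + 1 = 0) :
    euler (ω * q) ^ 3 + 3 * (ω * q) * euler (q ^ 9) ^ 3 =
      euler q ^ 3 + 3 * q * euler (q ^ 9) ^ 3 := by
  have hn := norm_eq_one_of_sq_add hω
  have hω3 : ω ^ 3 = 1 := by linear_combination (ω - 1) * hω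
  have h1 := (hasSum_euler_cube hq).sub
    (hasSum_euler_cube (q := ω * q) (by rwa [norm_mul, hn, one_mul]))
  have h2 := (hasSum_euler_cube (norm_pow_lt_one hq (show 9 ≠ 0 by norm_num))).mul_left
    ((ω - 1) * 3 * q)
  have hi : Function.Injective fun k : ℕ => 3 * k + 1 := fun a b h => by simpa using h
  have h3 := (hi.hasSum_iff (f := fun j : ℕ => (-1) ^ j * (2 * j + 1) * q ^ (j * (j + 1) / 2) -
    (-1) ^ j * (2 * j + 1) * (ω * q) ^ (j * (j + 1) / 2))
    (a := (ω - 1) * 3 * q * euler (q ^ 9) ^ 3) fun j hj => ?_).1 (HasSum.of_eq h2 (fun j => ?_) rfl)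
  · linear_combination -h1.unique h3
  · have h3 : 3 ∣ j * (j + 1) / 2 := by
      have h4 : 3 ∣ j * (j + 1) := by
        have : j % 3 ≠ 1 := fun h => hj ⟨j / 3, by simp only; omega⟩
        have : j % 3 = 0 ∨ j % 3 = 2 := by omega
        rcases this with h | h
        · exact (Nat.dvd_of_mod_eq_zero h).mul_right _
        · exact (Nat.dvd_of_mod_eq_zero (by omega)).mul_left _
      have h5 := Nat.mul_div_cancel' (Nat.even_mul_succ_self j).two_dvd
      omega
    obtain ⟨k, hk⟩ := h3
    rw [hk, mul_pow, pow_mul ω, hω3, one_pow]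
    ring
  · simp only [Function.comp_apply]
    have e : (3 * j + 1) * (3 * j + 1 + 1) / 2 = 9 * (j * (j + 1) / 2) + 1 := by
      have h5 := Nat.mul_div_cancel' (Nat.even_mul_succ_self j).two_dvd
      have h6 : (3 * j + 1) * (3 * j + 1 + 1) = 9 * (j * (j + 1)) + 2 := by ring
      omega
    rw [e, mul_pow, pow_succ ω, show 9 * (j * (j + 1) / 2) = 3 * (3 * (j * (j + 1) / 2)) by ring,
      pow_mul ω, hω3, one_pow, pow_succ q, ← mul_assoc 3 3, pow_mul q, pow_succ (-1 : ℂ), pow_mul,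
      show ((-1 : ℂ)) ^ 3 = -1 by norm_num]
    push_cast
    ring

/-- The product form of the cubic theta identity of Borwein and Borwein. -/
lemma euler_cubic {q : ℂ} (hq : ‖q‖ < 1) :
    (euler q ^ 3 + 3 * q * euler (q ^ 9) ^ 3) ^ 3 =
      (euler (q ^ 3) ^ 4 / euler (q ^ 9)) ^ 3 + 27 * q ^ 3 * (euler (q ^ 9) ^ 3) ^ 3 := by
  obtain ⟨ω, hω⟩ : ∃ ω : ℂ, ω ^ 2 + ω + 1 = 0 := by
    obtain ⟨s, hs⟩ := IsAlgClosed.exists_eq_mul_self (-3 : ℂ)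
    exact ⟨(s - 1) / 2, by linear_combination -hs / 4⟩
  have hω3 : ω ^ 3 = 1 := by linear_combination (ω - 1) * hω
  have hω' : (ω ^ 2) ^ 2 + ω ^ 2 + 1 = 0 := by linear_combination hω + ω * hω3
  have h1 := euler_cube_mul_root hq hω
  have h2 := euler_cube_mul_root hq hω'
  have h3 := euler_mul_euler_mul_euler hq hω
  have h9 := euler_ne_zero (norm_pow_lt_one hq (show 9 ≠ 0 by norm_num))
  rw [← eq_div_iff h9] at h3
  -- With A = x + 3qy the three conjugate cubes are A - 3ωⁱqy, whose product is A³ - 27q³y³.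
  rw [← h3]
  have h4 : euler (ω * q) ^ 3 =
    euler q ^ 3 + 3 * q * euler (q ^ 9) ^ 3 - 3 * (ω * q) * euler (q ^ 9) ^ 3 := by
    linear_combination h1
  have h5 : euler (ω ^ 2 * q) ^ 3 =
    euler q ^ 3 + 3 * q * euler (q ^ 9) ^ 3 - 3 * (ω ^ 2 * q) * euler (q ^ 9) ^ 3 := by
    linear_combination h2
  rw [mul_pow, mul_pow, h4, h5]
  generalize euler q ^ 3 = x
  generalize euler (q ^ 9) ^ 3 = y
  linear_combination x * (x + 3 * q * y) * (3 * q * y) * hω - x * (3 * q * y) ^ 2 * hω3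

/-! ### The eta function on the imaginary axis -/

lemma norm_ofReal_lt_one {r : ℝ} (h0 : 0 ≤ r) (h1 : r < 1) : ‖(r : ℂ)‖ < 1 := by
  rwa [Complex.norm_real, Real.norm_of_nonneg h0]

lemma exists_euler_eq_ofReal {r : ℝ} (h0 : 0 ≤ r) (h1 : r < 1) :
    ∃ x : ℝ, 0 < x ∧ euler r = x := by
  have hr := norm_ofReal_lt_one h0 h1
  have h := tendsto_qFactorial hr
  have hp (n : ℕ) : qFactorial (r : ℂ) n = (qFactorial r n : ℝ) := by
    simp [qFactorial]
  have him : (euler r).im = 0 :=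
    tendsto_nhds_unique ((Complex.continuous_im.tendsto _).comp h)
      (tendsto_const_nhds.congr fun n => by simp [hp])
  have hre : 0 ≤ (euler r).re := by
    refine ge_of_tendsto ((Complex.continuous_re.tendsto _).comp h) (Eventually.of_forall fun n => ?_)
    rw [Function.comp_apply, hp, Complex.ofReal_re]
    exact Finset.prod_nonneg fun k _ => sub_nonneg.2 (pow_le_one₀ h0 h1.le)
  have heq : euler r = ((euler r).re : ℂ) := Complex.ext rfl (by simpa using him)
  refine ⟨(euler r).re, lt_of_le_of_ne hre fun h => euler_ne_zero hr ?_, heq⟩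
  rw [heq, ← h, Complex.ofReal_zero]

/-- The value of the eta function at `i y`. -/
noncomputable def etaR (y : ℝ) : ℝ := (ModularForm.eta (Complex.I * y)).re

lemma exp_neg_lt_one {c y : ℝ} (hc : 0 < c) (hy : 0 < y) : Real.exp (-(c * y)) < 1 :=
  Real.exp_lt_one_iff.2 (neg_lt_zero.2 (mul_pos hc hy))

lemma eta_I_mul (y : ℝ) : ModularForm.eta (Complex.I * y) =
    (Real.exp (-(Real.pi / 12 * y)) : ℂ) * euler (Real.exp (-(2 * Real.pi * y))) := by
  have h (n : ℕ) : ModularForm.eta_q n (Complex.I * y) =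
      ((Real.exp (-(2 * Real.pi * y)) : ℝ) : ℂ) ^ (n + 1) := by
    rw [ModularForm.eta_q_eq_pow, Complex.ofReal_exp]
    congr 2
    push_cast
    linear_combination 2 * (Real.pi : ℂ) * y * Complex.I_mul_I
  rw [ModularForm.eta, euler, tprod_congr fun n => by rw [h n], Function.Periodic.qParam,
    Complex.ofReal_exp (-(Real.pi / 12 * y))]
  refine congrArg₂ (fun z w => Complex.exp z * w) ?_ rfl
  push_cast
  linear_combination (Real.pi : ℂ) / 12 * y * Complex.I_mul_I

lemma exists_eta_I_mul {y : ℝ} (hy : 0 < y) :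
    ∃ x : ℝ, 0 < x ∧ ModularForm.eta (Complex.I * y) = x := by
  obtain ⟨x, hx, h⟩ := exists_euler_eq_ofReal (Real.exp_pos _).le
    (exp_neg_lt_one Real.two_pi_pos hy)
  refine ⟨Real.exp (-(Real.pi / 12 * y)) * x, mul_pos (Real.exp_pos _) hx, ?_⟩
  rw [eta_I_mul, h]
  push_cast
  rfl

lemma eta_I_mul_eq_etaR {y : ℝ} (hy : 0 < y) : ModularForm.eta (Complex.I * y) = etaR y := by
  obtain ⟨x, -, h⟩ := exists_eta_I_mul hy
  rw [etaR, h, Complex.ofReal_re]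

lemma etaR_pos {y : ℝ} (hy : 0 < y) : 0 < etaR y := by
  obtain ⟨x, hx, h⟩ := exists_eta_I_mul hy
  rwa [etaR, h, Complex.ofReal_re]

lemma etaR_eq {y : ℝ} (hy : 0 < y) : (etaR y : ℂ) =
    (Real.exp (-(Real.pi / 12 * y)) : ℂ) * euler (Real.exp (-(2 * Real.pi * y))) := by
  rw [← eta_I_mul_eq_etaR hy, eta_I_mul]

lemma euler_exp {y : ℝ} (hy : 0 < y) : euler (Real.exp (-(2 * Real.pi * y))) =
    ((Real.exp (Real.pi / 12 * y) * etaR y : ℝ) : ℂ) := by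
  rw [Complex.ofReal_mul, etaR_eq hy, ← mul_assoc, ← Complex.ofReal_mul, ← Real.exp_add,
    add_neg_cancel, Real.exp_zero, Complex.ofReal_one, one_mul]

/-- The transformation τ ↦ -1/τ of eta. Squaring avoids the branch of the complex square root, and
positivity recovers the sign. -/
lemma etaR_one_div {y : ℝ} (hy : 0 < y) : etaR (1 / y) = √y * etaR y := by
  have hz : Complex.I * y ∈ UpperHalfPlane.upperHalfPlaneSet := by
    simpa [UpperHalfPlane.upperHalfPlaneSet] using hy
  have h := ModularForm.eta_comp_eq_csqrt_I_inv hz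
  have h1 : -1 / (Complex.I * y) = Complex.I * ((1 / y : ℝ) : ℂ) := by
    have : (y : ℂ) ≠ 0 := by exact_mod_cast hy.ne'
    push_cast
    field_simp
    rw [Complex.I_sq]
  simp only [Function.comp_apply, h1, Pi.smul_apply, Pi.mul_apply] at h
  rw [eta_I_mul_eq_etaR hy, eta_I_mul_eq_etaR (one_div_pos.2 hy)] at h
  have h2 (w : ℂ) : Complex.sqrt w ^ 2 = w := Complex.cpow_nat_inv_pow w two_ne_zero
  have h3 : etaR (1 / y) ^ 2 = y * etaR y ^ 2 := by
    have h4 := congrArg (· ^ 2) h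
    simp only [smul_eq_mul, mul_pow, inv_pow, h2] at h4
    rw [← mul_assoc, ← mul_assoc, inv_mul_cancel₀ Complex.I_ne_zero, one_mul] at h4
    exact_mod_cast h4
  rw [← Real.sqrt_sq (etaR_pos (one_div_pos.2 hy)).le, h3, Real.sqrt_mul hy.le,
    Real.sqrt_sq (etaR_pos hy).le]

/-! ### Theta constants on the imaginary axis -/

/-- The theta constant `θ₂` at `i y`. -/
noncomputable def theta2 (y : ℝ) : ℝ := 2 * etaR (2 * y) ^ 2 / etaR y

/-- The theta constant `θ₃` at `i y`. -/
noncomputable def theta3 (y : ℝ) : ℝ := etaR y ^ 5 / (etaR (y / 2) ^ 2 * etaR (2 * y) ^ 2)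

/-- The theta constant `θ₄` at `i y`. -/
noncomputable def theta4 (y : ℝ) : ℝ := etaR (y / 2) ^ 2 / etaR y

lemma theta2_pos {y : ℝ} (hy : 0 < y) : 0 < theta2 y := by
  have := etaR_pos hy
  have := etaR_pos (mul_pos two_pos hy)
  unfold theta2
  positivity

lemma theta3_pos {y : ℝ} (hy : 0 < y) : 0 < theta3 y := by
  have := etaR_pos hy
  have := etaR_pos (mul_pos two_pos hy)
  have := etaR_pos (half_pos hy)
  unfold theta3
  positivity

lemma theta4_pos {y : ℝ} (hy : 0 < y) : 0 < theta4 y := by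
  have := etaR_pos hy
  have := etaR_pos (half_pos hy)
  unfold theta4
  positivity

lemma euler_exp_pow {y c : ℝ} (hy : 0 < y) (n : ℕ) (h : n * c = 2 * Real.pi * y) :
    euler ((Real.exp (-c) : ℂ) ^ n) = ((Real.exp (Real.pi / 12 * y) * etaR y : ℝ) : ℂ) := by
  rw [← euler_exp hy, ← h, ← Complex.ofReal_pow, ← Real.exp_nat_mul, mul_neg]

lemma norm_exp_neg_lt_one {c : ℝ} (hc : 0 < c) : ‖(Real.exp (-c) : ℂ)‖ < 1 :=
  norm_ofReal_lt_one (Real.exp_pos _).le (Real.exp_lt_one_iff.2 (neg_lt_zero.2 hc))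

lemma theta4_eq_phi {y : ℝ} (hy : 0 < y) : (theta4 y : ℂ) = phi (Real.exp (-(Real.pi * y))) := by
  have h1 := euler_exp_pow (half_pos hy) 1 (c := Real.pi * y) (by ring)
  have h2 := euler_exp_pow hy 2 (c := Real.pi * y) (by push_cast; ring)
  rw [pow_one] at h1
  rw [phi, h1, h2, ← Complex.ofReal_pow, ← Complex.ofReal_div, theta4]
  congr 1
  have h3 : Real.exp (Real.pi / 12 * y) = Real.exp (Real.pi / 12 * (y / 2)) ^ 2 := by
    rw [← Real.exp_nat_mul]
    congr 1
    push_cast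
    ring
  have := Real.exp_pos (Real.pi / 12 * (y / 2))
  have := etaR_pos hy
  rw [h3]
  field_simp

/-- The Euler product at -q is eliminated by `euler_mul_euler_neg`, which leaves an eta quotient. -/
lemma theta3_eq_phi {y : ℝ} (hy : 0 < y) : (theta3 y : ℂ) = phi (-Real.exp (-(Real.pi * y))) := by
  have h1 := euler_exp_pow (half_pos hy) 1 (c := Real.pi * y) (by ring)
  have h2 := euler_exp_pow hy 2 (c := Real.pi * y) (by push_cast; ring)
  have h4 := euler_exp_pow (mul_pos two_pos hy) 4 (c := Real.pi * y) (by push_cast; ring)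
  have hq := norm_exp_neg_lt_one (mul_pos Real.pi_pos hy)
  have h := euler_mul_euler_neg hq
  rw [pow_one] at h1
  rw [h1, h2, h4] at h
  have e1 := etaR_pos (half_pos hy)
  have e2 := etaR_pos hy
  have e4 := etaR_pos (mul_pos two_pos hy)
  have hx := Real.exp_pos (Real.pi / 12 * (y / 2))
  have h3 : Real.exp (Real.pi / 12 * y) = Real.exp (Real.pi / 12 * (y / 2)) ^ 2 := by
    rw [← Real.exp_nat_mul]
    congr 1
    push_cast
    ring
  have h5 : Real.exp (Real.pi / 12 * (2 * y)) = Real.exp (Real.pi / 12 * (y / 2)) ^ 4 := by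
    rw [← Real.exp_nat_mul]
    congr 1
    push_cast
    ring
  have h6 : euler (-(Real.exp (-(Real.pi * y)) : ℂ)) =
      ((Real.exp (Real.pi / 12 * (y / 2)) * etaR y ^ 3 /
        (etaR (y / 2) * etaR (2 * y)) : ℝ) : ℂ) := by
    rw [h3, h5] at h
    rw [Complex.ofReal_div, eq_div_iff (by exact_mod_cast (mul_pos e1 e4).ne')]
    have hx' : ((Real.exp (Real.pi / 12 * (y / 2)) : ℝ) : ℂ) ≠ 0 := by exact_mod_cast hx.ne'
    refine mul_right_cancel₀ (pow_ne_zero 5 hx') ?_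
    push_cast at h ⊢
    linear_combination h
  rw [phi, h6, neg_sq, h2, ← Complex.ofReal_pow, ← Complex.ofReal_div, theta3, h3]
  congr 1
  field_simp

lemma theta3_add_theta4 {y : ℝ} (hy : 0 < y) : theta3 y + theta4 y = 2 * theta3 (4 * y) := by
  have h := phi_add_phi_neg (norm_exp_neg_lt_one (mul_pos Real.pi_pos hy))
  rw [← theta4_eq_phi hy, ← theta3_eq_phi hy, ← Complex.ofReal_pow, ← Real.exp_nat_mul,
    show ((4 : ℕ) : ℝ) * -(Real.pi * y) = -(Real.pi * (4 * y)) by push_cast; ring,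
    ← theta3_eq_phi (mul_pos four_pos hy)] at h
  have h' : theta4 y + theta3 y = 2 * theta3 (4 * y) := by exact_mod_cast h
  linarith

lemma theta3_sub_theta4 {y : ℝ} (hy : 0 < y) : theta3 y - theta4 y = 2 * theta2 (4 * y) := by
  have h := phi_neg_sub_phi (norm_exp_neg_lt_one (mul_pos Real.pi_pos hy))
  have h8 := euler_exp_pow (mul_pos four_pos hy) 8 (c := Real.pi * y) (by push_cast; ring)
  have h16 := euler_exp_pow (mul_pos two_pos (mul_pos four_pos hy)) 16 (c := Real.pi * y)
    (by push_cast; ring)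
  rw [← theta4_eq_phi hy, ← theta3_eq_phi hy, h8, h16] at h
  have h' : theta3 y - theta4 y = 4 * Real.exp (-(Real.pi * y)) *
    ((Real.exp (Real.pi / 12 * (2 * (4 * y))) * etaR (2 * (4 * y))) ^ 2 /
      (Real.exp (Real.pi / 12 * (4 * y)) * etaR (4 * y))) := by exact_mod_cast h
  rw [h', theta2]
  have h1 : Real.exp (Real.pi / 12 * (2 * (4 * y))) = Real.exp (Real.pi / 12 * (4 * y)) ^ 2 := by
    rw [← Real.exp_nat_mul]
    congr 1
    push_cast
    ring
  have h2 : Real.exp (-(Real.pi * y)) = (Real.exp (Real.pi / 12 * (4 * y)) ^ 3)⁻¹ := by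
    rw [← Real.exp_nat_mul, ← Real.exp_neg]
    congr 1
    push_cast
    ring
  have := Real.exp_pos (Real.pi / 12 * (4 * y))
  have := etaR_pos (mul_pos four_pos hy)
  rw [h1, h2]
  field_simp
  ring

lemma theta3_mul_theta4 {y : ℝ} (hy : 0 < y) : theta3 y * theta4 y = theta4 (2 * y) ^ 2 := by
  have := etaR_pos (half_pos hy)
  have := etaR_pos hy
  have := etaR_pos (mul_pos two_pos hy)
  rw [theta3, theta4, theta4, mul_div_cancel_left₀ y two_ne_zero]
  field_simp

lemma theta2_mul_theta3 {y : ℝ} (hy : 0 < y) :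
    2 * (theta2 (2 * y) * theta3 (2 * y)) = theta2 y ^ 2 := by
  have := etaR_pos hy
  have := etaR_pos (mul_pos two_pos hy)
  have := etaR_pos (mul_pos four_pos hy)
  rw [theta2, theta3, theta2, show 2 * (2 * y) = 4 * y by ring, mul_div_cancel_left₀ y two_ne_zero]
  field_simp

/-- The product of the relations for θ₃ ± θ₄, simplified by `theta2_mul_theta3` at 2y. -/
lemma theta3_sq_sub_theta4_sq {y : ℝ} (hy : 0 < y) :
    theta3 y ^ 2 - theta4 y ^ 2 = 2 * theta2 (2 * y) ^ 2 := by
  have h1 := theta3_add_theta4 hy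
  have h2 := theta3_sub_theta4 hy
  have h3 := theta2_mul_theta3 (mul_pos two_pos hy)
  rw [show 2 * (2 * y) = 4 * y by ring] at h3
  linear_combination (theta3 y - theta4 y) * h1 + 2 * theta3 (4 * y) * h2 + 2 * h3

lemma theta3_sq_add_theta4_sq {y : ℝ} (hy : 0 < y) :
    theta3 y ^ 2 + theta4 y ^ 2 = 2 * theta3 (2 * y) ^ 2 := by
  have h1 := theta3_add_theta4 hy
  have h2 := theta3_sub_theta4 hy
  have h4 := theta3_mul_theta4 hy
  have h5 := theta3_sq_sub_theta4_sq (mul_pos two_pos hy)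
  rw [show 2 * (2 * y) = 4 * y by ring] at h5
  have h6 := theta3_sq_sub_theta4_sq hy
  linear_combination (theta3 y - theta4 y + 2 * theta2 (4 * y)) * h2 + 2 * h4 - 2 * h5

/-- Jacobi's identity `θ₃⁴ = θ₂⁴ + θ₄⁴`. -/
lemma theta3_pow_four {y : ℝ} (hy : 0 < y) : theta3 y ^ 4 = theta2 y ^ 4 + theta4 y ^ 4 := by
  have h1 := theta3_sq_sub_theta4_sq hy
  have h2 := theta3_sq_add_theta4_sq hy
  have h3 := theta2_mul_theta3 hy
  linear_combination (theta3 y ^ 2 + theta4 y ^ 2) * h1 + 2 * theta2 (2 * y) ^ 2 * h2 +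
    (2 * (theta2 (2 * y) * theta3 (2 * y)) + theta2 y ^ 2) * h3

lemma theta4_one_div {y : ℝ} (hy : 0 < y) : theta4 (1 / y) = √y * theta2 y := by
  have := etaR_pos hy
  have h2 := etaR_one_div (mul_pos two_pos hy)
  have := Real.sqrt_pos.2 hy
  rw [theta4, theta2, show 1 / y / 2 = 1 / (2 * y) by field_simp, h2, etaR_one_div hy, mul_pow,
    Real.sq_sqrt (by positivity)]
  field_simp
  rw [Real.sq_sqrt hy.le, mul_comm]

lemma theta2_one_div {y : ℝ} (hy : 0 < y) : theta2 (1 / y) = √y * theta4 y := by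
  have h := theta4_one_div (one_div_pos.2 hy)
  rw [one_div_one_div, Real.sqrt_div zero_le_one, Real.sqrt_one] at h
  have := Real.sqrt_pos.2 hy
  rw [h]
  field_simp

/-- Inversion exchanges θ₂ and θ₄, so Jacobi's identity determines θ₃(1 / y)⁴, and θ₃ is positive.
-/
lemma theta3_one_div {y : ℝ} (hy : 0 < y) : theta3 (1 / y) = √y * theta3 y := by
  have h1 := theta3_pow_four (one_div_pos.2 hy)
  rw [theta4_one_div hy, theta2_one_div hy] at h1
  have h2 : theta3 (1 / y) ^ 4 = (√y * theta3 y) ^ 4 := by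
    rw [h1, mul_pow _ (theta3 y), theta3_pow_four hy]
    ring
  exact (pow_left_inj₀ (theta3_pos (one_div_pos.2 hy)).le
    (mul_nonneg (Real.sqrt_nonneg y) (theta3_pos hy).le) four_ne_zero).1 h2

/-- The value at y is the value at mⁿ y for every n, hence the limit at infinity. This identifies
F(X) with a theta function. -/
lemma eq_one_of_mul_invariant {f : ℝ → ℝ} {m : ℝ} (hm : 1 < m) (h : ∀ y, 0 < y → f y = f (m * y))
    (hlim : Tendsto f atTop (𝓝 1)) {y : ℝ} (hy : 0 < y) : f y = 1 := by
  have h1 (n : ℕ) : f y = f (m ^ n * y) := by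
    induction n with
    | zero => simp
    | succ n ih => rw [ih, h _ (by positivity), pow_succ]; congr 1; ring
  refine tendsto_nhds_unique (tendsto_const_nhds.congr h1) (l := (atTop : Filter ℕ)) (hlim.comp ?_)
  exact (tendsto_pow_atTop_atTop_of_one_lt hm).atTop_mul_const hy

lemma tendsto_exp_neg_mul {c : ℝ} (hc : 0 < c) :
    Tendsto (fun y : ℝ => (Real.exp (-(c * y)) : ℂ)) atTop (𝓝 0) := by
  have h : Tendsto (fun y : ℝ => Real.exp (-(c * y))) atTop (𝓝 0) :=
    Real.tendsto_exp_neg_atTop_nhds_zero.comp (tendsto_id.const_mul_atTop hc)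
  exact_mod_cast (Complex.continuous_ofReal.tendsto 0).comp h

lemma tendsto_euler_pow {f : ℝ → ℂ} (hf : Tendsto f atTop (𝓝 0)) (n : ℕ) :
    Tendsto (fun y => euler (f y ^ (n + 1))) atTop (𝓝 1) := by
  have h := hf.pow (n + 1)
  rw [zero_pow n.succ_ne_zero] at h
  have h2 := continuousAt_euler_zero.tendsto.comp h
  rwa [euler_zero] at h2

lemma tendsto_phi {f : ℝ → ℂ} (hf : Tendsto f atTop (𝓝 0)) :
    Tendsto (fun y => phi (f y)) atTop (𝓝 1) := by
  have h1 := tendsto_euler_pow hf 0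
  have h2 := tendsto_euler_pow hf 1
  simp only [zero_add, pow_one] at h1
  have h3 := (h1.pow 2).div h2 one_ne_zero
  rwa [one_pow, div_one] at h3

lemma tendsto_theta4 : Tendsto theta4 atTop (𝓝 1) := by
  have h := (Complex.continuous_re.tendsto _).comp (tendsto_phi (tendsto_exp_neg_mul Real.pi_pos))
  refine h.congr' ?_
  filter_upwards [eventually_gt_atTop 0] with y hy
  rw [Function.comp_apply, ← theta4_eq_phi hy, Complex.ofReal_re]

lemma tendsto_theta3 : Tendsto theta3 atTop (𝓝 1) := by
  have h1 := (tendsto_exp_neg_mul Real.pi_pos).neg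
  rw [neg_zero] at h1
  have h := (Complex.continuous_re.tendsto _).comp (tendsto_phi h1)
  refine h.congr' ?_
  filter_upwards [eventually_gt_atTop 0] with y hy
  rw [Function.comp_apply, ← theta3_eq_phi hy, Complex.ofReal_re]

/-! ### The elliptic modulus. -/

/-- The elliptic modulus `k = θ₂² / θ₃²` at `i y`. -/
noncomputable def modulus (y : ℝ) : ℝ := theta2 y ^ 2 / theta3 y ^ 2

/-- The complementary modulus `k' = θ₄² / θ₃²` at `i y`. -/
noncomputable def comodulus (y : ℝ) : ℝ := theta4 y ^ 2 / theta3 y ^ 2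

lemma modulus_pos {y : ℝ} (hy : 0 < y) : 0 < modulus y :=
  div_pos (pow_pos (theta2_pos hy) 2) (pow_pos (theta3_pos hy) 2)

lemma comodulus_pos {y : ℝ} (hy : 0 < y) : 0 < comodulus y :=
  div_pos (pow_pos (theta4_pos hy) 2) (pow_pos (theta3_pos hy) 2)

lemma modulus_sq_add {y : ℝ} (hy : 0 < y) : modulus y ^ 2 + comodulus y ^ 2 = 1 := by
  have h := theta3_pow_four hy
  have := theta3_pos hy
  rw [modulus, comodulus]
  field_simp
  linear_combination -h

lemma modulus_lt_one {y : ℝ} (hy : 0 < y) : modulus y < 1 := by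
  have := modulus_sq_add hy
  have := comodulus_pos hy
  nlinarith [modulus_pos hy]

lemma comodulus_lt_one {y : ℝ} (hy : 0 < y) : comodulus y < 1 := by
  have := modulus_sq_add hy
  have := modulus_pos hy
  nlinarith [comodulus_pos hy]

lemma modulus_one_div {y : ℝ} (hy : 0 < y) : modulus (1 / y) = comodulus y := by
  have := Real.sqrt_pos.2 hy
  have := theta3_pos hy
  rw [modulus, comodulus, theta2_one_div hy, theta3_one_div hy]
  field_simp

/-- The complete elliptic integral in terms of theta constants. -/
theorem hyp_modulus_sq {y : ℝ} (hy : 0 < y) : hyp (1 / 2) (modulus y ^ 2) = theta3 y ^ 2 := by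
  have h : hyp (1 / 2) (modulus y ^ 2) / theta3 y ^ 2 = 1 := by
    refine eq_one_of_mul_invariant (f := fun y => hyp (1 / 2) (modulus y ^ 2) / theta3 y ^ 2)
      one_lt_two (fun y hy => ?_) ?_ hy
    · have h1 := hyp_half_quadratic ⟨comodulus_pos hy, comodulus_lt_one hy⟩
      rw [← modulus_sq_add hy, add_sub_cancel_right] at h1
      have t3 := theta3_pos hy
      have t3' := theta3_pos (mul_pos two_pos hy)
      have h2 := theta3_sq_sub_theta4_sq hy
      have h3 := theta3_sq_add_theta4_sq hy
      have h4 : 1 + comodulus y = 2 * theta3 (2 * y) ^ 2 / theta3 y ^ 2 := by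
        rw [comodulus]; field_simp; exact h3
      have h5 : 1 - comodulus y = 2 * theta2 (2 * y) ^ 2 / theta3 y ^ 2 := by
        rw [comodulus]; field_simp; exact h2
      have h6 : (1 - comodulus y) / (1 + comodulus y) = modulus (2 * y) := by
        rw [h4, h5, modulus]; field_simp
      rw [modulus_sq_add hy, h6, h4] at h1
      rw [h1]
      field_simp
    · have h3 := tendsto_theta3
      have h4 := tendsto_theta4
      have h5 : Tendsto (fun y => modulus y ^ 2) atTop (𝓝 0) := by
        have h6 := ((h4.pow 2).div (h3.pow 2) (by norm_num)).pow 2 |>.const_sub 1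
        norm_num at h6
        refine h6.congr' ?_
        filter_upwards [eventually_gt_atTop 0] with y hy
        rw [← modulus_sq_add hy, comodulus]
        simp
      have h7 := ((tendsto_hyp_zero (a := 1 / 2) (by norm_num) (by norm_num)).comp h5).div
        (h3.pow 2) (by norm_num)
      rw [one_pow, div_one] at h7
      exact h7
  rwa [div_eq_one_iff_eq (pow_pos (theta3_pos hy) 2).ne'] at h

/-! ### Cubic theta functions -/

/-- The cubic theta function `b` of Borwein and Borwein at `i y`. -/
noncomputable def cubicB (y : ℝ) : ℝ := etaR y ^ 3 / etaR (3 * y)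

/-- The cubic theta function `c` of Borwein and Borwein at `i y`. -/
noncomputable def cubicC (y : ℝ) : ℝ := 3 * etaR (3 * y) ^ 3 / etaR y

/-- The cubic theta function `a` of Borwein and Borwein at `i y`. -/
noncomputable def cubicA (y : ℝ) : ℝ := (etaR (y / 3) ^ 3 + 3 * etaR (3 * y) ^ 3) / etaR y

lemma cubicA_pos {y : ℝ} (hy : 0 < y) : 0 < cubicA y := by
  have := etaR_pos hy
  have := etaR_pos (mul_pos three_pos hy)
  have := etaR_pos (div_pos hy three_pos)
  unfold cubicA
  positivity

lemma cubicB_pos {y : ℝ} (hy : 0 < y) : 0 < cubicB y := by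
  have := etaR_pos hy
  have := etaR_pos (mul_pos three_pos hy)
  unfold cubicB
  positivity

lemma cubicC_pos {y : ℝ} (hy : 0 < y) : 0 < cubicC y := by
  have := etaR_pos hy
  have := etaR_pos (mul_pos three_pos hy)
  unfold cubicC
  positivity

lemma exp_eq_exp_pow {a b : ℝ} (n : ℕ) (h : a = n * b) : Real.exp a = Real.exp b ^ n := by
  rw [← Real.exp_nat_mul, h]

/-- Here q is the cube root of the nome e^(-2πy), the variable in which `euler_cubic` becomes a³ =
b³ + c³. -/
lemma euler_cubicA {y : ℝ} (hy : 0 < y) : let q := (Real.exp (-(2 * Real.pi * (y / 3))) : ℂ)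
    (euler q ^ 3 + 3 * q * euler (q ^ 9) ^ 3) / euler (q ^ 3) = cubicA y := by
  intro q
  have h1 := euler_exp_pow (div_pos hy three_pos) 1 (c := 2 * Real.pi * (y / 3)) (by push_cast; ring)
  have h3 := euler_exp_pow hy 3 (c := 2 * Real.pi * (y / 3)) (by push_cast; ring)
  have h9 := euler_exp_pow (mul_pos three_pos hy) 9 (c := 2 * Real.pi * (y / 3))
    (by push_cast; ring)
  rw [pow_one] at h1
  rw [h1, h3, h9]
  have e1 := exp_eq_exp_pow (a := Real.pi / 12 * y) (b := Real.pi / 12 * (y / 3)) 3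
    (by push_cast; ring)
  have e2 := exp_eq_exp_pow (a := Real.pi / 12 * (3 * y)) (b := Real.pi / 12 * (y / 3)) 9
    (by push_cast; ring)
  have e3 : Real.exp (-(2 * Real.pi * (y / 3))) = (Real.exp (Real.pi / 12 * (y / 3)) ^ 24)⁻¹ := by
    rw [Real.exp_neg, exp_eq_exp_pow 24]
    push_cast
    ring
  have := Real.exp_pos (Real.pi / 12 * (y / 3))
  have := etaR_pos hy
  rw [e1, e2, cubicA]
  simp only [q, e3]
  norm_cast
  field_simp

lemma euler_cubicB {y : ℝ} (hy : 0 < y) : let q := (Real.exp (-(2 * Real.pi * (y / 3))) : ℂ)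
    euler (q ^ 3) ^ 3 / euler (q ^ 9) = cubicB y := by
  intro q
  have h3 := euler_exp_pow hy 3 (c := 2 * Real.pi * (y / 3)) (by push_cast; ring)
  have h9 := euler_exp_pow (mul_pos three_pos hy) 9 (c := 2 * Real.pi * (y / 3))
    (by push_cast; ring)
  rw [h3, h9]
  have e1 := exp_eq_exp_pow (a := Real.pi / 12 * (3 * y)) (b := Real.pi / 12 * y) 3
    (by push_cast; ring)
  have := Real.exp_pos (Real.pi / 12 * y)
  have := etaR_pos (mul_pos three_pos hy)
  rw [e1, cubicB]
  norm_cast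
  field_simp

lemma euler_cubicC {y : ℝ} (hy : 0 < y) : let q := (Real.exp (-(2 * Real.pi * (y / 3))) : ℂ)
    3 * q * euler (q ^ 9) ^ 3 / euler (q ^ 3) = cubicC y := by
  intro q
  have h3 := euler_exp_pow hy 3 (c := 2 * Real.pi * (y / 3)) (by push_cast; ring)
  have h9 := euler_exp_pow (mul_pos three_pos hy) 9 (c := 2 * Real.pi * (y / 3))
    (by push_cast; ring)
  rw [h3, h9]
  have e1 := exp_eq_exp_pow (a := Real.pi / 12 * (3 * y)) (b := Real.pi / 12 * y) 3
    (by push_cast; ring)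
  have e3 : Real.exp (-(2 * Real.pi * (y / 3))) = (Real.exp (Real.pi / 12 * y) ^ 8)⁻¹ := by
    rw [Real.exp_neg, exp_eq_exp_pow 8]
    push_cast
    ring
  have := Real.exp_pos (Real.pi / 12 * y)
  have := etaR_pos hy
  rw [e1, cubicC]
  simp only [q, e3]
  norm_cast
  field_simp

/-- The cubic identity of Borwein and Borwein. -/
lemma cubicA_pow_three {y : ℝ} (hy : 0 < y) : cubicA y ^ 3 = cubicB y ^ 3 + cubicC y ^ 3 := by
  have hq : ‖(Real.exp (-(2 * Real.pi * (y / 3))) : ℂ)‖ < 1 :=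
    norm_exp_neg_lt_one (mul_pos Real.two_pi_pos (div_pos hy three_pos))
  have h := euler_cubic hq
  have h3 := euler_ne_zero (norm_pow_lt_one hq three_ne_zero)
  have h9 := euler_ne_zero (norm_pow_lt_one hq (show 9 ≠ 0 by norm_num))
  have hA := euler_cubicA hy
  have hB := euler_cubicB hy
  have hC := euler_cubicC hy
  simp only at hA hB hC
  have h' : (cubicA y : ℂ) ^ 3 = cubicB y ^ 3 + cubicC y ^ 3 := by
    rw [← hA, ← hB, ← hC, div_pow, h]
    field_simp
    ring
  exact_mod_cast h'

lemma cubicB_one_div {y : ℝ} (hy : 0 < y) : cubicB (1 / (3 * y)) = √3 * y * cubicC y := by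
  have h1 := etaR_one_div (mul_pos three_pos hy)
  have h2 := etaR_one_div hy
  have := etaR_pos hy
  have hs := Real.sqrt_pos.2 hy
  rw [cubicB, cubicC, h1, show 3 * (1 / (3 * y)) = 1 / y by field_simp, h2,
    Real.sqrt_mul (by norm_num)]
  have h3 := Real.sq_sqrt (show (0 : ℝ) ≤ 3 by norm_num)
  have h4 := Real.sq_sqrt hy.le
  field_simp
  rw [h3, h4]

lemma cubicC_one_div {y : ℝ} (hy : 0 < y) : cubicC (1 / (3 * y)) = √3 * y * cubicB y := by
  have h1 := etaR_one_div (mul_pos three_pos hy)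
  have h2 := etaR_one_div hy
  have := etaR_pos (mul_pos three_pos hy)
  have hs := Real.sqrt_pos.2 hy
  rw [cubicB, cubicC, h1, show 3 * (1 / (3 * y)) = 1 / y by field_simp, h2,
    Real.sqrt_mul (by norm_num)]
  have h3 := Real.sq_sqrt (show (0 : ℝ) ≤ 3 by norm_num)
  have h4 := Real.sq_sqrt hy.le
  field_simp
  rw [h3, h4]
  ring

/-- Inversion exchanges b and c, so the cubic identity determines the cube of a, and a is positive.
-/
lemma cubicA_one_div {y : ℝ} (hy : 0 < y) : cubicA (1 / (3 * y)) = √3 * y * cubicA y := by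
  have hy' : 0 < 1 / (3 * y) := by positivity
  have h : cubicA (1 / (3 * y)) ^ 3 = (√3 * y * cubicA y) ^ 3 := by
    rw [cubicA_pow_three hy', cubicB_one_div hy, cubicC_one_div hy, mul_pow _ (cubicA y),
      cubicA_pow_three hy]
    ring
  exact (pow_left_inj₀ (cubicA_pos hy').le
    (mul_nonneg (by positivity) (cubicA_pos hy).le) three_ne_zero).1 h

/-- A second eta expression for a, obtained by inverting the definition: y/3 turns into 9y.
Comparing the two expressions gives the relations between y and 3y below. -/
lemma cubicA_eq {y : ℝ} (hy : 0 < y) :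
    cubicA y = (etaR y ^ 3 + 9 * etaR (9 * y) ^ 3) / etaR (3 * y) := by
  have h := cubicA_one_div hy
  have h1 := etaR_one_div (mul_pos three_pos hy)
  have h2 := etaR_one_div hy
  have h9 := etaR_one_div (show 0 < 9 * y by positivity)
  have := etaR_pos (mul_pos three_pos hy)
  have hs := Real.sqrt_pos.2 hy
  have h3 := Real.sq_sqrt (show (0 : ℝ) ≤ 3 by norm_num)
  have h4 := Real.sq_sqrt hy.le
  have hs9 : √(9 * y) = 3 * √y := by
    rw [Real.sqrt_mul (by norm_num), show (9 : ℝ) = 3 ^ 2 by norm_num,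
      Real.sqrt_sq (by norm_num)]
  rw [cubicA, h1, show 3 * (1 / (3 * y)) = 1 / y by field_simp,
    show 1 / (3 * y) / 3 = 1 / (9 * y) by field_simp; norm_num, h2, h9, hs9,
    Real.sqrt_mul (by norm_num)] at h
  refine mul_left_cancel₀ (show √3 * y ≠ 0 by positivity) (h.symm.trans ?_)
  field_simp
  rw [h3, h4]
  ring

lemma cubicA_three_mul_add {y : ℝ} (hy : 0 < y) :
    cubicA y = cubicA (3 * y) + 2 * cubicC (3 * y) := by
  have := etaR_pos (mul_pos three_pos hy)
  rw [cubicA_eq hy, cubicA, cubicC, mul_div_cancel_left₀ y three_ne_zero,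
    show 3 * (3 * y) = 9 * y by ring]
  field_simp
  ring

lemma cubicB_eq_sub {y : ℝ} (hy : 0 < y) : cubicB y = cubicA (3 * y) - cubicC (3 * y) := by
  have := etaR_pos (mul_pos three_pos hy)
  rw [cubicB, cubicA, cubicC, mul_div_cancel_left₀ y three_ne_zero]
  field_simp
  ring

lemma tendsto_cubicA : Tendsto cubicA atTop (𝓝 1) := by
  have hq := tendsto_exp_neg_mul (show 0 < 2 * Real.pi / 3 by positivity)
  have h1 := tendsto_euler_pow hq 0
  simp only [zero_add, pow_one] at h1
  have h3 := tendsto_euler_pow hq 2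
  have h9 := tendsto_euler_pow hq 8
  have h := ((h1.pow 3).add ((hq.const_mul 3).mul (h9.pow 3))).div h3 one_ne_zero
  have h' := (Complex.continuous_re.tendsto _).comp h
  norm_num at h'
  refine h'.congr' ?_
  filter_upwards [eventually_gt_atTop 0] with y hy
  have := euler_cubicA hy
  simp only at this
  rw [← Complex.ofReal_re (cubicA y), ← this, Function.comp_apply,
    show 2 * Real.pi * (y / 3) = 2 * Real.pi / 3 * y by ring]
  simp

lemma tendsto_cubicB : Tendsto cubicB atTop (𝓝 1) := by
  have hq := tendsto_exp_neg_mul (show 0 < 2 * Real.pi / 3 by positivity)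
  have h3 := tendsto_euler_pow hq 2
  have h9 := tendsto_euler_pow hq 8
  have h := (h3.pow 3).div h9 one_ne_zero
  have h' := (Complex.continuous_re.tendsto _).comp h
  norm_num at h'
  refine h'.congr' ?_
  filter_upwards [eventually_gt_atTop 0] with y hy
  have := euler_cubicB hy
  simp only at this
  rw [← Complex.ofReal_re (cubicB y), ← this, Function.comp_apply,
    show 2 * Real.pi * (y / 3) = 2 * Real.pi / 3 * y by ring]
  simp

/-- The cubic modulus `c³ / a³` at `i y`. -/
noncomputable def cubicModulus (y : ℝ) : ℝ := cubicC y ^ 3 / cubicA y ^ 3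

lemma one_sub_cubicModulus {y : ℝ} (hy : 0 < y) :
    1 - cubicModulus y = (cubicB y / cubicA y) ^ 3 := by
  have := cubicA_pos hy
  rw [cubicModulus]
  field_simp
  linear_combination cubicA_pow_three hy

lemma cubicModulus_mem {y : ℝ} (hy : 0 < y) : cubicModulus y ∈ Ioo (0 : ℝ) 1 := by
  have h := one_sub_cubicModulus hy
  have := pow_pos (div_pos (cubicB_pos hy) (cubicA_pos hy)) 3
  exact ⟨div_pos (pow_pos (cubicC_pos hy) 3) (pow_pos (cubicA_pos hy) 3), by linarith⟩

lemma cubicModulus_one_div {y : ℝ} (hy : 0 < y) :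
    cubicModulus (1 / (3 * y)) = 1 - cubicModulus y := by
  rw [one_sub_cubicModulus hy, cubicModulus, cubicC_one_div hy, cubicA_one_div hy]
  have := cubicA_pos hy
  field_simp

/-- The cubic theta function `a` as a hypergeometric function of the cubic modulus. -/
theorem hyp_cubicModulus {y : ℝ} (hy : 0 < y) : hyp (1 / 3) (cubicModulus y) = cubicA y := by
  have h : hyp (1 / 3) (cubicModulus y) / cubicA y = 1 := by
    refine eq_one_of_mul_invariant (f := fun y => hyp (1 / 3) (cubicModulus y) / cubicA y)
      (show (1 : ℝ) < 3 by norm_num) (fun y hy => ?_) ?_ hy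
    · have hA := cubicA_pos hy
      have hB := cubicB_pos hy
      have hA' := cubicA_pos (mul_pos three_pos hy)
      have hx := one_sub_cubicModulus hy
      have hm := cubicModulus_mem hy
      have h2 := cubicA_three_mul_add hy
      have h3 := cubicB_eq_sub hy
      -- At x = b / a the cubic transformation becomes y ↦ 3y.
      have h1 := hyp_third_cubic (x := cubicB y / cubicA y) ⟨div_pos hB hA,
        lt_of_pow_lt_pow_left₀ 3 zero_le_one (by rw [← hx, one_pow]; linarith [hm.1])⟩
      have h4 : 1 + 2 * (cubicB y / cubicA y) = 3 * cubicA (3 * y) / cubicA y := by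
        field_simp; linear_combination h2 + 2 * h3
      have h5 : 1 - cubicB y / cubicA y = 3 * cubicC (3 * y) / cubicA y := by
        field_simp; linear_combination h2 - h3
      have h6 : ((1 - cubicB y / cubicA y) / (1 + 2 * (cubicB y / cubicA y))) ^ 3 =
          cubicModulus (3 * y) := by
        rw [h4, h5, cubicModulus]; field_simp
      rw [← hx, sub_sub_cancel, h6, h4] at h1
      rw [h1]
      field_simp
    · have hA := tendsto_cubicA
      have h5 : Tendsto cubicModulus atTop (𝓝 0) := by
        have h6 := (tendsto_cubicB.div hA one_ne_zero).pow 3 |>.const_sub 1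
        norm_num at h6
        refine h6.congr' ?_
        filter_upwards [eventually_gt_atTop 0] with y hy
        rw [← one_sub_cubicModulus hy]
        ring
      have h7 := ((tendsto_hyp_zero (a := 1 / 3) (by norm_num) (by norm_num)).comp h5).div
        hA one_ne_zero
      rw [div_one] at h7
      exact h7
  rwa [div_eq_one_iff_eq (cubicA_pos hy).ne'] at h

/-! ### Changes of variables -/

lemma integral_eq_of_image {f f' : ℝ → ℝ} {s t : Set ℝ} (hs : MeasurableSet s)
    (hf : ∀ x ∈ s, HasDerivAt f (f' x) x) (hi : InjOn f s) (ht : f '' s = t) {g Φ : ℝ → ℝ}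
    (h : ∀ x ∈ s, |f' x| * g (f x) = Φ x) (hΦ : IntegrableOn Φ s) :
    IntegrableOn g t ∧ ∫ x in t, g x = ∫ x in s, Φ x := by
  have hf' : ∀ x ∈ s, HasDerivWithinAt f (f' x) s x := fun x hx => (hf x hx).hasDerivWithinAt
  rw [← ht]
  refine ⟨(integrableOn_image_iff_integrableOn_abs_deriv_smul hs hf' hi g).2
    (hΦ.congr_fun (fun x hx => (h x hx).symm) hs), ?_⟩
  rw [integral_image_eq_integral_abs_deriv_smul hs hf' hi]
  exact setIntegral_congr_fun hs h

/-- Integration over the imaginary axis in terms of a modulus `X`. -/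
theorem integral_comp_modulus {a κ : ℝ} (ha : 0 < a) (ha1 : a < 1) (hκ : 0 < κ) {X : ℝ → ℝ}
    (hX : ∀ y, 0 < y → X y ∈ Ioo (0 : ℝ) 1)
    (hXy : ∀ y, 0 < y → κ * hyp a (1 - X y) / hyp a (X y) = y) {G Φ : ℝ → ℝ}
    (hG : ∀ y, 0 < y → G y = hyp a (X y) ^ 2 * (X y * (1 - X y)) * Φ (X y))
    (hΦ : IntegrableOn Φ (Ioo 0 1)) :
    IntegrableOn G (Ioi 0) ∧
      ∫ y in Ioi 0, G y = κ * (Real.sin (Real.pi * a) / Real.pi) * ∫ x in Ioo 0 1, Φ x := by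
  have hsin : 0 < Real.sin (Real.pi * a) / Real.pi := div_pos (Real.sin_pos_of_pos_of_lt_pi
    (mul_pos Real.pi_pos ha) (by nlinarith [Real.pi_pos])) Real.pi_pos
  have mem {x : ℝ} (hx : x ∈ Ioo (0 : ℝ) 1) : 1 - x ∈ Ioo (0 : ℝ) 1 :=
    ⟨by linarith [hx.2], by linarith [hx.1]⟩
  have pos {x : ℝ} (hx : x ∈ Ioo (0 : ℝ) 1) : 0 < hyp a x := hyp_pos ha ha1 hx.1.le hx.2
  set s := Real.sin (Real.pi * a) / Real.pi
  -- The numerator of the derivative of F(1 - x) / F(x) is the Wronskian, which is constant.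
  have hd (x : ℝ) (hx : x ∈ Ioo (0 : ℝ) 1) : HasDerivAt (fun x => κ * hyp a (1 - x) / hyp a x)
      (-(κ * s / (x * (1 - x) * hyp a x ^ 2))) x := by
    have hs : HasDerivAt (fun x : ℝ => 1 - x) (-1) x := by
      simpa using (hasDerivAt_id x).const_sub 1
    refine ((((hasDerivAt_hyp ha ha1 (mem hx)).comp x hs).const_mul κ).div
      (hasDerivAt_hyp ha ha1 hx) (pos hx).ne').congr_deriv ?_
    have h1 := hyp_wronskian ha ha1 hx
    have := hx.1.ne'
    have := (mem hx).1.ne'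
    have := pos hx
    change _ = s at h1
    rw [← h1, sub_sub_cancel]
    simp only [Function.comp_apply]
    field_simp
    ring
  have hanti : StrictAntiOn (fun x => κ * hyp a (1 - x) / hyp a x) (Ioo 0 1) := by
    refine strictAntiOn_of_deriv_neg (convex_Ioo 0 1)
      (fun x hx => (hd x hx).continuousAt.continuousWithinAt) fun x hx => ?_
    rw [interior_Ioo] at hx
    rw [(hd x hx).deriv]
    have := hx.1
    have := (mem hx).1
    have := pos hx
    exact neg_lt_zero.2 (by positivity)
  have himage : (fun x => κ * hyp a (1 - x) / hyp a x) '' Ioo 0 1 = Ioi 0 := by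
    ext y
    constructor
    · rintro ⟨x, hx, rfl⟩
      exact div_pos (mul_pos hκ (pos (mem hx))) (pos hx)
    · exact fun hy => ⟨X y, hX y hy, hXy y hy⟩
  have h := integral_eq_of_image measurableSet_Ioo hd hanti.injOn himage (g := G)
    (Φ := fun x => κ * s * Φ x) (fun x hx => ?_) (hΦ.const_mul (κ * s))
  · exact ⟨h.1, by rw [h.2, integral_const_mul]⟩
  · have hy : 0 < κ * hyp a (1 - x) / hyp a x := div_pos (mul_pos hκ (pos (mem hx))) (pos hx)
    -- By injectivity X is the inverse of the substitution, so no derivative of X is needed.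
    have hXx : X (κ * hyp a (1 - x) / hyp a x) = x :=
      hanti.injOn (hX _ hy) hx (hXy _ hy)
    rw [hG _ hy, hXx]
    have := hx.1
    have := (mem hx).1
    have := pos hx
    rw [abs_neg, abs_of_pos (by positivity)]
    field_simp

lemma integral_comp_sq {Φ Ψ : ℝ → ℝ} (h : ∀ k ∈ Ioo (0 : ℝ) 1, 2 * k * Φ (k ^ 2) = Ψ k)
    (hΨ : IntegrableOn Ψ (Ioo 0 1)) :
    IntegrableOn Φ (Ioo 0 1) ∧ ∫ x in Ioo 0 1, Φ x = ∫ k in Ioo 0 1, Ψ k := by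
  refine integral_eq_of_image (f := fun k => k ^ 2) (f' := fun k => 2 * k) measurableSet_Ioo
    (fun k _ => (hasDerivAt_pow 2 k).congr_deriv (by norm_num)) (fun x hx y hy hxy => ?_) ?_
    (fun k hk => ?_) hΨ
  · exact (pow_left_inj₀ hx.1.le hy.1.le two_ne_zero).1 hxy
  · ext x
    constructor
    · rintro ⟨k, hk, rfl⟩
      exact ⟨pow_pos hk.1 2, pow_lt_one₀ hk.1.le hk.2 two_ne_zero⟩
    · intro hx
      refine ⟨√x, ⟨Real.sqrt_pos.2 hx.1, ?_⟩, Real.sq_sqrt hx.1.le⟩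
      rw [Real.sqrt_lt' one_pos, one_pow]
      exact hx.2
  · rw [abs_of_pos (mul_pos two_pos hk.1)]
    exact h k hk

/-- The substitution y ↦ 1 / (N y) turns g(y) y dy into g(y) dy / √N when g has weight three.
Convergence of the second integral is thus inherited from the first. -/
lemma integral_mul_id_of_inversion {g : ℝ → ℝ} {N : ℝ} (hN : 0 < N) (hg : IntegrableOn g (Ioi 0))
    (h : ∀ y, 0 < y → g (1 / (N * y)) = N * √N * y ^ 3 * g y) :
    IntegrableOn (fun y => g y * y) (Ioi 0) ∧
      ∫ y in Ioi 0, g y * y = 1 / √N * ∫ y in Ioi 0, g y := by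
  have hs := Real.sqrt_pos.2 hN
  have h1 := integral_eq_of_image (f := fun y => 1 / (N * y)) (f' := fun y => -(1 / (N * y ^ 2)))
    (g := fun y => g y * y) (Φ := fun y => 1 / √N * g y) (s := Ioi 0) (t := Ioi 0)
    measurableSet_Ioi (fun y hy => ?_) (fun x hx y hy hxy => ?_) ?_ (fun y hy => ?_)
    (hg.const_mul _)
  · exact ⟨h1.1, by rw [h1.2, integral_const_mul]⟩
  · have hy0 : y ≠ 0 := ne_of_gt hy
    refine (((hasDerivAt_id y).const_mul N).inv (mul_ne_zero hN.ne' hy0) |>.congr_deriv ?_).congr_of_eventuallyEq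
      (Eventually.of_forall fun x => by simp)
    simp only [id]
    field_simp
  · have hx0 : x ≠ 0 := ne_of_gt hx
    have hy0 : y ≠ 0 := ne_of_gt hy
    simp only at hxy
    field_simp at hxy
    exact hxy.symm
  · ext y
    constructor
    · rintro ⟨x, hx, rfl⟩
      exact one_div_pos.2 (mul_pos hN hx)
    · intro hy
      have hy0 : y ≠ 0 := ne_of_gt hy
      refine ⟨1 / (N * y), one_div_pos.2 (mul_pos hN hy), ?_⟩
      simp only
      field_simp
  · have hy0 : 0 < y := hy
    rw [h y hy, abs_neg, abs_of_pos (by positivity)]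
    field_simp
    rw [Real.sq_sqrt hN.le]

lemma integral_comp_mul {g : ℝ → ℝ} (hg : IntegrableOn g (Ioi 0)) {c : ℝ} (hc : 0 < c) :
    IntegrableOn (fun y => g (c * y)) (Ioi 0) ∧
      ∫ y in Ioi 0, g (c * y) = 1 / c * ∫ y in Ioi 0, g y := by
  refine ⟨(integrableOn_Ioi_comp_mul_left_iff g 0 hc).2 (by rwa [mul_zero]), ?_⟩
  rw [integral_comp_mul_left_Ioi g 0 hc, mul_zero, smul_eq_mul, one_div]

/-! ### Integrals of eta products -/

lemma betaIntegrand_half_half {u v : ℝ} (hu : 0 ≤ u) (hv : 0 ≤ v) (h : u ^ 2 + v ^ 2 = 1) :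
    betaIntegrand (1 / 2) (1 / 2) (u ^ 2) = 1 / (u * v) := by
  have e (t : ℝ) (ht : 0 ≤ t) : (t ^ 2) ^ ((1 / 2 : ℝ) - 1) = t⁻¹ := by
    rw [← Real.rpow_natCast, ← Real.rpow_mul ht]
    norm_num
    exact Real.rpow_neg_one t
  rw [betaIntegrand, show 1 - u ^ 2 = v ^ 2 by linarith, e u hu, e v hv]
  field_simp

lemma etaR_pow_six {y : ℝ} (hy : 0 < y) :
    etaR y ^ 6 = 1 / 4 * (theta2 y * theta3 y * theta4 y) ^ 2 := by
  have := etaR_pos hy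
  have := etaR_pos (mul_pos two_pos hy)
  have := etaR_pos (half_pos hy)
  rw [theta2, theta3, theta4]
  field_simp
  norm_num

lemma modulus_sq_mem {y : ℝ} (hy : 0 < y) : modulus y ^ 2 ∈ Ioo (0 : ℝ) 1 :=
  ⟨pow_pos (modulus_pos hy) 2, pow_lt_one₀ (modulus_pos hy).le (modulus_lt_one hy) two_ne_zero⟩

/-- The classical y = K' / K: inversion exchanges the moduli and multiplies θ₃² by y. The factor 1
is the κ of `integral_comp_modulus`. -/
lemma one_mul_hyp_div_hyp {y : ℝ} (hy : 0 < y) :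
    1 * hyp (1 / 2) (1 - modulus y ^ 2) / hyp (1 / 2) (modulus y ^ 2) = y := by
  have h := hyp_modulus_sq (one_div_pos.2 hy)
  rw [modulus_one_div hy, eq_sub_iff_add_eq'.2 (modulus_sq_add hy)] at h
  have := theta3_pos hy
  rw [h, hyp_modulus_sq hy, theta3_one_div hy, mul_pow, Real.sq_sqrt hy.le]
  field_simp

/-- Since θ₂θ₃θ₄ = 2η³, the integrand is θ₃⁶ k k' / 4, that is F³ √(X (1 - X)) / 4 with X = k². -/
theorem integral_etaR_pow_six {S : ℝ} (hS : HasSum (clausenCoeff (1 / 2) (1 - 1 / 2)) S) :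
    IntegrableOn (fun y => etaR y ^ 6) (Ioi 0) ∧ ∫ y in Ioi 0, etaR y ^ 6 = S / 4 := by
  obtain ⟨h1, h2⟩ := integral_hyp_mul_betaIntegrand (a := 1 / 2) (by norm_num) (by norm_num) hS
  have h := integral_comp_modulus (a := 1 / 2) (κ := 1) (by norm_num) (by norm_num) one_pos
    (X := fun y => modulus y ^ 2) (fun y => modulus_sq_mem) (fun y => one_mul_hyp_div_hyp)
    (G := fun y => etaR y ^ 6) (fun y hy => ?_) (h1.const_mul (1 / 4))
  · refine ⟨h.1, ?_⟩
    rw [h.2, integral_const_mul, h2, mul_one_div, Real.sin_pi_div_two]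
    have := Real.pi_ne_zero
    field_simp
  · have hk := modulus_pos hy
    have hk' := comodulus_pos hy
    rw [betaIntegrand_half_half hk.le hk'.le (modulus_sq_add hy),
      ← eq_sub_iff_add_eq'.2 (modulus_sq_add hy), hyp_modulus_sq hy, etaR_pow_six hy]
    have := theta3_pos hy
    rw [modulus, comodulus] at *
    field_simp

/-- The integrand is (bc)^(3/2) / (3√3) = a³ √(X (1 - X)) / (3√3). The constant κ = 1/√3 reflects
the involution y ↦ 1 / (3y). -/
theorem integral_etaR_cube_mul {S : ℝ} (hS : HasSum (clausenCoeff (1 / 3) (1 - 1 / 3)) S) :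
    IntegrableOn (fun y => etaR y ^ 3 * etaR (3 * y) ^ 3) (Ioi 0) ∧
      ∫ y in Ioi 0, etaR y ^ 3 * etaR (3 * y) ^ 3 = √3 / 18 * S := by
  obtain ⟨h1, h2⟩ := integral_hyp_mul_betaIntegrand (a := 1 / 3) (by norm_num) (by norm_num) hS
  have h := integral_comp_modulus (a := 1 / 3) (κ := 1 / √3) (by norm_num) (by norm_num)
    (by positivity) (X := cubicModulus) (fun y => cubicModulus_mem) (fun y hy => ?_)
    (G := fun y => etaR y ^ 3 * etaR (3 * y) ^ 3) (fun y hy => ?_) (h1.const_mul (1 / (3 * √3)))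
  · refine ⟨h.1, ?_⟩
    rw [h.2, integral_const_mul, h2, mul_one_div, Real.sin_pi_div_three]
    have := Real.pi_ne_zero
    field_simp
    linear_combination (-6 * S) * Real.sq_sqrt (show (0 : ℝ) ≤ 3 by norm_num)
  · have := cubicA_pos hy
    rw [← cubicModulus_one_div hy, hyp_cubicModulus hy, hyp_cubicModulus (by positivity),
      cubicA_one_div hy]
    field_simp
  · have hA := cubicA_pos hy
    have e1 := etaR_pos hy
    have e3 := etaR_pos (mul_pos three_pos hy)
    have hm := one_sub_cubicModulus hy
    have hu : √(cubicModulus y) ^ 2 = cubicModulus y := Real.sq_sqrt (cubicModulus_mem hy).1.le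
    have hv : √(1 - cubicModulus y) ^ 2 = 1 - cubicModulus y :=
      Real.sq_sqrt (sub_nonneg.2 (cubicModulus_mem hy).2.le)
    have hb := betaIntegrand_half_half (Real.sqrt_nonneg _) (Real.sqrt_nonneg _)
      (show √(cubicModulus y) ^ 2 + √(1 - cubicModulus y) ^ 2 = 1 by rw [hu, hv]; ring)
    rw [hu] at hb
    have hp : √(cubicModulus y) * √(1 - cubicModulus y) =
        3 * √3 * (etaR y ^ 3 * etaR (3 * y) ^ 3) / cubicA y ^ 3 := by
      rw [← Real.sqrt_mul (cubicModulus_mem hy).1.le, hm, cubicModulus, Real.sqrt_eq_iff_mul_self_eq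
        (by have := cubicB_pos hy; have := cubicC_pos hy; positivity) (by positivity), cubicB,
        cubicC]
      have h3 := Real.sq_sqrt (show (0 : ℝ) ≤ 3 by norm_num)
      field_simp
      rw [h3]
    have hq : cubicModulus y * (1 - cubicModulus y) =
        (3 * √3 * (etaR y ^ 3 * etaR (3 * y) ^ 3) / cubicA y ^ 3) ^ 2 := by
      rw [← hp, mul_pow, hu, hv]
    rw [hb, hp, hq, hyp_cubicModulus hy]
    field_simp

/-! ### The form of level eight -/

/-- The value of `f83da` at `i y`. -/
noncomputable def etaR8 (y : ℝ) : ℝ := etaR y ^ 2 * etaR (2 * y) * etaR (4 * y) * etaR (8 * y) ^ 2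

lemma etaR8_pos {y : ℝ} (hy : 0 < y) : 0 < etaR8 y := by
  have := etaR_pos hy
  have := etaR_pos (mul_pos two_pos hy)
  have := etaR_pos (mul_pos four_pos hy)
  have := etaR_pos (show 0 < 8 * y by positivity)
  unfold etaR8
  positivity

/-- The integrand `θ₃⁶ k k' √(1 + k) / 4`. -/
noncomputable def ellipticIntegrand (y : ℝ) : ℝ :=
  1 / 4 * (theta3 y ^ 6 * modulus y * comodulus y * √(1 + modulus y))

/-- The two terms have a common eta factor times θ₄(2y) and 2θ₂(8y), which add up to θ₃(2y). That
theta value is θ₃(4y) √(1 + k(4y)), the source of the extra square root. -/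
lemma etaR8_add {y : ℝ} (hy : 0 < y) :
    etaR8 y + 4 * etaR8 (2 * y) = ellipticIntegrand (4 * y) := by
  have e1 := etaR_pos hy
  have e2 := etaR_pos (mul_pos two_pos hy)
  have e4 := etaR_pos (mul_pos four_pos hy)
  have e8 := etaR_pos (show 0 < 8 * y by positivity)
  have h4 := mul_pos four_pos hy
  have t3 := theta3_pos h4
  have h1 := theta3_sq_sub_theta4_sq (mul_pos two_pos hy)
  have h2 := theta3_sq_add_theta4_sq (mul_pos two_pos hy)
  rw [show 2 * (2 * y) = 4 * y by ring] at h1 h2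
  have hk : √(1 + modulus (4 * y)) = theta3 (2 * y) / theta3 (4 * y) := by
    rw [Real.sqrt_eq_iff_mul_self_eq (by have := modulus_pos h4; positivity)
      (by have := theta3_pos (mul_pos two_pos hy); positivity), modulus]
    generalize theta3 (2 * y) = P at *
    field_simp
    linear_combination -(h1 + h2) / 2
  have h3 := theta3_sub_theta4 (mul_pos two_pos hy)
  rw [ellipticIntegrand, hk, modulus, comodulus]
  have h5 : etaR8 y + 4 * etaR8 (2 * y) =
      etaR (2 * y) ^ 2 * etaR (4 * y) * etaR (8 * y) ^ 2 * theta3 (2 * y) := by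
    rw [sub_eq_iff_eq_add.1 h3, theta2, theta4, etaR8, etaR8, mul_div_cancel_left₀ y two_ne_zero,
      show 2 * (2 * y) = 4 * y by ring, show 4 * (2 * y) = 8 * y by ring,
      show 8 * (2 * y) = 2 * (8 * y) by ring]
    generalize etaR (8 * y) = P at *
    generalize etaR (2 * (8 * y)) = Q at *
    generalize etaR (4 * y) = R at *
    generalize etaR (2 * y) = S at *
    field_simp
    ring
  have h6 : theta2 (4 * y) * theta4 (4 * y) =
      2 * etaR (8 * y) ^ 2 * etaR (2 * y) ^ 2 / etaR (4 * y) ^ 2 := by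
    rw [theta2, theta4, show 2 * (4 * y) = 8 * y by ring, show 4 * y / 2 = 2 * y by ring]
    field_simp
  have h7 : theta3 (4 * y) = etaR (4 * y) ^ 5 / (etaR (2 * y) ^ 2 * etaR (8 * y) ^ 2) := by
    rw [theta3, show 2 * (4 * y) = 8 * y by ring, show 4 * y / 2 = 2 * y by ring]
  rw [h5, show 1 / 4 * (theta3 (4 * y) ^ 6 * (theta2 (4 * y) ^ 2 / theta3 (4 * y) ^ 2) *
    (theta4 (4 * y) ^ 2 / theta3 (4 * y) ^ 2) * (theta3 (2 * y) / theta3 (4 * y))) =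
    1 / 4 * (theta2 (4 * y) * theta4 (4 * y)) ^ 2 * theta3 (4 * y) * theta3 (2 * y) by
      field_simp, h6, h7]
  field_simp
  norm_num

/-- After x = k² the factor √(1 + k) cancels half of √(1 - k²), leaving F(k²) (1 - k)^(-1/2), the
integral evaluated through Thomae's transformation. -/
lemma integral_ellipticIntegrand :
    IntegrableOn ellipticIntegrand (Ioi 0) ∧ ∫ y in Ioi 0, ellipticIntegrand y =
      √2 / 4 * (Real.pi / (Real.Gamma (7 / 8) * Real.Gamma (5 / 8)) ^ 2) := by
  obtain ⟨h1, h2⟩ := integral_hyp_sq_mul_betaIntegrand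
  have hsq (k : ℝ) (hk : k ∈ Ioo (0 : ℝ) 1) : 2 * k * (1 / 4 * (hyp (1 / 2) (k ^ 2) *
      (betaIntegrand (1 / 2) (1 / 2) (k ^ 2) * √(1 + √(k ^ 2))))) =
      1 / 2 * (hyp (1 / 2) (k ^ 2) * betaIntegrand 1 (1 / 2) k) := by
    have h0 : 0 < 1 - k := by linarith [hk.2]
    have h0' : 0 < 1 + k := by linarith [hk.1]
    have hv : √(1 - k ^ 2) ^ 2 = 1 - k ^ 2 := Real.sq_sqrt (by nlinarith [hk.1])
    have hsplit : √(1 - k ^ 2) = √(1 - k) * √(1 + k) := by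
      rw [← Real.sqrt_mul h0.le]
      congr 1
      ring
    rw [betaIntegrand_half_half hk.1.le (Real.sqrt_nonneg _) (by rw [hv]; ring),
      Real.sqrt_sq hk.1.le, hsplit, betaIntegrand, sub_self, Real.rpow_zero, one_mul,
      show (1 / 2 - 1 : ℝ) = -(1 / 2) by norm_num, Real.rpow_neg h0.le, ← Real.sqrt_eq_rpow]
    have := hk.1
    have := Real.sqrt_pos.2 h0
    have := Real.sqrt_pos.2 h0'
    field_simp
    norm_num
  obtain ⟨h3, h4⟩ := integral_comp_sq (Φ := fun x => 1 / 4 * (hyp (1 / 2) x *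
    (betaIntegrand (1 / 2) (1 / 2) x * √(1 + √x)))) hsq (h1.const_mul (1 / 2))
  have h := integral_comp_modulus (a := 1 / 2) (κ := 1) (by norm_num) (by norm_num) one_pos
    (X := fun y => modulus y ^ 2) (fun y => modulus_sq_mem) (fun y => one_mul_hyp_div_hyp)
    (G := ellipticIntegrand) (fun y hy => ?_) h3
  · refine ⟨h.1, ?_⟩
    rw [h.2, h4, integral_const_mul, h2, mul_one_div, Real.sin_pi_div_two]
    have := Real.pi_ne_zero
    field_simp
    norm_num
  · have hk := modulus_pos hy
    have hk' := comodulus_pos hy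
    rw [betaIntegrand_half_half hk.le hk'.le (modulus_sq_add hy),
      ← eq_sub_iff_add_eq'.2 (modulus_sq_add hy), hyp_modulus_sq hy, ellipticIntegrand,
      Real.sqrt_sq hk.le]
    field_simp

lemma continuousOn_etaR : ContinuousOn etaR (Ioi 0) := by
  intro y hy
  have hz : Complex.I * y ∈ UpperHalfPlane.upperHalfPlaneSet := by
    simpa [UpperHalfPlane.upperHalfPlaneSet] using hy
  have h := (ModularForm.differentiableAt_eta_of_mem_upperHalfPlaneSet hz).continuousAt
  have h2 : ContinuousAt (fun y : ℝ => Complex.I * y) y := by fun_prop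
  exact (Complex.continuous_re.continuousAt.comp
    (ContinuousAt.comp (f := fun y : ℝ => Complex.I * y) h h2)).continuousWithinAt

lemma continuousOn_etaR_mul {c : ℝ} (hc : 0 < c) :
    ContinuousOn (fun y => etaR (c * y)) (Ioi 0) :=
  continuousOn_etaR.comp (by fun_prop) fun _ hy => mul_pos hc hy

/-- Both terms of f(y) + 4 f(2y) are positive, so f is dominated by the sum. By scaling the sum
integrates to 1 + 4/2 = 3 times the integral of f. -/
lemma integral_etaR8 : IntegrableOn etaR8 (Ioi 0) ∧ ∫ y in Ioi 0, etaR8 y =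
    √2 / 48 * (Real.pi / (Real.Gamma (7 / 8) * Real.Gamma (5 / 8)) ^ 2) := by
  obtain ⟨h1, h2⟩ := integral_ellipticIntegrand
  obtain ⟨h3, h4⟩ := integral_comp_mul h1 four_pos
  have h5 : IntegrableOn (fun y => etaR8 y + 4 * etaR8 (2 * y)) (Ioi 0) :=
    h3.congr_fun (fun y hy => (etaR8_add hy).symm) measurableSet_Ioi
  have hcont : ContinuousOn etaR8 (Ioi 0) :=
    ((((continuousOn_etaR.pow 2).mul (continuousOn_etaR_mul two_pos)).mul
      (continuousOn_etaR_mul four_pos)).mul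
      ((continuousOn_etaR_mul (by norm_num : (0 : ℝ) < 8)).pow 2))
  have h6 : IntegrableOn etaR8 (Ioi 0) := by
    refine Integrable.mono' h5 (hcont.aestronglyMeasurable measurableSet_Ioi) ?_
    refine (ae_restrict_iff' measurableSet_Ioi).2 (Eventually.of_forall fun y hy => ?_)
    have := etaR8_pos (show 0 < 2 * y from mul_pos two_pos hy)
    rw [Real.norm_of_nonneg (etaR8_pos hy).le]
    linarith
  refine ⟨h6, ?_⟩
  obtain ⟨h7, h8⟩ := integral_comp_mul h6 two_pos
  have h9 : ∫ y in Ioi 0, (etaR8 y + 4 * etaR8 (2 * y)) =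
      ∫ y in Ioi 0, ellipticIntegrand (4 * y) :=
    setIntegral_congr_fun measurableSet_Ioi fun y hy => etaR8_add hy
  rw [integral_add h6 (h7.const_mul 4), integral_const_mul, h8, h4, h2] at h9
  linear_combination h9 / 3

/-! ### Complex hypergeometric series and L-values -/

lemma eval_ascPochhammer_ofReal (x : ℝ) (n : ℕ) :
    (ascPochhammer ℂ n).eval (x : ℂ) = (rising x n : ℝ) := by
  induction n with
  | zero => simp
  | succ n ih =>
    rw [ascPochhammer_succ_eval, ih, rising_succ]
    push_cast
    ring

lemma hasSum_threeFTwoTerm {a b z S : ℝ} (h : HasSum (fun n => clausenCoeff a b n * z ^ n) S) :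
    HasSum (threeFTwoTerm (1 / 2) a b 1 1 z) S := by
  refine HasSum.of_eq (Complex.hasSum_ofReal.2 h) (fun n => ?_) rfl
  have h1 := eval_ascPochhammer_ofReal (1 / 2) n
  have h2 := eval_ascPochhammer_ofReal 1 n
  push_cast at h1 h2
  rw [threeFTwoTerm, h1, h2, eval_ascPochhammer_ofReal, eval_ascPochhammer_ofReal, rising_one,
    clausenCoeff]
  push_cast
  congr 2
  ring

lemma hasSum_threeFTwoTerm_one {a b S : ℝ} (h : HasSum (clausenCoeff a b) S) :
    HasSum (threeFTwoTerm (1 / 2) a b 1 1 1) S := by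
  have h1 := hasSum_threeFTwoTerm (z := 1) (HasSum.of_eq h (fun n => by rw [one_pow, mul_one]) rfl)
  rwa [Complex.ofReal_one] at h1

lemma imagAxis_of_ofReal {f : ℂ → ℂ} {g : ℝ → ℝ} (hf : ∀ y : ℝ, 0 < y → f (Complex.I * y) = g y)
    (hg : IntegrableOn g (Ioi 0)) : ImagAxisIntegrable f ∧
      imagAxisIntegral f = (∫ y in Ioi 0, g y : ℝ) * Complex.I := by
  have h (y : ℝ) (hy : y ∈ Ioi (0 : ℝ)) : f (Complex.I * y) * Complex.I = (g y : ℂ) * Complex.I := by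
    rw [hf y hy]
  refine ⟨IntegrableOn.congr_fun (Integrable.mul_const (Integrable.ofReal hg) Complex.I)
    (fun y hy => (h y hy).symm) measurableSet_Ioi, ?_⟩
  rw [imagAxisIntegral, setIntegral_congr_fun measurableSet_Ioi h, integral_mul_const,
    integral_complex_ofReal]

/-- The L-values of a form of weight three and level `N` that is real on the imaginary axis and
invariant under the Fricke involution. -/
theorem lValues_of_inversion {f : ℂ → ℂ} {g : ℝ → ℝ} {N J : ℝ} (hN : 0 < N)
    (hf : ∀ y : ℝ, 0 < y → f (Complex.I * y) = g y) (hg : IntegrableOn g (Ioi 0))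
    (hJ : ∫ y in Ioi 0, g y = J) (h : ∀ y, 0 < y → g (1 / (N * y)) = N * √N * y ^ 3 * g y) :
    LValuesConverge f ∧ LValueOne f = (2 * Real.pi * J : ℝ) ∧
      LValueTwo f = (4 * Real.pi ^ 2 * (1 / √N * J) : ℝ) := by
  obtain ⟨h1, h2⟩ := imagAxis_of_ofReal hf hg
  obtain ⟨h3, h4⟩ := integral_mul_id_of_inversion hN hg h
  have hft (y : ℝ) (hy : y ∈ Ioi (0 : ℝ)) :
      f (Complex.I * y) * (Complex.I * y) * Complex.I = ((-(g y * y) : ℝ) : ℂ) := by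
    rw [hf y hy]
    push_cast
    linear_combination (g y * y : ℂ) * Complex.I_mul_I
  refine ⟨⟨h1, IntegrableOn.congr_fun (Integrable.ofReal h3.neg)
    (fun y hy => (hft y hy).symm) measurableSet_Ioi⟩, ?_, ?_⟩
  · rw [LValueOne, h2, hJ]
    push_cast
    linear_combination -2 * (Real.pi : ℂ) * J * Complex.I_mul_I
  · rw [LValueTwo, imagAxisIntegral, setIntegral_congr_fun measurableSet_Ioi hft, integral_complex_ofReal,
      integral_neg, h4, hJ]
    push_cast
    ring

lemma eta_natCast_mul_I {y : ℝ} (hy : 0 < y) (n : ℕ) [NeZero n] :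
    ModularForm.eta (n * (Complex.I * y)) = etaR (n * y) := by
  have hn : (0 : ℝ) < n := Nat.cast_pos.2 (Nat.pos_of_ne_zero (NeZero.ne n))
  rw [← eta_I_mul_eq_etaR (mul_pos hn hy)]
  congr 1
  push_cast
  ring

lemma etaForm4_I_mul (y : ℝ) (hy : 0 < y) : etaForm4 (Complex.I * y) = (etaR (4 * y) ^ 6 : ℝ) := by
  have h := eta_natCast_mul_I hy 4
  norm_num at h
  rw [etaForm4, h, Complex.ofReal_pow]

lemma etaForm3_I_mul (y : ℝ) (hy : 0 < y) :
    etaForm3 (Complex.I * y) = (etaR (2 * y) ^ 3 * etaR (3 * (2 * y)) ^ 3 : ℝ) := by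
  have h2 := eta_natCast_mul_I hy 2
  have h6 := eta_natCast_mul_I hy 6
  norm_num at h2 h6
  rw [etaForm3, h2, h6, show 3 * (2 * y) = 6 * y by ring]
  push_cast
  rfl

lemma f83da_I_mul (y : ℝ) (hy : 0 < y) : f83da (Complex.I * y) = etaR8 y := by
  have h2 := eta_natCast_mul_I hy 2
  have h4 := eta_natCast_mul_I hy 4
  have h8 := eta_natCast_mul_I hy 8
  norm_num at h2 h4 h8
  rw [f83da, h2, h4, h8, eta_I_mul_eq_etaR hy, etaR8]
  push_cast
  rfl

lemma sqrt_sq_mul {a b : ℝ} (ha : 0 ≤ a) : √(a ^ 2 * b) = a * √b := by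
  rw [Real.sqrt_mul (sq_nonneg a), Real.sqrt_sq ha]

theorem lValues_etaForm4 {S : ℝ} (hS : HasSum (clausenCoeff (1 / 2) (1 - 1 / 2)) S) :
    LValuesConverge etaForm4 ∧ LValueOne etaForm4 = (Real.pi / 8 * S : ℝ) ∧
      LValueTwo etaForm4 = (Real.pi ^ 2 / 16 * S : ℝ) := by
  obtain ⟨h1, h2⟩ := integral_etaR_pow_six hS
  obtain ⟨h3, h4⟩ := integral_comp_mul h1 four_pos
  rw [h2] at h4
  have hs : √(16 : ℝ) = 4 := by
    rw [show (16 : ℝ) = 4 ^ 2 by norm_num, Real.sqrt_sq (by norm_num)]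
  -- The Fricke involution at level 16; the forms below have levels 12 and 8.
  have hinv (y : ℝ) (hy : 0 < y) : etaR (4 * (1 / (16 * y))) ^ 6 = 16 * √16 * y ^ 3 * etaR (4 * y) ^ 6 := by
    have h := etaR_one_div (mul_pos four_pos hy)
    rw [show 4 * (1 / (16 * y)) = 1 / (4 * y) by field_simp; norm_num, h, hs, mul_pow,
      show √(4 * y) ^ 6 = (√(4 * y) ^ 2) ^ 3 by ring, Real.sq_sqrt (by positivity)]
    ring
  obtain ⟨h5, h6, h7⟩ := lValues_of_inversion (N := 16) (by norm_num) etaForm4_I_mul h3 h4 hinv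
  refine ⟨h5, h6.trans ?_, h7.trans ?_⟩
  · congr 1
    ring
  · rw [hs]
    congr 1
    ring

theorem lValues_etaForm3 {S : ℝ} (hS : HasSum (clausenCoeff (1 / 3) (1 - 1 / 3)) S) :
    LValuesConverge etaForm3 ∧ LValueOne etaForm3 = (Real.pi * √3 / 18 * S : ℝ) ∧
      LValueTwo etaForm3 = (Real.pi ^ 2 / 18 * S : ℝ) := by
  obtain ⟨h1, h2⟩ := integral_etaR_cube_mul hS
  obtain ⟨h3, h4⟩ := integral_comp_mul h1 two_pos
  rw [h2] at h4
  have hs : √(12 : ℝ) = 2 * √3 := by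
    rw [show (12 : ℝ) = 2 ^ 2 * 3 by norm_num, sqrt_sq_mul (by norm_num)]
  have hinv (y : ℝ) (hy : 0 < y) : etaR (2 * (1 / (12 * y))) ^ 3 * etaR (3 * (2 * (1 / (12 * y)))) ^ 3 =
      12 * √12 * y ^ 3 * (etaR (2 * y) ^ 3 * etaR (3 * (2 * y)) ^ 3) := by
    have ha := etaR_one_div (show 0 < 6 * y by positivity)
    have hb := etaR_one_div (mul_pos two_pos hy)
    rw [show 3 * (2 * (1 / (12 * y))) = 1 / (2 * y) by field_simp; norm_num,
      show 2 * (1 / (12 * y)) = 1 / (6 * y) by field_simp; norm_num, ha, hb,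
      show 3 * (2 * y) = 6 * y by ring]
    have hq : √(6 * y) * √(2 * y) = √12 * y := by
      rw [← Real.sqrt_mul (by positivity), show 6 * y * (2 * y) = y ^ 2 * 12 by ring,
        sqrt_sq_mul hy.le, mul_comm]
    have h12 := Real.sq_sqrt (show (0 : ℝ) ≤ 12 by norm_num)
    calc _ = (√(6 * y) * √(2 * y)) ^ 3 * (etaR (2 * y) ^ 3 * etaR (6 * y) ^ 3) := by ring
      _ = _ := by
        rw [hq]
        linear_combination (√12 * y ^ 3 * (etaR (2 * y) ^ 3 * etaR (6 * y) ^ 3)) * h12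
  obtain ⟨h5, h6, h7⟩ := lValues_of_inversion (N := 12) (by norm_num) etaForm3_I_mul h3 h4 hinv
  refine ⟨h5, h6.trans ?_, h7.trans ?_⟩
  · congr 1
    ring
  · rw [hs]
    congr 1
    field_simp
    norm_num

theorem lValues_f83da : LValuesConverge f83da ∧
    LValueOne f83da =
      (Real.pi * √2 / 24 * (Real.pi / (Real.Gamma (7 / 8) * Real.Gamma (5 / 8)) ^ 2) : ℝ) ∧
    LValueTwo f83da =
      (Real.pi ^ 2 / 24 * (Real.pi / (Real.Gamma (7 / 8) * Real.Gamma (5 / 8)) ^ 2) : ℝ) := by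
  obtain ⟨h3, h4⟩ := integral_etaR8
  have hs : √(8 : ℝ) = 2 * √2 := by
    rw [show (8 : ℝ) = 2 ^ 2 * 2 by norm_num, sqrt_sq_mul (by norm_num)]
  have hinv (y : ℝ) (hy : 0 < y) : etaR8 (1 / (8 * y)) = 8 * √8 * y ^ 3 * etaR8 y := by
    have ha := etaR_one_div (show 0 < 8 * y by positivity)
    have hb := etaR_one_div (mul_pos four_pos hy)
    have hc := etaR_one_div (mul_pos two_pos hy)
    have hd := etaR_one_div hy
    rw [etaR8, etaR8, show 2 * (1 / (8 * y)) = 1 / (4 * y) by field_simp; norm_num,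
      show 4 * (1 / (8 * y)) = 1 / (2 * y) by field_simp; norm_num,
      show 8 * (1 / (8 * y)) = 1 / y by field_simp, ha, hb, hc, hd]
    have hq : √(4 * y) * √(2 * y) = √8 * y := by
      rw [← Real.sqrt_mul (by positivity), show 4 * y * (2 * y) = y ^ 2 * 8 by ring,
        sqrt_sq_mul hy.le, mul_comm]
    have h8 := Real.sq_sqrt (show 0 ≤ 8 * y by positivity)
    have h1 := Real.sq_sqrt hy.le
    calc _ = √(8 * y) ^ 2 * √y ^ 2 * (√(4 * y) * √(2 * y)) *
          (etaR y ^ 2 * etaR (2 * y) * etaR (4 * y) * etaR (8 * y) ^ 2) := by ring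
      _ = _ := by
        rw [hq, h8, h1]
        ring
  obtain ⟨h5, h6, h7⟩ := lValues_of_inversion (N := 8) (by norm_num) f83da_I_mul h3 h4 hinv
  refine ⟨h5, h6.trans ?_, h7.trans ?_⟩
  · congr 1
    ring
  · rw [hs]
    congr 1
    generalize Real.pi / (Real.Gamma (7 / 8) * Real.Gamma (5 / 8)) ^ 2 = S
    field_simp
    ring

lemma exists_hasSum_threeFTwo {a : ℝ} (ha : 0 < a) (ha1 : a < 1) :
    ∃ S : ℝ, HasSum (clausenCoeff a (1 - a)) S ∧
      S = Real.pi / (Real.Gamma (1 - a / 2) * Real.Gamma ((1 + a) / 2)) ^ 2 ∧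
      HasSum (threeFTwoTerm (1 / 2) a (1 - a) 1 1 1) S := by
  refine ⟨_, hasSum_clausenCoeff ha ha1, rfl, ?_⟩
  have h := hasSum_threeFTwoTerm_one (hasSum_clausenCoeff ha ha1)
  rwa [Complex.ofReal_sub, Complex.ofReal_one] at h

lemma hasSum_threeFTwo_neg_one : HasSum (threeFTwoTerm (1 / 2) (1 / 2) (1 / 2) 1 1 (-1))
    ((Real.Gamma (1 / 8) / (2 * Real.Gamma (1 / 4) * Real.Gamma (7 / 8))) ^ 2 : ℝ) := by
  have h := hasSum_threeFTwoTerm hasSum_clausenCoeff_neg_one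
  rwa [Complex.ofReal_div, Complex.ofReal_neg, Complex.ofReal_one, Complex.ofReal_ofNat] at h

end HypergeometricLValues

/-! ### Assembly of the theorem. -/

theorem mainTheorem9 :
    -- all series and integrals involved converge
    (HypergeometricLValues.ThreeFTwoConverges (1 / 2) (1 / 2) (1 / 2) 1 1 1 ∧
      HypergeometricLValues.ThreeFTwoConverges (1 / 2) (1 / 6) (5 / 6) 1 1 1 ∧
      HypergeometricLValues.ThreeFTwoConverges (1 / 2) (1 / 3) (2 / 3) 1 1 1 ∧
      HypergeometricLValues.ThreeFTwoConverges (1 / 2) (1 / 4) (3 / 4) 1 1 1 ∧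
      HypergeometricLValues.ThreeFTwoConverges (1 / 2) (1 / 2) (1 / 2) 1 1 (-1)) ∧
    (HypergeometricLValues.LValuesConverge HypergeometricLValues.etaForm4 ∧
      HypergeometricLValues.LValuesConverge HypergeometricLValues.etaForm3 ∧
      HypergeometricLValues.LValuesConverge HypergeometricLValues.f83da) ∧
    -- the cases d = 2 and d = 6
    (HypergeometricLValues.threeFTwo (1 / 2) (1 / 2) (1 / 2) 1 1 1 =
        2 / (Real.sqrt 3 : ℂ) *
          HypergeometricLValues.threeFTwo (1 / 2) (1 / 6) (5 / 6) 1 1 1 ∧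
      HypergeometricLValues.threeFTwo (1 / 2) (1 / 2) (1 / 2) 1 1 1 =
        8 / (Real.pi : ℂ) *
          HypergeometricLValues.LValueOne HypergeometricLValues.etaForm4 ∧
      HypergeometricLValues.threeFTwo (1 / 2) (1 / 2) (1 / 2) 1 1 1 =
        16 / (Real.pi : ℂ) ^ 2 *
          HypergeometricLValues.LValueTwo HypergeometricLValues.etaForm4) ∧
    -- the case d = 3
    (HypergeometricLValues.threeFTwo (1 / 2) (1 / 3) (2 / 3) 1 1 1 =
        6 * (Real.sqrt 3 : ℂ) / (Real.pi : ℂ) *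
          HypergeometricLValues.LValueOne HypergeometricLValues.etaForm3 ∧
      HypergeometricLValues.threeFTwo (1 / 2) (1 / 3) (2 / 3) 1 1 1 =
        18 / (Real.pi : ℂ) ^ 2 *
          HypergeometricLValues.LValueTwo HypergeometricLValues.etaForm3) ∧
    -- the case d = 4
    (HypergeometricLValues.threeFTwo (1 / 2) (1 / 4) (3 / 4) 1 1 1 =
        (Real.sqrt 2 : ℂ) *
          HypergeometricLValues.threeFTwo (1 / 2) (1 / 2) (1 / 2) 1 1 (-1) ∧
      HypergeometricLValues.threeFTwo (1 / 2) (1 / 4) (3 / 4) 1 1 1 =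
        12 * (Real.sqrt 2 : ℂ) / (Real.pi : ℂ) *
          HypergeometricLValues.LValueOne HypergeometricLValues.f83da ∧
      HypergeometricLValues.threeFTwo (1 / 2) (1 / 4) (3 / 4) 1 1 1 =
        24 / (Real.pi : ℂ) ^ 2 *
          HypergeometricLValues.LValueTwo HypergeometricLValues.f83da) := by
  obtain ⟨S2, h2, e2, c2⟩ := HypergeometricLValues.exists_hasSum_threeFTwo (a := 1 / 2)
    (by norm_num) (by norm_num)
  obtain ⟨S6, h6, e6, c6⟩ := HypergeometricLValues.exists_hasSum_threeFTwo (a := 1 / 6)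
    (by norm_num) (by norm_num)
  obtain ⟨S3, h3, e3, c3⟩ := HypergeometricLValues.exists_hasSum_threeFTwo (a := 1 / 3)
    (by norm_num) (by norm_num)
  obtain ⟨S4, h4, e4, c4⟩ := HypergeometricLValues.exists_hasSum_threeFTwo (a := 1 / 4)
    (by norm_num) (by norm_num)
  have cm := HypergeometricLValues.hasSum_threeFTwo_neg_one
  norm_num only [Complex.ofReal_div, Complex.ofReal_one, Complex.ofReal_ofNat]
    at c2 c6 c3 c4 e2 e6 e4
  obtain ⟨l1, l2, l3⟩ := HypergeometricLValues.lValues_etaForm4 h2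
  obtain ⟨m1, m2, m3⟩ := HypergeometricLValues.lValues_etaForm3 h3
  obtain ⟨n1, n2, n3⟩ := HypergeometricLValues.lValues_f83da
  rw [← e4] at n2 n3
  have g34 := Real.Gamma_pos_of_pos (show (0 : ℝ) < 3 / 4 by norm_num)
  have g14 := Real.Gamma_pos_of_pos (show (0 : ℝ) < 1 / 4 by norm_num)
  have g78 := Real.Gamma_pos_of_pos (show (0 : ℝ) < 7 / 8 by norm_num)
  have g58 := Real.Gamma_pos_of_pos (show (0 : ℝ) < 5 / 8 by norm_num)
  have hπ := Real.pi_pos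
  have hs2 := Real.sq_sqrt (show (0 : ℝ) ≤ 2 by norm_num)
  have hs3 := Real.sq_sqrt (show (0 : ℝ) ≤ 3 by norm_num)
  -- From here on only the Gamma values matter: for a = 1/2 they are Γ(3/4)⁴, for a = 1/6 the
  -- product at 11/12 and 7/12.
  have k6 : S2 = 2 / √3 * S6 := by
    rw [e2, e6, HypergeometricLValues.sq_Gamma_mul_Gamma_twelfths]
    field_simp
  have k4 : S4 = √2 *
      (Real.Gamma (1 / 8) / (2 * Real.Gamma (1 / 4) * Real.Gamma (7 / 8))) ^ 2 := by
    have h := HypergeometricLValues.sq_Gamma_mul_Gamma_eighths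
    rw [e4]
    field_simp
    linear_combination (-√2) * h - 2 * Real.pi * Real.Gamma (1 / 4) ^ 2 * hs2
  refine ⟨⟨c2.summable, c6.summable, c3.summable, c4.summable, cm.summable⟩, ⟨l1, m1, n1⟩,
    ?_, ?_, ?_⟩
  · rw [HypergeometricLValues.threeFTwo, c2.tsum_eq, HypergeometricLValues.threeFTwo, c6.tsum_eq,
      l2, l3]
    norm_cast
    refine ⟨k6, ?_, ?_⟩
    · field_simp
    · field_simp
  · rw [HypergeometricLValues.threeFTwo, c3.tsum_eq, m2, m3]
    norm_cast
    constructor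
    · field_simp
      linear_combination (-6 * S3) * hs3
    · field_simp
  · rw [HypergeometricLValues.threeFTwo, c4.tsum_eq, HypergeometricLValues.threeFTwo, cm.tsum_eq,
      n2, n3]
    norm_cast
    refine ⟨k4, ?_, ?_⟩
    · field_simp
      linear_combination (-12 * S4) * hs2
    · field_simp
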